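/- Let $d\ge 1$ and let $\mathcal M^+(\mathbb R^d)$ be the set of finite non-negative Borel measures on $\mathbb R^d$. For $\mu\in\mathcal M^+(\mathbb R^d)$ put $\widehat\mu(\xi)=\int e^{-2\pi i\langle x,\xi\rangle}\,d\mu(x)$. For $\alpha,\beta>0$ and $\mu\ne 0$ let $$C_{\alpha,\beta,d}(\mu)=\frac{\big\|\widehat\mu(\xi)|\xi|^\beta\big\|_\infty^{\alpha}\,\big(\int|x|^\alpha\,d\mu\big)^{\beta}}{\mu(\mathbb R^d)^{\alpha+\beta}},$$ with $C_{\alpha,\beta,d}(\mu)=\infty$ if $\|\widehat\mu(\xi)|\xi|^\beta\|_\infty=\infty$, and let $C^*_{\alpha,\beta,d}=\inf_{0\ne\mu\in\mathcal M^+(\mathbb R^d)}C_{\alpha,\beta,d}(\mu)$. A measure $0\neq\mu\in\mathcal M^+(\mathbb R^d)$ is an extremizer for $(\alpha,\beta,d)$ if $C_{\alpha,\beta,d}(\mu)=C^*_{\alpha,\beta,d}$. A measure is radial if it is invariant under the orthogonal group $O(d)$. A rescaling of a measure $\nu$ is a measure $c\cdot(x\mapsto tx)_*\nu$ with $c,t>0$.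 A non-negative function $f$ is identified with the measure $f\,dx$. Then: 1. For every $\alpha\ge2$, the extremizers for $(\alpha,1,1)$ are exactly the rescalings of $f_1=\mathbb 1_{[-1/2,1/2]}$. 2. The radial extremizers for $(1,2,1)$ are exactly the rescalings of $f_2(x)=(1-|x|)\mathbb 1_{[-1,1]}(x)$. 3. The radial extremizers for $(1,2,3)$ are exactly the rescalings of $f_3(x)=|x|^{-1}\mathbb 1_{[0,1]}(|x|)$. 4. If either $\beta=1$ and $\alpha\ge(\frac\pi2-1)^{-1}$, or $0<\beta<1$ and $\alpha\ge2$, the radial extremizers for $(\alpha,\beta,3)$ are exactly the rescalings of the surface measure $\mu_4=\delta_{\mathbb S^2}$ of the unit sphere. Non-radial extremizers also exist for $(1,2,1)$ and for $(1,2,3)$. For $(1,2,1)$ there is $\varepsilon_0>0$ such that for all real $\varepsilon$ with $|\varepsilon|<\varepsilon_0$ the function $\tilde f_2(x)=f_2(x)+\varepsilon\,\mathbb 1_{[-1,1]}(x)\sin(2\pi x)$ is non-negative and is an extremizer, and it is not radial if $\varepsilon\ne0$. -/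

import Mathlib

open MeasureTheory Set
open scoped ENNReal NNReal

noncomputable section

namespace FourierUncertainty

/-! The ambient space `E` is used for `ℝ` (dimension one) and for
`EuclideanSpace ℝ (Fin 3)` (dimension three). -/

/-- The Fourier transform `ξ ↦ ∫ exp (-2πi⟨x, ξ⟩) dμ(x)` of a finite measure. -/
def fourier {E : Type*} [NormedAddCommGroup E] [InnerProductSpace ℝ E] [MeasurableSpace E]
    (μ : Measure E) (ξ : E) : ℂ :=
  ∫ x, Complex.exp (((-2 * Real.pi * inner ℝ x ξ : ℝ) : ℂ) * Complex.I) ∂μ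

/-- The norm `‖μ̂(ξ) |ξ|^β‖_∞` as an extended non-negative number. For a finite measure and
`β > 0` the function `μ̂(ξ) |ξ|^β` is continuous, so the essential supremum is the supremum. -/
def fourierNorm {E : Type*} [NormedAddCommGroup E] [InnerProductSpace ℝ E] [MeasurableSpace E]
    (β : ℝ) (μ : Measure E) : ℝ≥0∞ :=
  ⨆ ξ : E, ‖fourier μ ξ‖ₑ * ‖ξ‖ₑ ^ β

/-- The moment `∫ |x|^α dμ`. -/
def moment {E : Type*} [NormedAddCommGroup E] [MeasurableSpace E]
    (α : ℝ) (μ : Measure E) : ℝ≥0∞ :=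
  ∫⁻ x, ‖x‖ₑ ^ α ∂μ

open Classical in
/-- The functional `C_{α,β}(μ)`, equal to `∞` when `‖μ̂(ξ) |ξ|^β‖_∞ = ∞`. -/
def functional {E : Type*} [NormedAddCommGroup E] [InnerProductSpace ℝ E] [MeasurableSpace E]
    (α β : ℝ) (μ : Measure E) : ℝ≥0∞ :=
  if fourierNorm β μ = ∞ then ∞
  else fourierNorm β μ ^ α * moment α μ ^ β / μ univ ^ (α + β)

/-- The optimal constant: the infimum of the functional over non-zero finite measures on `E`. -/
def optimalConstant (E : Type*) [NormedAddCommGroup E] [InnerProductSpace ℝ E]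
    [MeasurableSpace E] (α β : ℝ) : ℝ≥0∞ :=
  ⨅ (μ : Measure E) (_ : IsFiniteMeasure μ) (_ : μ ≠ 0), functional α β μ

/-- A non-zero finite measure at which the infimum is attained. -/
def IsExtremizer {E : Type*} [NormedAddCommGroup E] [InnerProductSpace ℝ E] [MeasurableSpace E]
    (α β : ℝ) (μ : Measure E) : Prop :=
  IsFiniteMeasure μ ∧ μ ≠ 0 ∧ functional α β μ = optimalConstant E α β

/-- A measure is radial if it is invariant under all linear isometries of the space. -/
def IsRadial {E : Type*} [NormedAddCommGroup E] [InnerProductSpace ℝ E] [MeasurableSpace E]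
    (μ : Measure E) : Prop :=
  ∀ R : E ≃ₗᵢ[ℝ] E, μ.map (fun x => R x) = μ

/-- `μ` is obtained from `ν` by a dilation `x ↦ t x` and multiplication by a constant `c`. -/
def IsRescaling {E : Type*} [NormedAddCommGroup E] [InnerProductSpace ℝ E] [MeasurableSpace E]
    (μ ν : Measure E) : Prop :=
  ∃ (c : ℝ≥0) (t : ℝ), 0 < c ∧ 0 < t ∧ μ = c • ν.map (fun x => t • x)

/-- The measure with density `f` (used for non-negative `f`). -/
def ofDensity {E : Type*} [MeasureSpace E] (f : E → ℝ) : Measure E :=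
  (volume : Measure E).withDensity (fun x => ENNReal.ofReal (f x))

/-- The indicator function of `[-1/2, 1/2]`. -/
def f₁ : ℝ → ℝ := (Icc (-(1 / 2)) (1 / 2)).indicator (fun _ => 1)

/-- The hat function `(1 - |x|) 1_{[-1,1]}(x)`. -/
def f₂ : ℝ → ℝ := (Icc (-1) 1).indicator (fun x => 1 - |x|)

/-- The perturbation `f₂(x) + ε 1_{[-1,1]}(x) sin (2πx)`. -/
def f₂Tilde (ε : ℝ) : ℝ → ℝ := fun x =>
  f₂ x + ε * (Icc (-1) 1).indicator (fun y => Real.sin (2 * Real.pi * y)) x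

/-- The function `|x|⁻¹ 1_{[0,1]}(|x|)` on three-dimensional space. -/
def f₃ : EuclideanSpace ℝ (Fin 3) → ℝ :=
  (Metric.closedBall 0 1).indicator (fun x => ‖x‖⁻¹)

/-- The surface measure of the unit sphere in three-dimensional space. -/
def μ₄ : Measure (EuclideanSpace ℝ (Fin 3)) :=
  (volume : Measure (EuclideanSpace ℝ (Fin 3))).toSphere.map Subtype.val

end FourierUncertainty

end

open MeasureTheory Set
open scoped ENNReal NNReal

noncomputable section

namespace FourierUncertainty

/-! ### Fourier transform and Fourier norm of a finite measure -/

section Basic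

variable {E : Type*} [NormedAddCommGroup E] [InnerProductSpace ℝ E] [MeasurableSpace E]

/-! The functional is unchanged by dilations and scalar multiples, so a competitor `μ` with finite
Fourier norm can be normalised to have the mass and the Fourier norm of the candidate `ν`
(`exists_rescale`). What remains is to minimise the moment under upper bounds on |μ̂(ξ)||ξ|^β, a
linear programme. Each candidate is certified by a dual solution (`lintegral_le_of_dual`): a
minorant c - Σ d_k e_k of |x|^α with d_k > 0, exact on the support of `ν`, where the norm bound
forces ∫ e_k dμ ≤ ∫ e_k dν. If the moments agree, complementary slackness gives equality of all
these integrals and confines `μ` to the contact set.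

The test frequencies are the points where |ν̂(ξ)||ξ|^β attains its maximum. For `f₁`, `f₂` and `f₃`
these are the half-integers, and the minorants are explicit waves. For `f₁` it is the antiperiodic
extension of (1/2)^α - |x|^α: its signed cosine coefficients are positive for α ≥ 2
(`powerCoeff_pos`), and strict convexity of the power handles |x| > 1/2 (`sub_powerWave_lt`). For
`f₂` it is the triangle wave. In dimension three, averaging over spheres replaces cosines by sinc
(`integral_sphere_weighted`), and for `f₃` the wave, multiplied by r, is the antiperiodic extension
of x(1 - x).

For the sphere a single frequency suffices: s maximises t^β |sinc t|, and tangency at r = 1 fixes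
the multiplier. The minorant is then an inequality for sinc. For α ≥ 2 it follows because sinc lies
above its tangents as a function of the squared variable (`sinc_sub_sinc_lt`). For β = 1 it follows
from a one-variable maximisation (`sub_sin_lt`), and the threshold exponent is the one at which the
minorant also touches at the origin.

Uniqueness for the first three candidates: the equalities at the frequencies (2k+1)π are only half
of the data needed. For `f₁` the other half is the vanishing of the imaginary part of μ̂ when its
real part saturates the bound. For `f₂` and `f₃` it is a critical point equation, since the
saturated quantity is maximal there (`integral_mul_sin_of_maximum`, `integral_cos_of_maximum`).
`eq_of_trig_moments` combines the two halves on [0, 1].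

For `f₂` and `f₃` this determines only the radial part. An odd perturbation whose transform carries
the factor cos(π|ξ|) is harmless: the real part is B sin²(π|ξ|), the imaginary part is at most
B|cos(π|ξ|)|, and the modulus stays below B (`sq_add_sq_le_of_cos`). This gives the non-radial
extremizers. -/

lemma fourier_eq_charFun (μ : Measure E) (ξ : E) :
    fourier μ ξ = charFun μ ((-2 * Real.pi) • ξ) := by
  simp only [fourier, charFun_apply, inner_smul_right]

lemma fourier_zero (μ : Measure E) : fourier μ 0 = μ.real univ := by
  simp [fourier]

lemma norm_fourier_mul_le {β : ℝ} (hβ : 0 ≤ β) {μ : Measure E} {A : ℝ} (hA : 0 ≤ A)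
    (h : fourierNorm β μ ≤ ENNReal.ofReal A) (ξ : E) : ‖fourier μ ξ‖ * ‖ξ‖ ^ β ≤ A := by
  have h1 : ‖fourier μ ξ‖ₑ * ‖ξ‖ₑ ^ β ≤ ENNReal.ofReal A :=
    (le_iSup (fun ξ : E => ‖fourier μ ξ‖ₑ * ‖ξ‖ₑ ^ β) ξ).trans h
  rw [← ofReal_norm, ← ofReal_norm, ENNReal.ofReal_rpow_of_nonneg (norm_nonneg _) hβ,
    ← ENNReal.ofReal_mul (norm_nonneg _)] at h1
  exact (ENNReal.ofReal_le_ofReal_iff hA).1 h1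

lemma fourierNorm_le {β : ℝ} (hβ : 0 ≤ β) {μ : Measure E} {A : ℝ}
    (h : ∀ ξ : E, ‖fourier μ ξ‖ * ‖ξ‖ ^ β ≤ A) : fourierNorm β μ ≤ ENNReal.ofReal A := by
  refine iSup_le fun ξ => ?_
  rw [← ofReal_norm, ← ofReal_norm, ENNReal.ofReal_rpow_of_nonneg (norm_nonneg _) hβ,
    ← ENNReal.ofReal_mul (norm_nonneg _)]
  exact ENNReal.ofReal_le_ofReal (h ξ)

variable [BorelSpace E] [SecondCountableTopology E]

lemma continuous_fourier (μ : Measure E) [IsFiniteMeasure μ] : Continuous (fourier μ) := by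
  have : fourier μ = fun ξ => charFun μ ((-2 * Real.pi) • ξ) := by
    ext ξ; exact fourier_eq_charFun μ ξ
  rw [this]
  exact continuous_charFun.comp (by fun_prop)

lemma ext_of_fourier [CompleteSpace E] {μ ν : Measure E} [IsFiniteMeasure μ] [IsFiniteMeasure ν]
    (h : ∀ ξ, fourier μ ξ = fourier ν ξ) : μ = ν := by
  apply Measure.ext_of_charFun
  ext t
  have := h ((-2 * Real.pi)⁻¹ • t)
  rw [fourier_eq_charFun, fourier_eq_charFun, smul_smul,
    mul_inv_cancel₀ (by simp [Real.pi_ne_zero]),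
    one_smul] at this
  exact this

/-- Vanishing of the norm kills the transform away from the origin, and continuity then kills its
value at 0, which is the total mass. -/
lemma fourierNorm_ne_zero [Nontrivial E] (β : ℝ) {μ : Measure E} [IsFiniteMeasure μ]
    (hμ : μ ≠ 0) : fourierNorm β μ ≠ 0 := by
  intro h
  have h0 : ∀ ξ : E, ξ ≠ 0 → fourier μ ξ = 0 := by
    intro ξ hξ
    have h1 : ‖fourier μ ξ‖ₑ * ‖ξ‖ₑ ^ β = 0 := by
      have := le_iSup (fun ξ : E => ‖fourier μ ξ‖ₑ * ‖ξ‖ₑ ^ β) ξ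
      rw [fourierNorm] at h
      rw [h] at this
      exact le_antisymm this bot_le
    rcases mul_eq_zero.1 h1 with h2 | h2
    · simpa using h2
    · exfalso
      have := ENNReal.rpow_pos (p := β) (show 0 < ‖ξ‖ₑ by simpa using hξ) (by simp)
      exact this.ne' h2
  have h1 : (univ : Set E).EqOn (fourier μ) (fun _ => 0) := by
    have hd : Dense ({0}ᶜ : Set E) := by
      have : (nhdsWithin (0 : E) {0}ᶜ).NeBot := Module.punctured_nhds_neBot ℝ E 0
      exact dense_compl_singleton 0
    intro x _
    have := (continuous_fourier μ).ext_on hd continuous_const (g := fun _ => 0)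
      (fun ξ hξ => h0 ξ hξ)
    rw [this]
  have h2 := h1 (mem_univ 0)
  rw [fourier_zero] at h2
  have h3 : μ.real univ = 0 := by simpa using h2
  rw [measureReal_eq_zero_iff] at h3
  exact hμ (Measure.measure_univ_eq_zero.1 h3)

end Basic

/-! ### Invariance of the functional and normalisation of competitors -/

section Rescaling

variable {E : Type*} [NormedAddCommGroup E] [InnerProductSpace ℝ E] [MeasurableSpace E]

/-- The measure `c • (x ↦ t x)_* ν`. -/
def rescale (c : ℝ≥0) (t : ℝ) (ν : Measure E) : Measure E := c • ν.map (fun x => t • x)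

lemma rescale_one (ν : Measure E) : rescale 1 1 ν = ν := by
  simp [rescale]

lemma isRescaling_iff {μ ν : Measure E} :
    IsRescaling μ ν ↔ ∃ (c : ℝ≥0) (t : ℝ), 0 < c ∧ 0 < t ∧ μ = rescale c t ν := Iff.rfl

lemma functional_le_of_moment_le {α β : ℝ} (hα : 0 < α) (hβ : 0 < β) {μ ν : Measure E}
    (hu : ν univ = μ univ) (hF : fourierNorm β ν ≤ fourierNorm β μ)
    (hM : moment α ν ≤ moment α μ) : functional α β ν ≤ functional α β μ := by
  unfold functional
  by_cases h : fourierNorm β μ = ∞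
  · simp [h]
  · rw [if_neg h, if_neg (ne_top_of_le_ne_top h hF), hu]
    gcongr

variable [BorelSpace E]

instance (c : ℝ≥0) (t : ℝ) (ν : Measure E) [IsFiniteMeasure ν] :
    IsFiniteMeasure (rescale c t ν) := by
  unfold rescale; infer_instance

lemma rescale_univ (c : ℝ≥0) (t : ℝ) (ν : Measure E) : rescale c t ν univ = c * ν univ := by
  rw [rescale, Measure.smul_apply, Measure.map_apply (by fun_prop) MeasurableSet.univ]
  rfl

lemma rescale_rescale (c c' : ℝ≥0) (t t' : ℝ) (ν : Measure E) :
    rescale c t (rescale c' t' ν) = rescale (c * c') (t * t') ν := by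
  rw [rescale, rescale, rescale, Measure.map_smul, Measure.map_map (by fun_prop) (by fun_prop),
    smul_smul]
  congr 2
  ext x
  simp [smul_smul]

lemma fourier_rescale (c : ℝ≥0) (t : ℝ) (ν : Measure E) (ξ : E) :
    fourier (rescale c t ν) ξ = c * fourier ν (t • ξ) := by
  rw [fourier, rescale, integral_smul_nnreal_measure, integral_map (by fun_prop)]
  · simp only [inner_smul_left, fourier, inner_smul_right]
    rfl
  · apply Measurable.aestronglyMeasurable
    have : Measurable fun x : E => inner ℝ x ξ := by
      have h : Continuous fun x : E => inner ℝ x ξ := by fun_prop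
      exact h.measurable
    fun_prop

lemma fourierNorm_rescale {β : ℝ} (c : ℝ≥0) {t : ℝ} (ht : 0 < t) (ν : Measure E) :
    fourierNorm β (rescale c t ν) = c * ENNReal.ofReal t ^ (-β) * fourierNorm β ν := by
  have h0 : ENNReal.ofReal t ≠ 0 := by simpa using ht
  have hts : ∀ ξ : E, ‖t • ξ‖ₑ = ENNReal.ofReal t * ‖ξ‖ₑ := by
    intro ξ
    rw [enorm_smul, Real.enorm_eq_ofReal ht.le]
  rw [fourierNorm, fourierNorm, ENNReal.mul_iSup]
  apply le_antisymm
  · refine iSup_le fun ξ => le_iSup_of_le (t • ξ) ?_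
    rw [fourier_rescale, enorm_mul, hts, ENNReal.mul_rpow_of_ne_top (by simp) (by simp)]
    have : ‖((c : ℝ≥0) : ℂ)‖ₑ = c := by
      rw [enorm_eq_nnnorm]; simp
    rw [this]
    apply le_of_eq
    calc _ = (ENNReal.ofReal t ^ (-β) * ENNReal.ofReal t ^ β) *
          (c * ‖fourier ν (t • ξ)‖ₑ * ‖ξ‖ₑ ^ β) := by
            rw [← ENNReal.rpow_add _ _ h0 (by simp)]; simp
      _ = _ := by ring
  · refine iSup_le fun ξ => le_iSup_of_le (t⁻¹ • ξ) ?_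
    rw [fourier_rescale, enorm_mul, smul_smul, mul_inv_cancel₀ ht.ne', one_smul]
    have : ‖((c : ℝ≥0) : ℂ)‖ₑ = c := by
      rw [enorm_eq_nnnorm]; simp
    rw [this]
    have h2 : ‖ξ‖ₑ = ENNReal.ofReal t * ‖t⁻¹ • ξ‖ₑ := by
      rw [← hts, smul_smul, mul_inv_cancel₀ ht.ne', one_smul]
    rw [h2, ENNReal.mul_rpow_of_ne_top (by simp) (by simp)]
    apply le_of_eq
    symm
    calc _ = (ENNReal.ofReal t ^ (-β) * ENNReal.ofReal t ^ β) *
          (c * ‖fourier ν ξ‖ₑ * ‖t⁻¹ • ξ‖ₑ ^ β) := by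
            rw [← ENNReal.rpow_add _ _ h0 (by simp)]; simp
      _ = _ := by ring

lemma moment_rescale {α : ℝ} (c : ℝ≥0) {t : ℝ} (ht : 0 < t) (ν : Measure E) :
    moment α (rescale c t ν) = c * ENNReal.ofReal t ^ α * moment α ν := by
  have h0 : ENNReal.ofReal t ≠ 0 := by simpa using ht
  rw [moment, rescale, lintegral_smul_measure, lintegral_map (by fun_prop) (by fun_prop), moment]
  have : ∀ x : E, ‖t • x‖ₑ ^ α = ENNReal.ofReal t ^ α * ‖x‖ₑ ^ α := by
    intro x
    rw [enorm_smul, Real.enorm_eq_ofReal ht.le, ENNReal.mul_rpow_of_ne_top (by simp) (by simp)]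
  simp_rw [this]
  rw [lintegral_const_mul _ (by fun_prop), mul_assoc]
  rfl

/-- The dilation contributes `t ^ (-β * α)` through the norm and `t ^ (α * β)` through the moment,
which cancel. The powers of `c` add up to the exponent `α + β` of the mass. -/
lemma functional_rescale {α β : ℝ} (hα : 0 < α) (hβ : 0 < β) {c : ℝ≥0} (hc : 0 < c) {t : ℝ}
    (ht : 0 < t) (ν : Measure E) : functional α β (rescale c t ν) = functional α β ν := by
  have h0 : ENNReal.ofReal t ≠ 0 := by simpa using ht
  have hc0 : (c : ℝ≥0∞) ≠ 0 := by simpa using hc.ne'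
  have htβ0 : ENNReal.ofReal t ^ (-β) ≠ 0 := (ENNReal.rpow_pos (pos_iff_ne_zero.2 h0) (by simp)).ne'
  have htβ1 : ENNReal.ofReal t ^ (-β) ≠ ∞ := by
    simp [ENNReal.rpow_eq_top_iff, h0]
  have hcc : (c : ℝ≥0∞) ^ (α + β) ≠ 0 := (ENNReal.rpow_pos (pos_iff_ne_zero.2 hc0) (by simp)).ne'
  have hcc' : (c : ℝ≥0∞) ^ (α + β) ≠ ∞ := by
    simp [ENNReal.rpow_eq_top_iff, hc.ne']
  unfold functional
  rw [fourierNorm_rescale c ht, moment_rescale c ht, rescale_univ]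
  have hiff : (c * ENNReal.ofReal t ^ (-β) * fourierNorm β ν = ∞) ↔ fourierNorm β ν = ∞ := by
    constructor
    · intro h
      by_contra h'
      exact (ENNReal.mul_ne_top (ENNReal.mul_ne_top (by simp) htβ1) h') h
    · intro h
      rw [h, ENNReal.mul_top (mul_ne_zero hc0 htβ0)]
  by_cases hF : fourierNorm β ν = ∞
  · rw [if_pos (hiff.2 hF), if_pos hF]
  · rw [if_neg (fun h => hF (hiff.1 h)), if_neg hF]
    rw [ENNReal.mul_rpow_of_nonneg _ _ hα.le, ENNReal.mul_rpow_of_nonneg _ _ hα.le,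
      ENNReal.mul_rpow_of_nonneg _ _ hβ.le, ENNReal.mul_rpow_of_nonneg _ _ hβ.le,
      ENNReal.mul_rpow_of_nonneg _ _ (add_pos hα hβ).le, ← ENNReal.rpow_mul, ← ENNReal.rpow_mul]
    calc _ = (ENNReal.ofReal t ^ (-β * α) * ENNReal.ofReal t ^ (α * β)) *
          ((c : ℝ≥0∞) ^ α * (c : ℝ≥0∞) ^ β * (fourierNorm β ν ^ α * moment α ν ^ β)) /
            ((c : ℝ≥0∞) ^ (α + β) * ν univ ^ (α + β)) := by congr 1; ring
      _ = (c : ℝ≥0∞) ^ (α + β) * (fourierNorm β ν ^ α * moment α ν ^ β) /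
            ((c : ℝ≥0∞) ^ (α + β) * ν univ ^ (α + β)) := by
          rw [← ENNReal.rpow_add _ _ h0 (by simp), ← ENNReal.rpow_add _ _ hc0 (by simp),
            show -β * α + α * β = 0 by ring, ENNReal.rpow_zero, one_mul]
      _ = _ := ENNReal.mul_div_mul_left _ _ hcc hcc'

lemma IsRadial.rescale {ν : Measure E} (h : IsRadial ν) (c : ℝ≥0) (t : ℝ) :
    IsRadial (rescale c t ν) := by
  intro R
  have hR : Measurable fun x : E => R x := R.continuous.measurable
  conv_rhs => rw [FourierUncertainty.rescale, ← h R]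
  rw [FourierUncertainty.rescale, Measure.map_smul, Measure.map_map hR (by fun_prop),
    Measure.map_map (by fun_prop) hR]
  congr 2
  ext x
  simp

lemma rescale_ne_zero {ν : Measure E} (h : ν ≠ 0) {c : ℝ≥0} (hc : 0 < c) (t : ℝ) :
    rescale c t ν ≠ 0 := by
  intro h0
  have := rescale_univ c t ν
  rw [h0] at this
  simp [hc.ne'] at this
  exact h this

/-- Any measure with finite Fourier norm can be rescaled to have prescribed mass and norm. -/
lemma exists_rescale [SecondCountableTopology E] [Nontrivial E] {β : ℝ} (hβ : 0 < β)
    {μ ν : Measure E} [IsFiniteMeasure μ] [IsFiniteMeasure ν] (hμ : μ ≠ 0) (hν : ν ≠ 0)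
    (hFμ : fourierNorm β μ ≠ ∞) (hFν : fourierNorm β ν ≠ ∞) :
    ∃ (c : ℝ≥0) (t : ℝ), 0 < c ∧ 0 < t ∧ rescale c t μ univ = ν univ ∧
      fourierNorm β (rescale c t μ) = fourierNorm β ν := by
  have hm : μ univ ≠ 0 := by simpa using hμ
  have hn : ν univ ≠ 0 := by simpa using hν
  have hF0 := fourierNorm_ne_zero β hμ
  have hG0 := fourierNorm_ne_zero β hν
  set c : ℝ≥0∞ := ν univ / μ univ with hc
  have hctop : c ≠ ∞ := ENNReal.div_ne_top (measure_ne_top _ _) hm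
  have hc0 : c ≠ 0 := by
    rw [hc]; exact (ENNReal.div_pos hn (measure_ne_top _ _)).ne'
  set s : ℝ≥0∞ := fourierNorm β ν / (c * fourierNorm β μ) with hs
  have hcF0 : c * fourierNorm β μ ≠ 0 := mul_ne_zero hc0 hF0
  have hcF : c * fourierNorm β μ ≠ ∞ := ENNReal.mul_ne_top hctop hFμ
  have hs_fin : s ≠ ∞ := ENNReal.div_ne_top hFν hcF0
  have hs0 : s ≠ 0 := (ENNReal.div_pos hG0 hcF).ne'
  have hspos : 0 < s.toReal := ENNReal.toReal_pos hs0 hs_fin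
  -- The mass determines `c`. The norm then scales by `t ^ (-β)`, so `t` is the power `-1/β` of the
  -- remaining ratio `s` of norms.
  refine ⟨c.toNNReal, s.toReal ^ (-β⁻¹), ?_, Real.rpow_pos_of_pos hspos _, ?_, ?_⟩
  · exact ENNReal.toNNReal_pos hc0 hctop
  · rw [rescale_univ, ENNReal.coe_toNNReal hctop, hc,
      ENNReal.div_mul_cancel hm (measure_ne_top _ _)]
  · rw [fourierNorm_rescale _ (Real.rpow_pos_of_pos hspos _), ENNReal.coe_toNNReal hctop,
      ← ENNReal.ofReal_rpow_of_pos hspos, ENNReal.ofReal_toReal hs_fin, ← ENNReal.rpow_mul,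
      show -β⁻¹ * -β = 1 by field_simp, ENNReal.rpow_one]
    calc _ = s * (c * fourierNorm β μ) := by ring
      _ = _ := ENNReal.div_mul_cancel hcF0 hcF

lemma rescale_inv_cancel {c : ℝ≥0} (hc : 0 < c) {t : ℝ} (ht : 0 < t) (μ : Measure E) :
    rescale c⁻¹ t⁻¹ (rescale c t μ) = μ := by
  rw [rescale_rescale, inv_mul_cancel₀ hc.ne', inv_mul_cancel₀ ht.ne', rescale_one]

/-- Competitors of infinite norm are trivial. Any other is first moved along its orbit to the mass
and norm of `ν`, where only the moments differ. -/
lemma isExtremizer_of_forall [SecondCountableTopology E] [Nontrivial E] {α β : ℝ} (hα : 0 < α)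
    (hβ : 0 < β) {ν : Measure E} [IsFiniteMeasure ν] (hν : ν ≠ 0) (hF : fourierNorm β ν ≠ ∞)
    (h : ∀ μ : Measure E, IsFiniteMeasure μ → μ univ = ν univ →
      fourierNorm β μ ≤ fourierNorm β ν → moment α ν ≤ moment α μ) :
    IsExtremizer α β ν := by
  refine ⟨inferInstance, hν, le_antisymm ?_ ?_⟩
  · refine le_iInf fun μ => le_iInf fun hμ => le_iInf fun hμ0 => ?_
    by_cases hFμ : fourierNorm β μ = ∞
    · simp [functional, hFμ]
    · obtain ⟨c, t, hc, ht, hu, hf⟩ := exists_rescale hβ hμ0 hν hFμ hF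
      rw [← functional_rescale hα hβ hc ht μ]
      exact functional_le_of_moment_le hα hβ hu.symm hf.ge (h _ inferInstance hu hf.le)
  · exact iInf_le_of_le ν (iInf_le_of_le inferInstance (iInf_le_of_le hν le_rfl))

lemma IsExtremizer.rescale {α β : ℝ} (hα : 0 < α) (hβ : 0 < β) {ν : Measure E}
    (h : IsExtremizer α β ν) {c : ℝ≥0} (hc : 0 < c) {t : ℝ} (ht : 0 < t) :
    IsExtremizer α β (rescale c t ν) := by
  obtain ⟨h1, h2, h3⟩ := h
  exact ⟨inferInstance, rescale_ne_zero h2 hc t, by rw [functional_rescale hα hβ hc ht, h3]⟩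

/-- After normalising mass and norm, the equal functionals share the norm and mass factors. These
are finite and nonzero, so they cancel and leave equality of moments. -/
lemma IsExtremizer.exists_rescale [SecondCountableTopology E] [Nontrivial E] {α β : ℝ}
    (hα : 0 < α) (hβ : 0 < β) {μ ν : Measure E} (hν : IsExtremizer α β ν)
    (hF : fourierNorm β ν ≠ ∞) (hM : moment α ν ≠ ∞) (hμ : IsExtremizer α β μ) :
    ∃ (c : ℝ≥0) (t : ℝ), 0 < c ∧ 0 < t ∧ FourierUncertainty.rescale c t μ univ = ν univ ∧
      fourierNorm β (FourierUncertainty.rescale c t μ) = fourierNorm β ν ∧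
      moment α (FourierUncertainty.rescale c t μ) = moment α ν := by
  obtain ⟨hμ1, hμ2, hμ3⟩ := hμ
  obtain ⟨hν1, hν2, hν3⟩ := hν
  have hn : ν univ ≠ 0 := by simpa using hν2
  have hn' : ν univ ≠ ∞ := measure_ne_top _ _
  have hpow : ∀ {x : ℝ≥0∞} {y : ℝ}, 0 < y → x ≠ ∞ → x ^ y ≠ ∞ := fun hy hx =>
    ENNReal.rpow_ne_top_of_nonneg hy.le hx
  have hpow0 : ∀ {x : ℝ≥0∞} {y : ℝ}, 0 < y → x ≠ 0 → x ^ y ≠ 0 := fun hy hx h0 => by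
    rw [ENNReal.rpow_eq_zero_iff] at h0
    rcases h0 with h0 | h0
    · exact hx h0.1
    · linarith [h0.2]
  have hfin : functional α β ν ≠ ∞ := by
    rw [functional, if_neg hF]
    exact ENNReal.div_ne_top (ENNReal.mul_ne_top (hpow hα hF) (hpow hβ hM))
      (hpow0 (add_pos hα hβ) hn)
  have hFμ : fourierNorm β μ ≠ ∞ := by
    intro h
    rw [hν3, ← hμ3, functional, if_pos h] at hfin
    exact hfin rfl
  obtain ⟨c, t, hc, ht, hu, hf⟩ := FourierUncertainty.exists_rescale hβ hμ2 hν2 hFμ hF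
  refine ⟨c, t, hc, ht, hu, hf, ?_⟩
  have heq : functional α β (FourierUncertainty.rescale c t μ) = functional α β ν := by
    rw [functional_rescale hα hβ hc ht, hμ3, hν3]
  have hF0 : fourierNorm β ν ≠ 0 := fourierNorm_ne_zero β hν2
  rw [functional, functional, if_neg hF, hf, if_neg hF, hu] at heq
  have h1 := congrArg (· * ν univ ^ (α + β)) heq
  simp only [ENNReal.div_mul_cancel (hpow0 (add_pos hα hβ) hn) (hpow (add_pos hα hβ) hn')] at h1
  have h2 := (ENNReal.mul_right_inj (hpow0 hα hF0) (hpow hα hF)).1 h1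
  exact (ENNReal.rpow_left_injective hβ.ne') h2

end Rescaling

/-! ### Linear programming duality -/

section Duality

/-- Weak duality: a majorization of `h` by test functions whose integrals are controlled gives a
lower bound for `∫ h`, together with complementary slackness in the case of equality. -/
lemma lintegral_le_of_dual {X : Type*} [TopologicalSpace X] [MeasurableSpace X]
    [OpensMeasurableSpace X] {ι : Type*} [Countable ι] {μ ν : Measure X} [IsFiniteMeasure μ]
    [IsFiniteMeasure ν] (huniv : μ univ = ν univ) {h : X → ℝ} (hm : Measurable h)
    (h0 : ∀ x, 0 ≤ h x) {c : ℝ} {d : ι → ℝ} {e : ι → X → ℝ} {B : ι → ℝ} (hd : ∀ k, 0 < d k)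
    (he : ∀ k x, |e k x| ≤ B k) (hem : ∀ k, Continuous (e k)) (hs : Summable fun k => d k * B k)
    (hle : ∀ x, c - ∑' k, d k * e k x ≤ h x) (heq : ∀ᵐ x ∂ν, h x = c - ∑' k, d k * e k x)
    (hintegral : ∀ k, ∫ x, e k x ∂μ ≤ ∫ x, e k x ∂ν) :
    (∫⁻ x, ENNReal.ofReal (h x) ∂ν ≤ ∫⁻ x, ENNReal.ofReal (h x) ∂μ) ∧
    (∫⁻ x, ENNReal.ofReal (h x) ∂ν ≠ ∞) ∧
    (∫⁻ x, ENNReal.ofReal (h x) ∂μ = ∫⁻ x, ENNReal.ofReal (h x) ∂ν →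
      (∀ k, ∫ x, e k x ∂μ = ∫ x, e k x ∂ν) ∧ ∀ᵐ x ∂μ, h x = c - ∑' k, d k * e k x) := by
  have hbd : ∀ k x, ‖d k * e k x‖ ≤ d k * B k := fun k x => by
    rw [Real.norm_eq_abs, abs_mul, abs_of_pos (hd k)]
    exact mul_le_mul_of_nonneg_left (he k x) (hd k).le
  -- The summable majorant `d k * B k` makes `φ` continuous and bounded and allows termwise
  -- integration against every finite measure.
  set φ : X → ℝ := fun x => ∑' k, d k * e k x with hφ
  have hφc : Continuous φ := continuous_tsum (fun k => continuous_const.mul (hem k)) hs hbd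
  have hφb : ∀ x, ‖φ x‖ ≤ ∑' k, d k * B k := fun x => tsum_of_norm_bounded hs.hasSum (hbd · x)
  have hek : ∀ (ρ : Measure X) [IsFiniteMeasure ρ] k, Integrable (e k) ρ := fun ρ _ k =>
    Integrable.of_bound (hem k).aestronglyMeasurable (B k) (ae_of_all _ (he k))
  have hφi : ∀ (ρ : Measure X) [IsFiniteMeasure ρ], Integrable φ ρ := fun ρ _ =>
    Integrable.of_bound hφc.aestronglyMeasurable _ (ae_of_all _ hφb)
  have hsum : ∀ (ρ : Measure X) [IsFiniteMeasure ρ],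
      HasSum (fun k => d k * ∫ x, e k x ∂ρ) (∫ x, φ x ∂ρ) := by
    intro ρ _
    have := hasSum_integral_of_summable_integral_norm (μ := ρ) (F := fun k x => d k * e k x)
      (fun k => (hek ρ k).const_mul _) (by
        refine Summable.of_nonneg_of_le (fun k => integral_nonneg fun x => norm_nonneg _)
          (fun k => ?_) (hs.mul_right (ρ.real univ))
        calc ∫ x, ‖d k * e k x‖ ∂ρ ≤ ∫ x, d k * B k ∂ρ :=
              integral_mono ((hek ρ k).const_mul _).norm (integrable_const _) (hbd k)
          _ = _ := by simp [mul_comm])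
    simpa only [integral_const_mul] using this
  have hφle : ∫ x, φ x ∂μ ≤ ∫ x, φ x ∂ν :=
    hasSum_le (fun k => mul_le_mul_of_nonneg_left (hintegral k) (hd k).le) (hsum μ) (hsum ν)
  have hreal : μ.real univ = ν.real univ := by simp [Measure.real, huniv]
  have hci : ∀ (ρ : Measure X) [IsFiniteMeasure ρ], Integrable (fun x => c - φ x) ρ := fun ρ _ =>
    (integrable_const c).sub (hφi ρ)
  have hc : ∀ (ρ : Measure X) [IsFiniteMeasure ρ],
      ∫ x, (c - φ x) ∂ρ = c * ρ.real univ - ∫ x, φ x ∂ρ := fun ρ _ => by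
    rw [integral_sub (integrable_const c) (hφi ρ)]; simp [mul_comm]
  have hhν : Integrable h ν := (hci ν).congr (heq.mono fun x hx => hx.symm)
  have hν : ∫ x, h x ∂ν = c * ν.real univ - ∫ x, φ x ∂ν := by
    rw [← hc ν]; exact integral_congr_ae heq
  have hLν : ∫⁻ x, ENNReal.ofReal (h x) ∂ν = ENNReal.ofReal (∫ x, h x ∂ν) :=
    (ofReal_integral_eq_lintegral_ofReal hhν (ae_of_all _ h0)).symm
  have hμint : ∫⁻ x, ENNReal.ofReal (h x) ∂μ ≠ ∞ → Integrable h μ := fun hfin => by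
    refine ⟨hm.aestronglyMeasurable, ?_⟩
    rw [hasFiniteIntegral_iff_ofReal (ae_of_all _ h0)]
    exact lt_top_iff_ne_top.2 hfin
  refine ⟨?_, by rw [hLν]; exact ENNReal.ofReal_ne_top, fun heq' => ?_⟩
  · by_cases hfin : ∫⁻ x, ENNReal.ofReal (h x) ∂μ = ∞
    · rw [hfin]; exact le_top
    · have hhμ := hμint hfin
      rw [hLν, ← ofReal_integral_eq_lintegral_ofReal hhμ (ae_of_all _ h0)]
      apply ENNReal.ofReal_le_ofReal
      have : ∫ x, (c - φ x) ∂μ ≤ ∫ x, h x ∂μ := integral_mono (hci μ) hhμ hle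
      rw [hc μ, hreal] at this
      linarith
  · have hhμ : Integrable h μ := hμint (by rw [heq', hLν]; exact ENNReal.ofReal_ne_top)
    rw [hLν, ← ofReal_integral_eq_lintegral_ofReal hhμ (ae_of_all _ h0)] at heq'
    have heq2 := (ENNReal.ofReal_eq_ofReal_iff (integral_nonneg h0) (integral_nonneg h0)).1 heq'
    have h1 : ∫ x, (c - φ x) ∂μ ≤ ∫ x, h x ∂μ := integral_mono (hci μ) hhμ hle
    have h2 := hc μ
    rw [hreal] at h2
    have h3 : ∫ x, φ x ∂μ = ∫ x, φ x ∂ν := by linarith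
    constructor
    · intro k
      by_contra hne
      -- Because `d k` is positive, one strict inequality would make the whole sum for `μ` strictly
      -- smaller, against `h3`.
      have hlt : d k * ∫ x, e k x ∂μ < d k * ∫ x, e k x ∂ν :=
        mul_lt_mul_of_pos_left (lt_of_le_of_ne (hintegral k) hne) (hd k)
      have := hasSum_lt (fun k => mul_le_mul_of_nonneg_left (hintegral k) (hd k).le) hlt
        (hsum μ) (hsum ν)
      linarith
    -- The gap between `h` and its minorant is nonnegative with zero integral, hence zero almost
    -- everywhere.
    · have h4 : ∫ x, (h x - (c - φ x)) ∂μ = 0 := by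
        rw [integral_sub hhμ (hci μ)]; linarith
      have h5 := (integral_eq_zero_iff_of_nonneg (fun x => sub_nonneg.2 (hle x))
        (hhμ.sub (hci μ))).1 h4
      filter_upwards [h5] with x hx
      simp only [Pi.zero_apply, sub_eq_zero] at hx
      exact hx

end Duality

/-! ### Measures determined by trigonometric moments -/

section Uniqueness

variable {μ ν : Measure ℝ} [IsFiniteMeasure μ] [IsFiniteMeasure ν]

lemma integrable_of_continuous_of_Icc {a b : ℝ} (hμ : ∀ᵐ x ∂μ, x ∈ Icc a b)
    {F : ℝ → ℝ} (hF : Continuous F) : Integrable F μ := by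
  obtain ⟨C, hC⟩ := isCompact_Icc.exists_bound_of_continuousOn (s := Icc a b) hF.continuousOn
  exact Integrable.of_bound hF.aestronglyMeasurable C (hμ.mono fun x hx => hC x hx)

lemma integral_eq_of_approx {a b : ℝ} (hμ : ∀ᵐ x ∂μ, x ∈ Icc a b) (hν : ∀ᵐ x ∂ν, x ∈ Icc a b)
    {F : ℝ → ℝ} (hF : Continuous F)
    (h : ∀ ε > 0, ∃ q : ℝ → ℝ, Continuous q ∧ (∀ x ∈ Icc a b, |q x - F x| ≤ ε) ∧
      ∫ x, q x ∂μ = ∫ x, q x ∂ν) : ∫ x, F x ∂μ = ∫ x, F x ∂ν := by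
  by_contra hne
  set D := |∫ x, F x ∂μ - ∫ x, F x ∂ν| with hD
  have hDpos : 0 < D := abs_pos.2 (sub_ne_zero.2 hne)
  set m := μ.real univ + ν.real univ + 1 with hm
  have hmpos : 0 < m := by positivity
  -- Since `m` exceeds the sum of the two masses, this tolerance keeps the combined error at most `D
  -- / 2`, which is less than `D`.
  obtain ⟨q, hq, hqF, hqe⟩ := h (D / (2 * m)) (by positivity)
  have key : ∀ (ρ : Measure ℝ) [IsFiniteMeasure ρ], (∀ᵐ x ∂ρ, x ∈ Icc a b) →
      |∫ x, q x ∂ρ - ∫ x, F x ∂ρ| ≤ D / (2 * m) * ρ.real univ := by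
    intro ρ _ hρ
    rw [← integral_sub (integrable_of_continuous_of_Icc hρ hq)
      (integrable_of_continuous_of_Icc hρ hF)]
    have := norm_integral_le_of_norm_le_const (μ := ρ) (f := fun x => q x - F x)
      (C := D / (2 * m)) (hρ.mono fun x hx => hqF x hx)
    simpa using this
  have h1 := key μ hμ
  have h2 := key ν hν
  have h3 : D ≤ D / (2 * m) * μ.real univ + D / (2 * m) * ν.real univ := by
    calc D = |(∫ x, q x ∂ν - ∫ x, F x ∂ν) - (∫ x, q x ∂μ - ∫ x, F x ∂μ)| := by
          rw [hD, hqe]; congr 1; ring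
      _ ≤ |∫ x, q x ∂ν - ∫ x, F x ∂ν| + |∫ x, q x ∂μ - ∫ x, F x ∂μ| := abs_sub _ _
      _ ≤ _ := by linarith
  have h4 : D / (2 * m) * μ.real univ + D / (2 * m) * ν.real univ ≤ D / 2 := by
    rw [← mul_add, div_mul_eq_mul_div, div_le_div_iff₀ (by positivity) (by positivity)]
    nlinarith [hDpos, hm]
  linarith

/-- If all odd moments of two measures on `[-1, 1]` agree, so do the integrals of odd functions. -/
lemma integral_odd_eq (hμ : ∀ᵐ x ∂μ, x ∈ Icc (-1 : ℝ) 1) (hν : ∀ᵐ x ∂ν, x ∈ Icc (-1 : ℝ) 1)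
    (hodd : ∀ j : ℕ, ∫ x, x ^ (2 * j + 1) ∂μ = ∫ x, x ^ (2 * j + 1) ∂ν) {F : ℝ → ℝ}
    (hF : Continuous F) (hFodd : ∀ x, F (-x) = -F x) : ∫ x, F x ∂μ = ∫ x, F x ∂ν := by
  refine integral_eq_of_approx hμ hν hF fun ε hε => ?_
  obtain ⟨p, hp⟩ := exists_polynomial_near_of_continuousOn (-1) 1 F hF.continuousOn ε hε
  -- The odd part of a polynomial approximant of an odd function approximates it equally well and
  -- involves only odd powers.
  refine ⟨fun x => (p.eval x - p.eval (-x)) / 2, by fun_prop, fun x hx => ?_, ?_⟩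
  · have h1 := hp x hx
    have h2 := hp (-x) ⟨by linarith [hx.2], by linarith [hx.1]⟩
    rw [hFodd] at h2
    rw [abs_lt] at h1 h2
    rw [abs_le]
    constructor <;> linarith
  · have hq : ∀ x : ℝ, (p.eval x - p.eval (-x)) / 2 =
        ∑ i ∈ Finset.range (p.natDegree + 1), p.coeff i * ((x ^ i - (-x) ^ i) / 2) := by
      intro x
      rw [Polynomial.eval_eq_sum_range, Polynomial.eval_eq_sum_range, ← Finset.sum_sub_distrib,
        Finset.sum_div]
      exact Finset.sum_congr rfl fun i _ => by ring
    simp_rw [hq]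
    rw [integral_finsetSum _ fun i _ => integrable_of_continuous_of_Icc hμ (by fun_prop),
      integral_finsetSum _ fun i _ => integrable_of_continuous_of_Icc hν (by fun_prop)]
    refine Finset.sum_congr rfl fun i _ => ?_
    rw [integral_const_mul, integral_const_mul]
    congr 1
    rcases Nat.even_or_odd' i with ⟨j, rfl | rfl⟩
    · simp [Even.neg_pow (even_two_mul j)]
    · have : ∀ x : ℝ, (x ^ (2 * j + 1) - (-x) ^ (2 * j + 1)) / 2 = x ^ (2 * j + 1) := by
        intro x
        rw [Odd.neg_pow (odd_two_mul_add_one j)]; ring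
      simp_rw [this]
      exact hodd j

lemma integral_mul_eq_of_moments (hμ : ∀ᵐ x ∂μ, x ∈ Icc (-1 : ℝ) 1)
    (hν : ∀ᵐ x ∂ν, x ∈ Icc (-1 : ℝ) 1) {W : ℝ → ℝ} (hW : Continuous W)
    (h : ∀ n : ℕ, ∫ x, W x * x ^ n ∂μ = ∫ x, W x * x ^ n ∂ν) {F : ℝ → ℝ} (hF : Continuous F) :
    ∫ x, W x * F x ∂μ = ∫ x, W x * F x ∂ν := by
  refine integral_eq_of_approx hμ hν (hW.mul hF) fun ε hε => ?_
  obtain ⟨C, hC⟩ := isCompact_Icc.exists_bound_of_continuousOn (s := Icc (-1 : ℝ) 1)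
    hW.continuousOn
  have hC0 : 0 ≤ C := (norm_nonneg _).trans (hC 0 (by simp))
  obtain ⟨p, hp⟩ := exists_polynomial_near_of_continuousOn (-1) 1 F hF.continuousOn
    (ε / (C + 1)) (by positivity)
  refine ⟨fun x => W x * p.eval x, by fun_prop, fun x hx => ?_, ?_⟩
  · rw [← mul_sub, abs_mul]
    calc |W x| * |p.eval x - F x| ≤ C * (ε / (C + 1)) :=
          mul_le_mul (hC x hx) (hp x hx).le (abs_nonneg _) hC0
      _ ≤ ε := by
          rw [mul_div_assoc', div_le_iff₀ (by positivity)]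
          nlinarith
  · have hq : ∀ x : ℝ, W x * p.eval x =
        ∑ i ∈ Finset.range (p.natDegree + 1), p.coeff i * (W x * x ^ i) := by
      intro x
      rw [Polynomial.eval_eq_sum_range, Finset.mul_sum]
      exact Finset.sum_congr rfl fun i _ => by ring
    simp_rw [hq]
    rw [integral_finsetSum _ fun i _ => integrable_of_continuous_of_Icc hμ (by fun_prop),
      integral_finsetSum _ fun i _ => integrable_of_continuous_of_Icc hν (by fun_prop)]
    refine Finset.sum_congr rfl fun i _ => ?_
    rw [integral_const_mul, integral_const_mul, h i]

/-- The integrals identify the weighted measures Wμ and Wν. Dividing by W identifies μ and ν where W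
> 0. There ν has all its mass, so equality of total masses leaves nothing for μ on the zero set of
W. -/
lemma eq_of_forall_integral_mul_eq (huniv : μ univ = ν univ) {W : ℝ → ℝ} (hW : Continuous W)
    (hμ0 : ∀ᵐ x ∂μ, 0 ≤ W x) (hν0 : ∀ᵐ x ∂ν, 0 < W x) (hWμ : Integrable W μ) (hWν : Integrable W ν)
    (h : ∀ F : ℝ → ℝ, Continuous F → ∫ x, W x * F x ∂μ = ∫ x, W x * F x ∂ν) : μ = ν := by
  set w : ℝ → ℝ≥0 := fun x => (W x).toNNReal with hw
  have hwm : Measurable w := hW.measurable.real_toNNReal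
  have fin : ∀ (ρ : Measure ℝ), Integrable W ρ →
      IsFiniteMeasure (ρ.withDensity fun x => (w x : ℝ≥0∞)) := fun ρ hρ => by
    refine isFiniteMeasure_withDensity ?_
    exact hρ.lintegral_lt_top.ne
  have := fin μ hWμ
  have := fin ν hWν
  have key : (μ.withDensity fun x => (w x : ℝ≥0∞)) = ν.withDensity fun x => (w x : ℝ≥0∞) := by
    apply ext_of_forall_integral_eq_of_IsFiniteMeasure
    intro F
    rw [integral_withDensity_eq_integral_smul hwm, integral_withDensity_eq_integral_smul hwm]
    have e1 : ∫ x, w x • F x ∂μ = ∫ x, W x * F x ∂μ := by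
      refine integral_congr_ae (hμ0.mono fun x hx => ?_)
      simp [hw, NNReal.smul_def, Real.coe_toNNReal _ hx]
    have e2 : ∫ x, w x • F x ∂ν = ∫ x, W x * F x ∂ν := by
      refine integral_congr_ae (hν0.mono fun x hx => ?_)
      simp [hw, NNReal.smul_def, Real.coe_toNNReal _ hx.le]
    rw [e1, e2, h F F.continuous]
  set S : Set ℝ := {x | 0 < W x} with hS
  have hSm : MeasurableSet S := measurableSet_lt measurable_const hW.measurable
  have hrec : ∀ ρ : Measure ℝ, ((ρ.withDensity fun x => (w x : ℝ≥0∞)).restrict S).withDensity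
      (fun x => (w x : ℝ≥0∞)⁻¹) = ρ.restrict S := fun ρ => by
    rw [restrict_withDensity hSm]
    apply withDensity_inv_same hwm.coe_nnreal_ennreal
    · filter_upwards [ae_restrict_mem hSm] with x hx
      have hx' : 0 < W x := hx
      simpa [hw] using hx'
    · simp
  have hres : μ.restrict S = ν.restrict S := by rw [← hrec μ, ← hrec ν, key]
  have hνS : ν Sᶜ = 0 := hν0
  have hSeq : μ S = ν S := by
    rw [← Measure.restrict_apply_self μ S, hres, Measure.restrict_apply_self]
  have hμS : μ Sᶜ = 0 := by
    rw [measure_compl hSm (measure_ne_top _ _), huniv, hSeq,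
      ← measure_compl hSm (measure_ne_top _ _), hνS]
  rw [← Measure.restrict_eq_self_of_ae_mem (s := S) (μ := μ) hμS,
    ← Measure.restrict_eq_self_of_ae_mem (s := S) (μ := ν) hνS, hres]

/-- Since cos²(πx) = (1 + cos(2πx))/2, the recurrence turns each factor cos² into a combination of
the neighbouring indices; hence the induction on `j` for all `k` at once. -/
lemma integral_cos_pow_mul_eq {a b : ℝ} (hμ : ∀ᵐ x ∂μ, x ∈ Icc a b) (hν : ∀ᵐ x ∂ν, x ∈ Icc a b)
    {s : ℤ → ℝ → ℝ} (hs : ∀ k, Continuous (s k))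
    (hrec : ∀ k x, 2 * Real.cos (2 * (Real.pi * x)) * s k x = s (k + 1) x + s (k - 1) x)
    (h : ∀ k, ∫ x, s k x ∂μ = ∫ x, s k x ∂ν) (j : ℕ) (k : ℤ) :
    ∫ x, Real.cos (Real.pi * x) ^ (2 * j) * s k x ∂μ =
      ∫ x, Real.cos (Real.pi * x) ^ (2 * j) * s k x ∂ν := by
  induction j generalizing k with
  | zero => simpa using h k
  | succ j ih =>
    have e : ∀ x, Real.cos (Real.pi * x) ^ (2 * (j + 1)) * s k x =
        (1 / 2) * (Real.cos (Real.pi * x) ^ (2 * j) * s k x) +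
        ((1 / 4) * (Real.cos (Real.pi * x) ^ (2 * j) * s (k + 1) x) +
         (1 / 4) * (Real.cos (Real.pi * x) ^ (2 * j) * s (k - 1) x)) := by
      intro x
      rw [← mul_add, ← mul_add, ← hrec, Real.cos_two_mul]
      ring
    simp_rw [e]
    have I : ∀ (ρ : Measure ℝ) [IsFiniteMeasure ρ], (∀ᵐ x ∂ρ, x ∈ Icc a b) → ∀ (c : ℝ) (k : ℤ),
        Integrable (fun x => c * (Real.cos (Real.pi * x) ^ (2 * j) * s k x)) ρ := fun ρ _ hρ c k =>
      integrable_of_continuous_of_Icc hρ (by have := hs k; fun_prop)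
    have S : ∀ (ρ : Measure ℝ) [IsFiniteMeasure ρ], (∀ᵐ x ∂ρ, x ∈ Icc a b) →
        ∫ x, ((1 / 2) * (Real.cos (Real.pi * x) ^ (2 * j) * s k x) +
        ((1 / 4) * (Real.cos (Real.pi * x) ^ (2 * j) * s (k + 1) x) +
         (1 / 4) * (Real.cos (Real.pi * x) ^ (2 * j) * s (k - 1) x))) ∂ρ =
        (1 / 2) * ∫ x, (Real.cos (Real.pi * x) ^ (2 * j) * s k x) ∂ρ +
        ((1 / 4) * ∫ x, (Real.cos (Real.pi * x) ^ (2 * j) * s (k + 1) x) ∂ρ +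
         (1 / 4) * ∫ x, (Real.cos (Real.pi * x) ^ (2 * j) * s (k - 1) x) ∂ρ) := fun ρ _ hρ =>
      (integral_add (I ρ hρ _ _) ((I ρ hρ _ _).add (I ρ hρ _ _))).trans
        (congrArg₂ _ (integral_const_mul _ _) ((integral_add (I ρ hρ _ _) (I ρ hρ _ _)).trans
          (congrArg₂ _ (integral_const_mul _ _) (integral_const_mul _ _))))
    rw [S μ hμ, S ν hν]
    simp only [ih]

/-- A finite measure on `[0, 1]` is determined by its trigonometric moments of half-integer
frequency against cosines and a family of weighted sines. -/
lemma eq_of_trig_moments (huniv : μ univ = ν univ) (hμ : ∀ᵐ x ∂μ, x ∈ Icc (0 : ℝ) 1)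
    (hν : ∀ᵐ x ∂ν, x ∈ Ioo (0 : ℝ) 1)
    (hcos : ∀ k : ℤ, ∫ x, Real.cos ((2 * k + 1) * Real.pi * x) ∂μ =
      ∫ x, Real.cos ((2 * k + 1) * Real.pi * x) ∂ν)
    {s : ℤ → ℝ → ℝ} (hs : ∀ k, Continuous (s k))
    (hrec : ∀ k x, 2 * Real.cos (2 * (Real.pi * x)) * s k x = s (k + 1) x + s (k - 1) x)
    (hsin : ∀ k, ∫ x, s k x ∂μ = ∫ x, s k x ∂ν)
    (hnonneg : ∀ x ∈ Icc (0 : ℝ) 1, 0 ≤ s 0 x + s 0 (1 - x))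
    (hpos : ∀ x ∈ Ioo (0 : ℝ) 1, 0 < s 0 x + s 0 (1 - x)) : μ = ν := by
  have hν' : ∀ᵐ x ∂ν, x ∈ Icc (0 : ℝ) 1 := hν.mono fun x hx => Ioo_subset_Icc_self hx
  -- The coordinate c = cos(πx) maps [0, 1] bijectively onto [-1, 1] and turns x ↦ 1 - x into c ↦
  -- -c. The cosine data become the odd moments in c.
  set γ : ℝ → ℝ := fun x => Real.cos (Real.pi * x) with hγ
  have hγm : Measurable γ := by fun_prop
  have hγc : Continuous γ := by fun_prop
  set δ : ℝ → ℝ := fun c => Real.arccos c / Real.pi with hδ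
  have hδc : Continuous δ := Real.continuous_arccos.div_const _
  have hδγ : ∀ x ∈ Icc (0 : ℝ) 1, δ (γ x) = x := fun x hx => by
    simp only [hδ, hγ]
    rw [Real.arccos_cos (by have := Real.pi_pos; nlinarith [hx.1])
      (by nlinarith [hx.2, Real.pi_pos]), mul_div_cancel_left₀ _ Real.pi_ne_zero]
  have hδneg : ∀ c, δ (-c) = 1 - δ c := fun c => by
    simp only [hδ, Real.arccos_neg]
    field_simp
  have hγI : ∀ (ρ : Measure ℝ), ∀ᵐ x ∂(ρ.map γ), x ∈ Icc (-1 : ℝ) 1 := fun ρ => by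
    refine (ae_map_iff hγm.aemeasurable (p := (· ∈ Icc (-1 : ℝ) 1)) measurableSet_Icc).2 ?_
    exact ae_of_all _ fun x => ⟨Real.neg_one_le_cos _, Real.cos_le_one _⟩
  have hintegral : ∀ (ρ : Measure ℝ) {F : ℝ → ℝ}, Continuous F →
      ∫ x, F x ∂(ρ.map γ) = ∫ x, F (γ x) ∂ρ := fun ρ F hF =>
    integral_map hγm.aemeasurable hF.aestronglyMeasurable
  have hodd : ∀ j : ℕ, ∫ x, x ^ (2 * j + 1) ∂(μ.map γ) = ∫ x, x ^ (2 * j + 1) ∂(ν.map γ) := by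
    intro j
    rw [hintegral μ (by fun_prop), hintegral ν (by fun_prop)]
    have := integral_cos_pow_mul_eq hμ hν'
      (s := fun (k : ℤ) x => Real.cos ((2 * k + 1) * Real.pi * x)) (fun k => by fun_prop)
      (fun k x => by
        rw [← sub_eq_zero]
        push_cast
        rw [show (2 * ((k : ℝ) + 1) + 1) * Real.pi * x = (2 * k + 1) * Real.pi * x +
          2 * (Real.pi * x) by ring, show (2 * ((k : ℝ) - 1) + 1) * Real.pi * x =
          (2 * k + 1) * Real.pi * x - 2 * (Real.pi * x) by ring, Real.cos_add, Real.cos_sub]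
        ring) hcos j 0
    simpa [hγ, pow_succ] using this
  set g : ℝ → ℝ := fun c => s 0 (δ c) with hg
  have hgc : Continuous g := (hs 0).comp hδc
  have heven : ∀ j : ℕ, ∫ x, g x * x ^ (2 * j) ∂(μ.map γ) = ∫ x, g x * x ^ (2 * j) ∂(ν.map γ) := by
    intro j
    rw [hintegral μ (by fun_prop), hintegral ν (by fun_prop)]
    have e : ∀ (ρ : Measure ℝ), (∀ᵐ x ∂ρ, x ∈ Icc (0 : ℝ) 1) →
        ∫ x, g (γ x) * γ x ^ (2 * j) ∂ρ = ∫ x, Real.cos (Real.pi * x) ^ (2 * j) * s 0 x ∂ρ :=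
      fun ρ hρ => integral_congr_ae (hρ.mono fun x hx => by
        simp only [hg, hδγ x hx]; rw [mul_comm])
    rw [e μ hμ, e ν hν']
    exact integral_cos_pow_mul_eq hμ hν' hs hrec hsin j 0
  have hO : ∀ {F : ℝ → ℝ}, Continuous F → (∀ x, F (-x) = -F x) →
      ∫ x, F x ∂(μ.map γ) = ∫ x, F x ∂(ν.map γ) := fun hF hFo =>
    integral_odd_eq (hγI μ) (hγI ν) hodd hF hFo
  -- The even weight `W` differs from `2 * g` by an odd function, so its even moments follow from
  -- those of `g`; its odd moments are integrals of odd functions, already known to agree.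
  set W : ℝ → ℝ := fun c => g c + g (-c) with hW
  have hWc : Continuous W := by fun_prop
  have hmom : ∀ n : ℕ, ∫ x, W x * x ^ n ∂(μ.map γ) = ∫ x, W x * x ^ n ∂(ν.map γ) := by
    intro n
    rcases Nat.even_or_odd' n with ⟨j, rfl | rfl⟩
    · have e : ∀ x, W x * x ^ (2 * j) =
          2 * (g x * x ^ (2 * j)) - (g x - g (-x)) * x ^ (2 * j) := fun x => by
        simp only [hW]; ring
      have I : ∀ (ρ : Measure ℝ) [IsFiniteMeasure ρ] {F : ℝ → ℝ}, Continuous F →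
        Integrable F (ρ.map γ) := fun ρ _ F hF => integrable_of_continuous_of_Icc (hγI ρ) hF
      simp_rw [e]
      rw [integral_sub (I μ (by fun_prop)) (I μ (by fun_prop)),
        integral_sub (I ν (by fun_prop)) (I ν (by fun_prop)), integral_const_mul,
        integral_const_mul, heven j]
      congr 1
      exact hO (by fun_prop) fun x => by
        simp only [neg_neg, Even.neg_pow (even_two_mul j)]; ring
    · exact hO (by fun_prop) fun x => by
        simp only [hW, neg_neg, Odd.neg_pow (odd_two_mul_add_one j)]; ring
  have hWγ : ∀ x ∈ Icc (0 : ℝ) 1, W (γ x) = s 0 x + s 0 (1 - x) := fun x hx => by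
    simp only [hW, hg, hδneg, hδγ x hx]
  have hmap : μ.map γ = ν.map γ := by
    refine eq_of_forall_integral_mul_eq ?_ hWc ?_ ?_
      (integrable_of_continuous_of_Icc (hγI μ) hWc) (integrable_of_continuous_of_Icc (hγI ν) hWc)
      fun F hF => integral_mul_eq_of_moments (hγI μ) (hγI ν) hWc hmom hF
    · rw [Measure.map_apply hγm .univ, Measure.map_apply hγm .univ]
      exact huniv
    · rw [ae_map_iff hγm.aemeasurable (measurableSet_le measurable_const hWc.measurable)]
      exact hμ.mono fun x hx => by rw [hWγ x hx]; exact hnonneg x hx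
    · rw [ae_map_iff hγm.aemeasurable (measurableSet_lt measurable_const hWc.measurable)]
      exact hν.mono fun x hx => by rw [hWγ x (Ioo_subset_Icc_self hx)]; exact hpos x hx
  have hback : ∀ (ρ : Measure ℝ), (∀ᵐ x ∂ρ, x ∈ Icc (0 : ℝ) 1) → (ρ.map γ).map δ = ρ :=
    fun ρ hρ => by
      rw [Measure.map_map hδc.measurable hγm]
      conv_rhs => rw [← Measure.map_id (μ := ρ)]
      exact Measure.map_congr (hρ.mono fun x hx => hδγ x hx)
  rw [← hback μ hμ, ← hback ν hν', hmap]

end Uniqueness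

/-! ### Odd multiples of π -/

section Frequencies

/-- The angular frequencies `(2k+1)π`. -/
def freq (k : ℤ) : ℝ := (2 * k + 1) * Real.pi

lemma freq_ne_zero (k : ℤ) : freq k ≠ 0 := by
  refine mul_ne_zero ?_ Real.pi_ne_zero
  have : (2 * k + 1 : ℤ) ≠ 0 := by omega
  exact_mod_cast this

lemma cos_freq_half (k : ℤ) : Real.cos (freq k / 2) = 0 := by
  rw [Real.cos_eq_zero_iff]
  exact ⟨k, rfl⟩

lemma sin_freq_half_sq (k : ℤ) : Real.sin (freq k / 2) ^ 2 = 1 := by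
  have := Real.sin_sq_add_cos_sq (freq k / 2)
  rw [cos_freq_half] at this
  linarith

lemma cos_freq (k : ℤ) : Real.cos (freq k) = -1 := by
  have h : freq k = 2 * (freq k / 2) := by ring
  rw [h, Real.cos_two_mul, cos_freq_half]; norm_num

lemma sin_freq (k : ℤ) : Real.sin (freq k) = 0 := by
  have h : freq k = 2 * (freq k / 2) := by ring
  rw [h, Real.sin_two_mul, cos_freq_half]; norm_num

lemma cos_freq_add_one (k : ℤ) (x : ℝ) :
    Real.cos (freq k * (x + 1)) = -Real.cos (freq k * x) := by
  rw [mul_add, mul_one, Real.cos_add, cos_freq, sin_freq]; ring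

lemma summable_inv_freq_sq : Summable fun k : ℤ => (freq k ^ 2)⁻¹ := by
  have h := (Real.summable_one_div_int_pow (p := 2)).2 (by norm_num)
  have h2 := h.comp_injective (i := fun k : ℤ => 2 * k + 1) (fun a b hab => by
    simp only at hab; omega)
  refine (h2.mul_left ((Real.pi ^ 2)⁻¹)).congr fun k => ?_
  simp only [Function.comp, freq]
  push_cast
  rw [mul_pow, mul_inv, one_div, mul_comm]

end Frequencies

/-! ### Cosine series with half-integer frequencies -/

section FourierSeries

/-- Fourier expansion of an even function on `[-1/2, 1/2]` in cosines of half-integer frequency. -/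
lemma hasSum_cos_freq {h : ℝ → ℝ} (hc : Continuous h) (heven : ∀ x, h (-x) = h x)
    (h0 : h (1 / 2) = 0)
    (hs : Summable fun k : ℤ => ∫ x in (-(1 / 2 : ℝ))..(1 / 2), h x * Real.cos (freq k * x))
    {x : ℝ} (hx : x ∈ Icc (-(1 / 2 : ℝ)) (1 / 2)) :
    HasSum (fun k : ℤ => (∫ y in (-(1 / 2 : ℝ))..(1 / 2), h y * Real.cos (freq k * y)) *
      Real.cos (freq k * x)) (h x) := by
  -- The right endpoint is missing from the half-open fundamental domain used below; there every
  -- term and the function vanish.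
  rcases eq_or_lt_of_le hx.2 with hx1 | hx1
  · rw [hx1, h0]
    convert hasSum_zero (α := ℝ) (β := ℤ) using 2 with k
    rw [show freq k * (1 / 2) = freq k / 2 by ring, cos_freq_half, mul_zero]
  set c : ℤ → ℝ := fun k => ∫ y in (-(1 / 2 : ℝ))..(1 / 2), h y * Real.cos (freq k * y) with hcdef
  have : Fact ((0 : ℝ) < 1) := ⟨one_pos⟩
  -- The twist by exp(-πix) shifts half-integer frequencies to integers, so Fourier series on the
  -- circle of length one apply. The zeros of `h` at ±1/2 make the lift continuous.
  set f : ℝ → ℂ := fun x => h x * Complex.exp (((-Real.pi * x : ℝ) : ℂ) * Complex.I) with hf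
  have hfc : Continuous f := by fun_prop
  have hlc : Continuous (AddCircle.liftIco (1 : ℝ) (-(1 / 2)) f) := by
    apply AddCircle.liftIco_continuous
    · simp only [hf]
      rw [heven, show -(1 / 2 : ℝ) + 1 = 1 / 2 by norm_num, h0]
      simp
    · exact hfc.continuousOn
  have hcoeff : ∀ k : ℤ, fourierCoeff (AddCircle.liftIco (1 : ℝ) (-(1 / 2)) f) k = (c k : ℂ) := by
    intro k
    rw [fourierCoeff_liftIco_eq, fourierCoeffOn_eq_integral]
    have e1 : ∀ y : ℝ, _root_.fourier (-k) (y : AddCircle (-(1 / 2 : ℝ) + 1 - -(1 / 2))) • f y =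
        ((h y * Real.cos (freq k * y) : ℝ) : ℂ) -
          ((h y * Real.sin (freq k * y) : ℝ) : ℂ) * Complex.I := by
      intro y
      rw [fourier_coe_apply, smul_eq_mul]
      simp only [hf]
      rw [mul_left_comm, ← Complex.exp_add]
      have : 2 * (Real.pi : ℂ) * Complex.I * ((-k : ℤ) : ℂ) * (y : ℂ) /
          ((-(1 / 2 : ℝ) + 1 - -(1 / 2) : ℝ) : ℂ) + ((-Real.pi * y : ℝ) : ℂ) * Complex.I =
          ((-(freq k * y) : ℝ) : ℂ) * Complex.I := by
        have h1 : (-(1 / 2 : ℝ) + 1 - -(1 / 2)) = 1 := by norm_num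
        rw [h1]
        simp only [freq]
        push_cast
        ring
      rw [this, Complex.exp_mul_I, ← Complex.ofReal_cos, ← Complex.ofReal_sin, Real.cos_neg,
        Real.sin_neg]
      push_cast
      ring
    simp_rw [e1]
    have h1 : (-(1 / 2 : ℝ) + 1 - -(1 / 2)) = 1 := by norm_num
    have h2 : (-(1 / 2 : ℝ) + 1) = 1 / 2 := by norm_num
    rw [h1, h2]
    have hodd : ∫ y in (-(1 / 2 : ℝ))..(1 / 2), h y * Real.sin (freq k * y) = 0 := by
      have := intervalIntegral.integral_comp_neg (a := -(1 / 2 : ℝ)) (b := 1 / 2)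
        (fun y => h y * Real.sin (freq k * y))
      simp only [heven, mul_neg, Real.sin_neg, intervalIntegral.integral_neg, neg_neg] at this
      linarith
    rw [intervalIntegral.integral_sub (Continuous.intervalIntegrable (by fun_prop) _ _)
      (Continuous.intervalIntegrable (by fun_prop) _ _), intervalIntegral.integral_mul_const,
      intervalIntegral.integral_ofReal, intervalIntegral.integral_ofReal, hodd]
    simp [hcdef]
  have hsum : Summable (fourierCoeff (⟨_, hlc⟩ : C(AddCircle (1 : ℝ), ℂ))) := by
    have : (fourierCoeff (⟨_, hlc⟩ : C(AddCircle (1 : ℝ), ℂ))) = fun k => (c k : ℂ) :=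
      funext hcoeff
    rw [this]
    exact Complex.ofRealCLM.summable hs
  have key := has_pointwise_sum_fourier_series_of_summable hsum (x : AddCircle (1 : ℝ))
  have hval : (⟨_, hlc⟩ : C(AddCircle (1 : ℝ), ℂ)) (x : AddCircle (1 : ℝ)) = f x := by
    have hmem : x ∈ Ico (-(1 / 2 : ℝ)) (-(1 / 2) + 1) := ⟨hx.1, by linarith⟩
    change AddCircle.liftIco (1 : ℝ) (-(1 / 2)) f (x : AddCircle (1 : ℝ)) = f x
    exact AddCircle.liftIco_coe_apply hmem
  rw [hval] at key
  -- Multiplication by exp(πix) undoes the twist, and real parts recover the cosines.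
  have key2 := key.mul_left (Complex.exp (((Real.pi * x : ℝ) : ℂ) * Complex.I))
  have key3 := Complex.hasSum_re key2
  convert key3 using 1
  · ext k
    have : fourierCoeff (⟨_, hlc⟩ : C(AddCircle (1 : ℝ), ℂ)) k = c k := hcoeff k
    rw [this, fourier_coe_apply, smul_eq_mul, mul_left_comm, ← Complex.exp_add]
    have : ((Real.pi * x : ℝ) : ℂ) * Complex.I +
        2 * (Real.pi : ℂ) * Complex.I * (k : ℂ) * (x : ℂ) / ((1 : ℝ) : ℂ) =
        ((freq k * x : ℝ) : ℂ) * Complex.I := by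
      simp only [freq]
      push_cast
      ring
    rw [this, Complex.re_ofReal_mul, Complex.exp_ofReal_mul_I_re]
  · simp only [hf]
    rw [mul_left_comm, ← Complex.exp_add]
    simp

lemma integral_symm_eq_two_mul {f : ℝ → ℝ} (hf : Continuous f) (he : ∀ x, f (-x) = f x) (a : ℝ) :
    ∫ x in (-a)..a, f x = 2 * ∫ x in (0 : ℝ)..a, f x := by
  rw [← intervalIntegral.integral_add_adjacent_intervals (b := 0) (hf.intervalIntegrable _ _)
    (hf.intervalIntegrable _ _)]
  have := intervalIntegral.integral_comp_neg (a := 0) (b := a) f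
  simp only [he, neg_zero] at this
  rw [← this]; ring

end FourierSeries

/-! ### Signs and decay of the cosine coefficients of (1/2)^α - |x|^α -/

section PowerCoefficients

lemma hasDerivAt_sin_mul_div {ω : ℝ} (hω : ω ≠ 0) (x : ℝ) :
    HasDerivAt (fun x => Real.sin (ω * x) / ω) (Real.cos (ω * x)) x := by
  have := (((hasDerivAt_id x).const_mul ω).sin).div_const ω
  simpa [hω] using this

lemma hasDerivAt_neg_cos_mul_div {ω : ℝ} (hω : ω ≠ 0) (x : ℝ) :
    HasDerivAt (fun x => -Real.cos (ω * x) / ω) (Real.sin (ω * x)) x := by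
  have := (((hasDerivAt_id x).const_mul ω).cos).neg.div_const ω
  simpa [hω] using this

lemma continuous_rpow_of_nonneg {p : ℝ} (hp : 0 ≤ p) : Continuous fun x : ℝ => x ^ p :=
  Real.continuous_rpow_const hp

/-- The cosine coefficients of `(1/2)^α - |x|^α` on `[-1/2, 1/2]`. -/
lemma integral_pow_cos_freq {α : ℝ} (hα : 1 ≤ α) (k : ℤ) :
    ∫ x in (-(1 / 2 : ℝ))..(1 / 2), ((1 / 2 : ℝ) ^ α - |x| ^ α) * Real.cos (freq k * x) =
      2 / freq k * ∫ x in (0 : ℝ)..(1 / 2), α * x ^ (α - 1) * Real.sin (freq k * x) := by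
  have hω := freq_ne_zero k
  have hcont : Continuous fun x : ℝ => x ^ α := continuous_rpow_of_nonneg (by linarith)
  have hcont' : Continuous fun x : ℝ => x ^ (α - 1) := continuous_rpow_of_nonneg (by linarith)
  have hcabs : Continuous fun x : ℝ => |x| ^ α := hcont.comp continuous_abs
  rw [integral_symm_eq_two_mul (f := fun x => ((1 / 2 : ℝ) ^ α - |x| ^ α) * Real.cos (freq k * x))
    (by fun_prop) (fun x => by simp)]
  have e : ∫ x in (0 : ℝ)..(1 / 2), ((1 / 2 : ℝ) ^ α - |x| ^ α) * Real.cos (freq k * x) =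
      ∫ x in (0 : ℝ)..(1 / 2), ((1 / 2 : ℝ) ^ α - x ^ α) * Real.cos (freq k * x) := by
    refine intervalIntegral.integral_congr fun x hx => ?_
    rw [uIcc_of_le (by norm_num)] at hx
    simp only [abs_of_nonneg hx.1]
  rw [e, intervalIntegral.integral_mul_deriv_eq_deriv_mul
    (u := fun x => (1 / 2 : ℝ) ^ α - x ^ α) (u' := fun x => -(α * x ^ (α - 1)))
    (v := fun x => Real.sin (freq k * x) / freq k)
    (fun x _ => (Real.hasDerivAt_rpow_const (Or.inr hα)).const_sub _)
    (fun x _ => hasDerivAt_sin_mul_div hω x)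
    (Continuous.intervalIntegrable (by fun_prop) _ _)
    (Continuous.intervalIntegrable (by fun_prop) _ _)]
  have e2 : ∀ x : ℝ, -(α * x ^ (α - 1)) * (Real.sin (freq k * x) / freq k) =
      -(1 / freq k) * (α * x ^ (α - 1) * Real.sin (freq k * x)) := fun x => by ring
  simp_rw [e2]
  rw [intervalIntegral.integral_const_mul]
  simp
  ring

lemma integral_abs_cos_freq (k : ℤ) :
    ∫ x in (-(1 / 2 : ℝ))..(1 / 2), (1 / 2 - |x|) * Real.cos (freq k * x) = 2 / freq k ^ 2 := by
  have h := integral_pow_cos_freq le_rfl k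
  simp only [Real.rpow_one, sub_self, Real.rpow_zero, one_mul] at h
  rw [h, intervalIntegral.integral_eq_sub_of_hasDerivAt
    (fun x _ => hasDerivAt_neg_cos_mul_div (freq_ne_zero k) x)
    (Continuous.intervalIntegrable (by fun_prop) _ _),
    show freq k * (1 / 2) = freq k / 2 by ring, cos_freq_half]
  have := freq_ne_zero k
  simp
  field_simp

/-- A second integration by parts loses no boundary term: the cosine vanishes at 1/2 and the power α
- 1 > 0 vanishes at 0. The remaining exponent α - 2 is nonnegative, as the sign argument requires.
-/
lemma integral_pow_cos_freq_two {α : ℝ} (hα : 2 ≤ α) (k : ℤ) :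
    ∫ x in (-(1 / 2 : ℝ))..(1 / 2), ((1 / 2 : ℝ) ^ α - |x| ^ α) * Real.cos (freq k * x) =
      2 * α * (α - 1) / freq k ^ 2 *
        ∫ x in (0 : ℝ)..(1 / 2), x ^ (α - 2) * Real.cos (freq k * x) := by
  have hω := freq_ne_zero k
  have hcont' : Continuous fun x : ℝ => x ^ (α - 1) := continuous_rpow_of_nonneg (by linarith)
  have hcont2 : Continuous fun x : ℝ => x ^ (α - 2) := continuous_rpow_of_nonneg (by linarith)
  rw [integral_pow_cos_freq (by linarith), intervalIntegral.integral_mul_deriv_eq_deriv_mul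
    (u := fun x => α * x ^ (α - 1)) (u' := fun x => α * ((α - 1) * x ^ (α - 2)))
    (v := fun x => -Real.cos (freq k * x) / freq k)
    (fun x _ => by
      have := (Real.hasDerivAt_rpow_const (x := x) (p := α - 1) (Or.inr (by linarith))).const_mul α
      rwa [show α - 1 - 1 = α - 2 by ring] at this)
    (fun x _ => hasDerivAt_neg_cos_mul_div hω x)
    (Continuous.intervalIntegrable (by fun_prop) _ _)
    (Continuous.intervalIntegrable (by fun_prop) _ _)]
  have e2 : ∀ x : ℝ, α * ((α - 1) * x ^ (α - 2)) * (-Real.cos (freq k * x) / freq k) =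
      -(α * (α - 1) / freq k) * (x ^ (α - 2) * Real.cos (freq k * x)) := fun x => by ring
  simp_rw [e2]
  rw [intervalIntegral.integral_const_mul, show freq k * (1 / 2) = freq k / 2 by ring,
    cos_freq_half, Real.zero_rpow (by linarith)]
  simp
  field_simp

/-- For γ > 0, integrate by parts with the antiderivative (sin(ωx) - s)/ω, which vanishes at 1/2.
What is left is 1/ω times the integral of γ x^(γ-1)(1 - s sin(ωx)), a nonnegative integrand. The
case γ = 0 is explicit. -/
lemma integral_rpow_mul_cos_pos {γ ω s : ℝ} (hγ : 0 ≤ γ) (hω : 2 ≤ ω) (hs : Real.sin (ω / 2) = s)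
    (hs1 : s ^ 2 = 1) : 0 < s * ∫ x in (0 : ℝ)..(1 / 2), x ^ γ * Real.cos (ω * x) := by
  have hω0 : 0 < ω := by linarith
  rcases eq_or_lt_of_le hγ with rfl | hγ
  · simp only [Real.rpow_zero, one_mul]
    rw [intervalIntegral.integral_eq_sub_of_hasDerivAt
      (fun x _ => hasDerivAt_sin_mul_div hω0.ne' x)
      (Continuous.intervalIntegrable (by fun_prop) _ _),
      show ω * (1 / 2) = ω / 2 by ring, hs]
    simp only [mul_zero, Real.sin_zero, zero_div, sub_zero]
    rw [← mul_div_assoc, ← sq, hs1]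
    positivity
  have hcont : Continuous fun x : ℝ => x ^ γ := continuous_rpow_of_nonneg hγ.le
  have hintegral : ∀ a b : ℝ, IntervalIntegrable (fun x : ℝ => γ * x ^ (γ - 1)) volume a b :=
    fun a b =>
    (intervalIntegral.intervalIntegrable_rpow' (by linarith)).const_mul γ
  have hint2 : ∀ a b : ℝ, IntervalIntegrable
      (fun x : ℝ => γ * x ^ (γ - 1) * (1 - s * Real.sin (ω * x))) volume a b :=
    fun a b =>
    (hintegral a b).mul_continuousOn (by fun_prop)
  have ibp := intervalIntegral.integral_mul_deriv_eq_deriv_mul_of_hasDerivAt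
    (a := 0) (b := 1 / 2) (u := fun x : ℝ => x ^ γ) (u' := fun x => γ * x ^ (γ - 1))
    (v := fun x => Real.sin (ω * x) / ω - s / ω) (v' := fun x => Real.cos (ω * x))
    (by fun_prop) (by fun_prop)
    (fun x hx => Real.hasDerivAt_rpow_const (Or.inl (by
      rw [min_eq_left (by norm_num)] at hx; exact hx.1.ne')))
    (fun x _ => (hasDerivAt_sin_mul_div hω0.ne' x).sub_const _) (hintegral _ _)
    (Continuous.intervalIntegrable (by fun_prop) _ _)
  have e2 : ∀ x : ℝ, γ * x ^ (γ - 1) * (Real.sin (ω * x) / ω - s / ω) =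
      -(s / ω) * (γ * x ^ (γ - 1) * (1 - s * Real.sin (ω * x))) := fun x => by
    have : s * s = 1 := by rw [← sq, hs1]
    field_simp
    linear_combination (-x ^ (γ - 1) * Real.sin (ω * x)) * this
  simp_rw [e2] at ibp
  rw [intervalIntegral.integral_const_mul, Real.zero_rpow hγ.ne',
    show ω * (1 / 2) = ω / 2 by ring, hs] at ibp
  rw [ibp]
  have e3 : s * ((1 / 2 : ℝ) ^ γ * (s / ω - s / ω) - 0 * (Real.sin (ω * 0) / ω - s / ω) -
      -(s / ω) * ∫ x in (0 : ℝ)..(1 / 2), γ * x ^ (γ - 1) * (1 - s * Real.sin (ω * x))) =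
      (1 / ω) * ∫ x in (0 : ℝ)..(1 / 2), γ * x ^ (γ - 1) * (1 - s * Real.sin (ω * x)) := by
    have : s * s = 1 := by rw [← sq, hs1]
    field_simp
    linear_combination
      (∫ x in (0 : ℝ)..(1 / 2), γ * x ^ (γ - 1) * (1 - s * Real.sin (ω * x))) * this
  rw [e3]
  apply mul_pos (by positivity)
  have habs : |s| = 1 := by
    rw [← sq_eq_sq₀ (abs_nonneg s) zero_le_one, sq_abs, hs1, one_pow]
  -- On [0, 1/(2ω)] the sine is at most 1/2 in modulus, so the factor 1 - s sin(ωx) is at least 1/2;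
  -- strict positivity comes from this interval.
  have hδ0 : 0 < 1 / (2 * ω) := by positivity
  have hδ1 : 1 / (2 * ω) ≤ 1 / 2 := by
    rw [div_le_div_iff₀ (by positivity) (by positivity)]; linarith
  rw [← intervalIntegral.integral_add_adjacent_intervals (hint2 0 (1 / (2 * ω)))
    (hint2 (1 / (2 * ω)) (1 / 2))]
  refine add_pos_of_pos_of_nonneg ?_ (intervalIntegral.integral_nonneg hδ1 fun x hx => ?_)
  · have h1 : ∫ x in (0 : ℝ)..(1 / (2 * ω)), (1 / 2) * (γ * x ^ (γ - 1)) ≤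
        ∫ x in (0 : ℝ)..(1 / (2 * ω)), γ * x ^ (γ - 1) * (1 - s * Real.sin (ω * x)) := by
      refine intervalIntegral.integral_mono_on hδ0.le ((hintegral _ _).const_mul _) (hint2 _ _)
        fun x hx => ?_
      have hx0 : 0 ≤ γ * x ^ (γ - 1) := mul_nonneg hγ.le (Real.rpow_nonneg hx.1 _)
      have h2 : s * Real.sin (ω * x) ≤ 1 / 2 := by
        calc s * Real.sin (ω * x) ≤ |s * Real.sin (ω * x)| := le_abs_self _
          _ = |Real.sin (ω * x)| := by rw [abs_mul, habs, one_mul]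
          _ ≤ |ω * x| := Real.abs_sin_le_abs
          _ = ω * x := abs_of_nonneg (mul_nonneg hω0.le hx.1)
          _ ≤ ω * (1 / (2 * ω)) := by gcongr; exact hx.2
          _ = 1 / 2 := by field_simp
      nlinarith
    refine lt_of_lt_of_le ?_ h1
    rw [intervalIntegral.integral_const_mul, intervalIntegral.integral_const_mul,
      integral_rpow (Or.inl (by linarith)), sub_add_cancel, Real.zero_rpow hγ.ne']
    have := Real.rpow_pos_of_pos hδ0 γ
    simp only [sub_zero]
    positivity
  · have hx0 : 0 ≤ x := hδ0.le.trans hx.1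
    refine mul_nonneg (mul_nonneg hγ.le (Real.rpow_nonneg hx0 _)) (sub_nonneg.2 ?_)
    calc s * Real.sin (ω * x) ≤ |s * Real.sin (ω * x)| := le_abs_self _
      _ = |Real.sin (ω * x)| := by rw [abs_mul, habs, one_mul]
      _ ≤ 1 := Real.abs_sin_le_one _

/-- The cosine coefficients of `(1/2)^α - |x|^α`, normalized by their sign and frequency. -/
def powerCoeff (α : ℝ) (k : ℤ) : ℝ :=
  Real.sin (freq k / 2) / (2 * k + 1) *
    ∫ x in (-(1 / 2 : ℝ))..(1 / 2), ((1 / 2 : ℝ) ^ α - |x| ^ α) * Real.cos (freq k * x)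

lemma two_mul_add_one_ne_zero (k : ℤ) : (2 * (k : ℝ) + 1) ≠ 0 := by
  have : (2 * k + 1 : ℤ) ≠ 0 := by omega
  exact_mod_cast this

lemma powerCoeff_mul (α : ℝ) (k : ℤ) :
    powerCoeff α k * (Real.sin (freq k / 2) * (2 * k + 1)) =
      ∫ x in (-(1 / 2 : ℝ))..(1 / 2), ((1 / 2 : ℝ) ^ α - |x| ^ α) * Real.cos (freq k * x) := by
  have h := two_mul_add_one_ne_zero k
  have h2 := sin_freq_half_sq k
  unfold powerCoeff
  set I := ∫ x in (-(1 / 2 : ℝ))..(1 / 2), ((1 / 2 : ℝ) ^ α - |x| ^ α) * Real.cos (freq k * x)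
  field_simp
  linear_combination I * h2

lemma powerCoeff_pos {α : ℝ} (hα : 2 ≤ α) (k : ℤ) : 0 < powerCoeff α k := by
  have hω := freq_ne_zero k
  unfold powerCoeff
  rw [integral_pow_cos_freq_two hα]
  have hpos : 0 < 2 * α * (α - 1) / freq k ^ 2 := by
    have : 0 < α - 1 := by linarith
    have : 0 < α := by linarith
    positivity
  rw [mul_left_comm]
  apply mul_pos hpos
  have hpi := Real.pi_gt_three
  rw [div_mul_eq_mul_div]
  rcases le_or_gt 0 k with hk | hk
  · have hk' : (0 : ℝ) ≤ k := by exact_mod_cast hk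
    exact div_pos (integral_rpow_mul_cos_pos (by linarith) (by unfold freq; nlinarith) rfl
      (sin_freq_half_sq k)) (by positivity)
  -- For negative `k` the positive frequency is `-freq k`; the sign of the sine and the sign of 2k+1
  -- change together.
  · have hk' : (k : ℝ) ≤ -1 := by exact_mod_cast (show k ≤ -1 by omega)
    have := integral_rpow_mul_cos_pos (γ := α - 2) (ω := -freq k) (s := -Real.sin (freq k / 2))
      (by linarith) (by unfold freq; nlinarith) (by rw [neg_div, Real.sin_neg])
      (by rw [neg_sq, sin_freq_half_sq])
    simp only [neg_mul, Real.cos_neg] at this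
    apply div_pos_of_neg_of_neg <;> linarith

lemma abs_integral_pow_cos_freq_le {α : ℝ} (hα : 2 ≤ α) (k : ℤ) :
    |∫ x in (-(1 / 2 : ℝ))..(1 / 2), ((1 / 2 : ℝ) ^ α - |x| ^ α) * Real.cos (freq k * x)| ≤
      2 * α * (α - 1) * (freq k ^ 2)⁻¹ := by
  rw [integral_pow_cos_freq_two hα, abs_mul]
  have h0 : 0 ≤ 2 * α * (α - 1) / freq k ^ 2 := by
    have : 0 < α - 1 := by linarith
    have : 0 < α := by linarith
    positivity
  rw [abs_of_nonneg h0, ← div_eq_mul_inv]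
  refine mul_le_of_le_one_right h0 ?_
  have := intervalIntegral.norm_integral_le_of_norm_le_const (a := 0) (b := 1 / 2) (C := 1)
    (f := fun x => x ^ (α - 2) * Real.cos (freq k * x)) (fun x hx => by
      rw [uIoc_of_le (by norm_num)] at hx
      rw [norm_mul, Real.norm_eq_abs, Real.norm_eq_abs, abs_of_nonneg (Real.rpow_nonneg hx.1.le _)]
      exact mul_le_one₀ (Real.rpow_le_one hx.1.le (by linarith [hx.2]) (by linarith))
        (abs_nonneg _) (Real.abs_cos_le_one _))
  rw [Real.norm_eq_abs] at this
  refine this.trans ?_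
  norm_num

lemma summable_powerCoeff {α : ℝ} (hα : 2 ≤ α) :
    Summable fun k => powerCoeff α k * |2 * (k : ℝ) + 1| := by
  refine Summable.of_nonneg_of_le (fun k => mul_nonneg (powerCoeff_pos hα k).le (abs_nonneg _))
    (fun k => ?_) (summable_inv_freq_sq.mul_left (2 * α * (α - 1)))
  refine le_trans (le_of_eq ?_) (abs_integral_pow_cos_freq_le hα k)
  rw [← powerCoeff_mul, abs_mul, abs_mul, abs_of_pos (powerCoeff_pos hα k)]
  have : |Real.sin (freq k / 2)| = 1 := by
    rw [← sq_eq_sq₀ (abs_nonneg _) zero_le_one, sq_abs, sin_freq_half_sq, one_pow]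
  rw [this, one_mul]

lemma hasSum_powerCoeff {α : ℝ} (hα : 2 ≤ α) {x : ℝ} (hx : x ∈ Icc (-(1 / 2 : ℝ)) (1 / 2)) :
    HasSum (fun k : ℤ => powerCoeff α k *
      (Real.sin (freq k / 2) * (2 * k + 1) * Real.cos (freq k * x)))
      ((1 / 2 : ℝ) ^ α - |x| ^ α) := by
  have hcabs : Continuous fun x : ℝ => |x| ^ α :=
    (continuous_rpow_of_nonneg (by linarith)).comp continuous_abs
  have := hasSum_cos_freq (h := fun x => (1 / 2 : ℝ) ^ α - |x| ^ α) (by fun_prop)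
    (fun x => by simp) (by rw [abs_of_pos (by norm_num), sub_self])
    (Summable.of_norm_bounded (summable_inv_freq_sq.mul_left (2 * α * (α - 1)))
      fun k => abs_integral_pow_cos_freq_le hα k) hx
  simp_rw [← powerCoeff_mul, mul_assoc] at this
  simpa only [mul_assoc] using this

end PowerCoefficients

/-! ### Expansions of the triangle and of the parabola -/

section Waves

/-- The cosine expansion covers |x| ≤ 1/2. Both sides change sign under x ↦ x - 1 on [1/2, 1], which
reaches 1, and evenness gives the negative half. -/
lemma hasSum_triangle {x : ℝ} (hx : x ∈ Icc (-1 : ℝ) 1) :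
    HasSum (fun k : ℤ => 2 / freq k ^ 2 * Real.cos (freq k * x)) (1 / 2 - |x|) := by
  have base : ∀ {x : ℝ}, x ∈ Icc (-(1 / 2 : ℝ)) (1 / 2) →
      HasSum (fun k : ℤ => 2 / freq k ^ 2 * Real.cos (freq k * x)) (1 / 2 - |x|) := by
    intro x hx
    have := hasSum_cos_freq (h := fun x => 1 / 2 - |x|) (by fun_prop)
      (fun x => by simp) (by rw [abs_of_pos (by norm_num), sub_self])
      ((summable_inv_freq_sq.mul_left 2).congr fun k => by
        rw [integral_abs_cos_freq, div_eq_mul_inv]) hx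
    simpa only [integral_abs_cos_freq] using this
  have half : ∀ {x : ℝ}, 0 ≤ x → x ≤ 1 →
      HasSum (fun k : ℤ => 2 / freq k ^ 2 * Real.cos (freq k * x)) (1 / 2 - |x|) := by
    intro x h0 h1
    rcases le_or_gt x (1 / 2) with h | h
    · exact base ⟨by linarith, h⟩
    · have h2 := (base (x := x - 1) ⟨by linarith, by linarith⟩).neg
      have e : ∀ k : ℤ, 2 / freq k ^ 2 * Real.cos (freq k * x) =
          -(2 / freq k ^ 2 * Real.cos (freq k * (x - 1))) := fun k => by
        have := cos_freq_add_one k (x - 1)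
        rw [sub_add_cancel] at this
        rw [this]; ring
      have e2 : 1 / 2 - |x| = -(1 / 2 - |x - 1|) := by
        rw [abs_of_nonneg h0, abs_of_nonpos (by linarith)]; ring
      simp_rw [e, e2]
      exact h2
  rcases le_total 0 x with h | h
  · exact half h hx.2
  · have := half (x := -x) (by linarith) (by linarith [hx.1])
    simpa using this

/-- This is the exponent 2 case of the power expansion translated by 1/2: 1/4 - (x - 1/2)² = x(1 -
x), and the shifted cosines are sines up to sign. -/
lemma hasSum_parabola {x : ℝ} (hx : x ∈ Icc (0 : ℝ) 1) :
    HasSum (fun k : ℤ => 4 / freq k ^ 3 * Real.sin (freq k * x)) (x * (1 - x)) := by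
  have h := hasSum_powerCoeff (le_refl 2) (x := x - 1 / 2)
    ⟨by linarith [hx.1], by linarith [hx.2]⟩
  convert h using 1
  · ext k
    have hω := freq_ne_zero k
    rw [← mul_assoc, powerCoeff_mul, integral_pow_cos_freq_two le_rfl]
    simp only [sub_self, Real.rpow_zero, one_mul]
    rw [intervalIntegral.integral_eq_sub_of_hasDerivAt
      (fun x _ => hasDerivAt_sin_mul_div hω x)
      (Continuous.intervalIntegrable (by fun_prop) _ _),
      show freq k * (1 / 2) = freq k / 2 by ring,
      show freq k * (x - 1 / 2) = freq k * x - freq k / 2 by ring, Real.cos_sub, cos_freq_half]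
    simp only [mul_zero, Real.sin_zero, zero_div, sub_zero, zero_add]
    have h2 := sin_freq_half_sq k
    field_simp
    linear_combination (-4 * Real.sin (freq k * x)) * h2
  · have : |x - 1 / 2| ^ (2 : ℝ) = (x - 1 / 2) ^ 2 := by
      rw [Real.rpow_two, sq_abs]
    rw [this, Real.rpow_two]; ring

end Waves

/-! ### Real and imaginary parts, and the general characterization scheme -/

section Characterization

lemma moment_eq_lintegral_ofReal {E : Type*} [NormedAddCommGroup E] [MeasurableSpace E] {α : ℝ}
    (hα : 0 ≤ α) (μ : Measure E) :
    moment α μ = ∫⁻ x, ENNReal.ofReal (‖x‖ ^ α) ∂μ := by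
  unfold moment
  refine lintegral_congr fun x => ?_
  rw [← ofReal_norm, ENNReal.ofReal_rpow_of_nonneg (norm_nonneg _) hα]

variable {E : Type*} [NormedAddCommGroup E] [InnerProductSpace ℝ E] [MeasurableSpace E]
  [BorelSpace E]

lemma integrable_cos_inner (μ : Measure E) [IsFiniteMeasure μ] (ξ : E) :
    Integrable (fun x => Real.cos (2 * Real.pi * inner ℝ x ξ)) μ :=
  Integrable.of_bound (Continuous.aestronglyMeasurable (by fun_prop)) 1
    (ae_of_all _ fun _ => Real.abs_cos_le_one _)

lemma integrable_sin_inner (μ : Measure E) [IsFiniteMeasure μ] (ξ : E) :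
    Integrable (fun x => Real.sin (2 * Real.pi * inner ℝ x ξ)) μ :=
  Integrable.of_bound (Continuous.aestronglyMeasurable (by fun_prop)) 1
    (ae_of_all _ fun _ => Real.abs_sin_le_one _)

lemma fourier_eq_cos_sin (μ : Measure E) [IsFiniteMeasure μ] (ξ : E) :
    fourier μ ξ = ((∫ x, Real.cos (2 * Real.pi * inner ℝ x ξ) ∂μ : ℝ) : ℂ) -
      ((∫ x, Real.sin (2 * Real.pi * inner ℝ x ξ) ∂μ : ℝ) : ℂ) * Complex.I := by
  have e : ∀ x : E, Complex.exp (((-2 * Real.pi * inner ℝ x ξ : ℝ) : ℂ) * Complex.I) =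
      ((Real.cos (2 * Real.pi * inner ℝ x ξ) : ℝ) : ℂ) -
        ((Real.sin (2 * Real.pi * inner ℝ x ξ) : ℝ) : ℂ) * Complex.I := fun x => by
    rw [Complex.exp_mul_I, ← Complex.ofReal_cos, ← Complex.ofReal_sin,
      show -2 * Real.pi * inner ℝ x ξ = -(2 * Real.pi * inner ℝ x ξ) by ring, Real.cos_neg,
      Real.sin_neg]
    push_cast
    ring
  unfold fourier
  simp_rw [e]
  rw [integral_sub (integrable_cos_inner μ ξ).ofReal
    ((integrable_sin_inner μ ξ).ofReal.mul_const _), integral_mul_const, integral_complex_ofReal,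
    integral_complex_ofReal]

lemma fourier_re (μ : Measure E) [IsFiniteMeasure μ] (ξ : E) :
    (fourier μ ξ).re = ∫ x, Real.cos (2 * Real.pi * inner ℝ x ξ) ∂μ := by
  rw [fourier_eq_cos_sin]
  simp only [Complex.sub_re, Complex.mul_re, Complex.ofReal_re, Complex.ofReal_im, Complex.I_re,
    Complex.I_im]
  ring

lemma fourier_im (μ : Measure E) [IsFiniteMeasure μ] (ξ : E) :
    (fourier μ ξ).im = -∫ x, Real.sin (2 * Real.pi * inner ℝ x ξ) ∂μ := by
  rw [fourier_eq_cos_sin]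
  simp only [Complex.sub_im, Complex.mul_im, Complex.ofReal_re, Complex.ofReal_im, Complex.I_re,
    Complex.I_im]
  ring

/-- A normalized minimality statement, with uniqueness in the class `P`, characterizes the
extremizers in `P` up to rescaling. -/
lemma extremizers_eq_rescalings [SecondCountableTopology E] [Nontrivial E] {α β : ℝ}
    (hα : 0 < α) (hβ : 0 < β) {ν : Measure E} [IsFiniteMeasure ν] (hν : ν ≠ 0)
    (hF : fourierNorm β ν ≠ ∞)
    (hM : moment α ν ≠ ∞) {P : Measure E → Prop}
    (hP : ∀ μ, P μ → ∀ c t, P (rescale c t μ)) (hPν : P ν)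
    (h : ∀ μ : Measure E, IsFiniteMeasure μ → μ univ = ν univ →
      fourierNorm β μ ≤ fourierNorm β ν →
      moment α ν ≤ moment α μ ∧ (moment α μ = moment α ν → P μ → μ = ν)) (μ : Measure E) :
    (P μ ∧ IsExtremizer α β μ) ↔ IsRescaling μ ν := by
  have hext : IsExtremizer α β ν :=
    isExtremizer_of_forall hα hβ hν hF fun μ h1 h2 h3 => (h μ h1 h2 h3).1
  constructor
  · rintro ⟨hPμ, hμ⟩
    obtain ⟨c, t, hc, ht, hu, hf, hm⟩ := hext.exists_rescale hα hβ hF hM hμ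
    obtain ⟨hμ1, hμ2, hμ3⟩ := hμ
    have := (h _ inferInstance hu hf.le).2 hm (hP μ hPμ c t)
    refine isRescaling_iff.2 ⟨c⁻¹, t⁻¹, by positivity, by positivity, ?_⟩
    rw [← this, rescale_inv_cancel hc ht]
  · intro hr
    obtain ⟨c, t, hc, ht, rfl⟩ := isRescaling_iff.1 hr
    exact ⟨hP ν hPν c t, hext.rescale hα hβ hc ht⟩

end Characterization

/-! ### The interval and exponents (α, 1) in dimension one -/

section Indicator

lemma ofDensity_indicator_one : ofDensity f₁ = volume.restrict (Icc (-(1 / 2 : ℝ)) (1 / 2)) := by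
  have : (fun x => ENNReal.ofReal (f₁ x)) = (Icc (-(1 / 2 : ℝ)) (1 / 2)).indicator 1 := by
    ext x
    by_cases hx : x ∈ Icc (-(1 / 2 : ℝ)) (1 / 2)
    · rw [f₁, indicator_of_mem hx, indicator_of_mem hx]; simp
    · rw [f₁, indicator_of_notMem hx, indicator_of_notMem hx]; simp
  rw [ofDensity, this, withDensity_indicator_one measurableSet_Icc]

instance : IsFiniteMeasure (ofDensity f₁) := by
  rw [ofDensity_indicator_one]; infer_instance

lemma ofDensity_f₁_univ : ofDensity f₁ univ = 1 := by
  rw [ofDensity_indicator_one, Measure.restrict_apply MeasurableSet.univ, univ_inter,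
    Real.volume_Icc]
  norm_num

lemma integral_ofDensity_f₁ (F : ℝ → ℝ) :
    ∫ x, F x ∂(ofDensity f₁) = ∫ x in (-(1 / 2 : ℝ))..(1 / 2), F x := by
  rw [ofDensity_indicator_one, intervalIntegral.integral_of_le (by norm_num),
    integral_Icc_eq_integral_Ioc]

lemma integral_cos_symm {ω : ℝ} (hω : ω ≠ 0) (a : ℝ) :
    ∫ x in (-a)..a, Real.cos (ω * x) = 2 * Real.sin (ω * a) / ω := by
  rw [intervalIntegral.integral_eq_sub_of_hasDerivAt
    (fun x _ => hasDerivAt_sin_mul_div hω x) (Continuous.intervalIntegrable (by fun_prop) _ _)]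
  rw [mul_neg, Real.sin_neg]; ring

lemma integral_odd_symm {f : ℝ → ℝ} (hf : ∀ x, f (-x) = -f x) (a : ℝ) :
    ∫ x in (-a)..a, f x = 0 := by
  have := intervalIntegral.integral_comp_neg (a := -a) (b := a) f
  simp only [hf, intervalIntegral.integral_neg, neg_neg] at this
  linarith

/-- The transform is sin(πξ)/(πξ), so the bound is attained exactly at half-integers; this dictates
the test frequencies. -/
lemma norm_fourier_f₁_mul_le (ξ : ℝ) :
    ‖fourier (ofDensity f₁) ξ‖ * ‖ξ‖ ^ (1 : ℝ) ≤ 1 / Real.pi := by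
  rcases eq_or_ne ξ 0 with rfl | hξ
  · simp [Real.pi_pos.le]
  rw [fourier_eq_cos_sin, integral_ofDensity_f₁, integral_ofDensity_f₁]
  have hω : 2 * Real.pi * ξ ≠ 0 := by simp [Real.pi_ne_zero, hξ]
  have e1 : ∫ x in (-(1 / 2 : ℝ))..(1 / 2), Real.sin (2 * Real.pi * inner ℝ x ξ) = 0 :=
    integral_odd_symm (fun x => by simp) _
  have e2 : ∫ x in (-(1 / 2 : ℝ))..(1 / 2), Real.cos (2 * Real.pi * inner ℝ x ξ) =
      Real.sin (Real.pi * ξ) / (Real.pi * ξ) := by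
    have : ∀ x : ℝ, 2 * Real.pi * inner ℝ x ξ = 2 * Real.pi * ξ * x := fun x => by
      simp; ring
    simp_rw [this]
    rw [integral_cos_symm hω, show 2 * Real.pi * ξ * (1 / 2) = Real.pi * ξ by ring]
    field_simp
  rw [e1, e2, Real.rpow_one]
  simp only [Complex.ofReal_zero, zero_mul, sub_zero, Complex.norm_real, norm_div, norm_mul,
    Real.norm_eq_abs, abs_of_pos Real.pi_pos]
  have : |ξ| ≠ 0 := by simpa using hξ
  calc |Real.sin (Real.pi * ξ)| / (Real.pi * |ξ|) * |ξ| = |Real.sin (Real.pi * ξ)| / Real.pi := by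
        field_simp
    _ ≤ _ := by gcongr; exact Real.abs_sin_le_one _

/-- The signed cosine test functions for the indicator function. -/
def signedCos (k : ℤ) (x : ℝ) : ℝ := Real.sin (freq k / 2) * (2 * k + 1) * Real.cos (freq k * x)

lemma abs_sin_freq_half (k : ℤ) : |Real.sin (freq k / 2)| = 1 := by
  rw [← sq_eq_sq₀ (abs_nonneg _) zero_le_one, sq_abs, sin_freq_half_sq, one_pow]

lemma abs_signedCos_le (k : ℤ) (x : ℝ) : |signedCos k x| ≤ |2 * (k : ℝ) + 1| := by
  rw [signedCos, abs_mul, abs_mul, abs_sin_freq_half, one_mul]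
  exact mul_le_of_le_one_right (abs_nonneg _) (Real.abs_cos_le_one _)

lemma integral_signedCos_f₁ (k : ℤ) : ∫ x, signedCos k x ∂(ofDensity f₁) = 2 / Real.pi := by
  rw [integral_ofDensity_f₁]
  unfold signedCos
  rw [intervalIntegral.integral_const_mul, integral_cos_symm (freq_ne_zero k),
    show freq k * (1 / 2) = freq k / 2 by ring]
  have h := two_mul_add_one_ne_zero k
  have h2 := sin_freq_half_sq k
  have hpi := Real.pi_ne_zero
  rw [show Real.sin (freq k / 2) * (2 * ↑k + 1) * (2 * Real.sin (freq k / 2) / freq k) =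
    2 * Real.sin (freq k / 2) ^ 2 * (2 * k + 1) / freq k by ring, h2, freq]
  field_simp

lemma two_pi_inner_half (k : ℤ) (x : ℝ) :
    2 * Real.pi * inner ℝ x (k + 1 / 2 : ℝ) = freq k * x := by
  simp [freq]; ring

/-- This is the norm constraint at ξ = k + 1/2, with only the real part of the transform retained.
Saturation means that the real part has the full modulus, so the imaginary part vanishes and
supplies the sine moments for uniqueness. -/
lemma integral_signedCos_le {μ : Measure ℝ} [IsFiniteMeasure μ]
    (hF : fourierNorm 1 μ ≤ ENNReal.ofReal (1 / Real.pi)) (k : ℤ) :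
    ∫ x, signedCos k x ∂μ ≤ 2 / Real.pi ∧
      (∫ x, signedCos k x ∂μ = 2 / Real.pi → ∫ x, Real.sin (freq k * x) ∂μ = 0) := by
  have hb := norm_fourier_mul_le zero_le_one (by positivity) hF (k + 1 / 2 : ℝ)
  have hre := fourier_re μ (k + 1 / 2 : ℝ)
  have him := fourier_im μ (k + 1 / 2 : ℝ)
  simp_rw [two_pi_inner_half] at hre him
  have hs : ∫ x, signedCos k x ∂μ =
      Real.sin (freq k / 2) * (2 * k + 1) * (fourier μ (k + 1 / 2 : ℝ)).re := by
    unfold signedCos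
    rw [integral_const_mul, hre]
  set z := fourier μ (k + 1 / 2 : ℝ)
  have hk : |2 * (k : ℝ) + 1| = 2 * |(k : ℝ) + 1 / 2| := by
    rw [show 2 * (k : ℝ) + 1 = 2 * (k + 1 / 2) by ring, abs_mul, abs_two]
  rw [Real.rpow_one, Real.norm_eq_abs] at hb
  have habs : |∫ x, signedCos k x ∂μ| = 2 * |(k : ℝ) + 1 / 2| * |z.re| := by
    rw [hs, abs_mul, abs_mul, abs_sin_freq_half, one_mul, hk]
  have hkp : 0 < |(k : ℝ) + 1 / 2| := by
    have := two_mul_add_one_ne_zero k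
    rw [← abs_pos, hk] at this
    linarith
  have hre_le : |z.re| ≤ ‖z‖ := Complex.abs_re_le_norm z
  have h2 : (2 : ℝ) / Real.pi = 2 * (1 / Real.pi) := by ring
  constructor
  · refine (le_abs_self _).trans ?_
    rw [habs, h2]
    nlinarith
  · intro heq
    rw [heq, abs_of_pos (by positivity)] at habs
    have h3 : ‖z‖ ≤ |z.re| := by
      have : ‖z‖ * |(k : ℝ) + 1 / 2| ≤ |z.re| * |(k : ℝ) + 1 / 2| := by linarith
      exact le_of_mul_le_mul_right this hkp
    have h4 : z.im = 0 := Complex.abs_re_eq_norm.1 (le_antisymm hre_le h3)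
    linarith

/-- The antiperiodic extension of `(1/2)^α - |x|^α`. -/
def powerWave (α x : ℝ) : ℝ := ∑' k : ℤ, powerCoeff α k * signedCos k x

lemma powerWave_eq {α : ℝ} (hα : 2 ≤ α) {x : ℝ} (hx : x ∈ Icc (-(1 / 2 : ℝ)) (1 / 2)) :
    powerWave α x = (1 / 2 : ℝ) ^ α - |x| ^ α :=
  (hasSum_powerCoeff hα hx).tsum_eq

lemma powerWave_add_one (α x : ℝ) : powerWave α (x + 1) = -powerWave α x := by
  unfold powerWave
  rw [← tsum_neg]
  congr 1
  ext k
  simp only [signedCos, cos_freq_add_one]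
  ring

lemma powerWave_neg (α x : ℝ) : powerWave α (-x) = powerWave α x := by
  simp [powerWave, signedCos]

/-- Antiperiodicity makes the modulus 1-periodic, so the explicit formula at the distance to the
nearest integer suffices. -/
lemma abs_powerWave_le {α : ℝ} (hα : 2 ≤ α) (x : ℝ) : |powerWave α x| ≤ (1 / 2 : ℝ) ^ α := by
  have hper : Function.Periodic (fun x => |powerWave α x|) 1 := fun x => by
    simp only [powerWave_add_one, abs_neg]
  have h1 := hper.sub_int_mul_eq (x := x) (round x)
  rw [mul_one] at h1
  rw [← h1]
  have h2 := abs_le.1 (abs_sub_round x)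
  rw [powerWave_eq hα h2]
  have h3 : |x - round x| ^ α ≤ (1 / 2 : ℝ) ^ α :=
    Real.rpow_le_rpow (abs_nonneg _) (abs_sub_round x) (by linarith)
  have h4 : 0 ≤ |x - round x| ^ α := Real.rpow_nonneg (abs_nonneg _) _
  rw [abs_of_nonneg (by linarith)]
  linarith

/-- For 1/2 < |x| ≤ 1, antiperiodicity reduces the claim to 2(1/2)^α < |x|^α + (1 - |x|)^α, strict
convexity at the midpoint. For |x| > 1 the uniform bound on the wave is enough, as 2(1/2)^α ≤ 1. -/
lemma sub_powerWave_lt {α : ℝ} (hα : 2 ≤ α) {x : ℝ} (hx : 1 / 2 < |x|) :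
    (1 / 2 : ℝ) ^ α - powerWave α x < |x| ^ α := by
  wlog h0 : 0 ≤ x generalizing x
  · have := this (x := -x) (by simpa using hx) (by linarith)
    simpa [powerWave_neg] using this
  rw [abs_of_nonneg h0] at hx ⊢
  rcases le_or_gt x 1 with h1 | h1
  · have h2 := powerWave_add_one α (x - 1)
    rw [sub_add_cancel, powerWave_eq (x := x - 1) hα ⟨by linarith, by linarith⟩,
      abs_of_nonpos (by linarith)] at h2
    rw [h2]
    have hsc := (strictConvexOn_rpow (p := α) (by linarith)).2 (mem_Ici.2 h0)
      (mem_Ici.2 (show (0 : ℝ) ≤ 1 - x by linarith)) (by intro h; linarith)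
      (one_half_pos (α := ℝ)) (one_half_pos (α := ℝ)) (by norm_num)
    simp only [smul_eq_mul] at hsc
    rw [show 1 / 2 * x + 1 / 2 * (1 - x) = (1 / 2 : ℝ) by ring] at hsc
    rw [show -(x - 1) = 1 - x by ring]
    linarith
  · have h2 := neg_le_of_abs_le (abs_powerWave_le hα x)
    have h3 : 1 < x ^ α := Real.one_lt_rpow h1 (by linarith)
    have h4 : (1 / 2 : ℝ) ^ α ≤ (1 / 2 : ℝ) ^ (1 : ℝ) :=
      Real.rpow_le_rpow_of_exponent_ge (by norm_num) (by norm_num) (by linarith)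
    rw [Real.rpow_one] at h4
    linarith

lemma sub_powerWave_le {α : ℝ} (hα : 2 ≤ α) (x : ℝ) :
    (1 / 2 : ℝ) ^ α - powerWave α x ≤ |x| ^ α := by
  rcases le_or_gt |x| (1 / 2) with h | h
  · rw [powerWave_eq hα (abs_le.1 h)]; linarith
  · exact (sub_powerWave_lt hα h).le

lemma map_sub_map_add (μ : Measure ℝ) (a : ℝ) : (μ.map (· + a)).map (· - a) = μ := by
  rw [Measure.map_map (by fun_prop) (by fun_prop)]
  convert Measure.map_id
  ext x; simp

/-- Translation by 1/2 moves the support to [0, 1] and exchanges the roles: the signed cosines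
become multiples of sines, and the vanishing sine moments become cosine moments. -/
lemma eq_of_signedCos_moments {μ : Measure ℝ} [IsFiniteMeasure μ]
    (huniv : μ univ = ofDensity f₁ univ) (hF : fourierNorm 1 μ ≤ ENNReal.ofReal (1 / Real.pi))
    (hk : ∀ k, ∫ x, signedCos k x ∂μ = 2 / Real.pi) (hsupp : ∀ᵐ x ∂μ, |x| ≤ 1 / 2) :
    μ = ofDensity f₁ := by
  set τ : ℝ → ℝ := (· + (1 / 2 : ℝ)) with hτ
  have hτm : Measurable τ := by fun_prop
  have hFν := fourierNorm_le zero_le_one norm_fourier_f₁_mul_le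
  have hcs : ∀ (ρ : Measure ℝ) [IsFiniteMeasure ρ], fourierNorm 1 ρ ≤ ENNReal.ofReal (1 / Real.pi) →
      (∀ k, ∫ x, signedCos k x ∂ρ = 2 / Real.pi) → ∀ k : ℤ,
      (∫ y, Real.cos ((2 * k + 1) * Real.pi * y) ∂(ρ.map τ) = 0) ∧
      (∫ y, Real.sin ((2 * k + 1) * Real.pi * y) ∂(ρ.map τ) = 2 / ((2 * k + 1) * Real.pi)) := by
    intro ρ _ hρ hρk k
    rw [integral_map hτm.aemeasurable (Continuous.aestronglyMeasurable (by fun_prop)),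
      integral_map hτm.aemeasurable (Continuous.aestronglyMeasurable (by fun_prop))]
    have e1 : ∀ x, Real.cos ((2 * k + 1) * Real.pi * τ x) =
        -Real.sin (freq k / 2) * Real.sin (freq k * x) := fun x => by
      rw [show (2 * k + 1) * Real.pi * τ x = freq k * x + freq k / 2 by
        simp only [hτ, freq]; ring, Real.cos_add, cos_freq_half]
      ring
    have e2 : ∀ x, Real.sin ((2 * k + 1) * Real.pi * τ x) =
        1 / (2 * k + 1) * signedCos k x := fun x => by
      rw [show (2 * k + 1) * Real.pi * τ x = freq k * x + freq k / 2 by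
        simp only [hτ, freq]; ring, Real.sin_add, cos_freq_half, signedCos]
      have := two_mul_add_one_ne_zero k
      field_simp
      ring
    simp_rw [e1, e2]
    rw [integral_const_mul, integral_const_mul, hρk k, (integral_signedCos_le hρ k).2 (hρk k)]
    refine ⟨by simp, ?_⟩
    have := two_mul_add_one_ne_zero k
    field_simp
  have hμk := hcs μ hF hk
  have hνk := hcs (ofDensity f₁) hFν integral_signedCos_f₁
  have key : μ.map τ = (ofDensity f₁).map τ := by
    refine eq_of_trig_moments ?_ ?_ ?_ (fun k => by rw [(hμk k).1, (hνk k).1])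
      (s := fun k y => Real.sin ((2 * k + 1) * Real.pi * y)) (fun k => by fun_prop)
      (fun k x => ?_) (fun k => by rw [(hμk k).2, (hνk k).2]) ?_ ?_
    · rw [Measure.map_apply hτm .univ, Measure.map_apply hτm .univ]
      exact huniv
    · refine (ae_map_iff hτm.aemeasurable (p := (· ∈ Icc (0 : ℝ) 1)) measurableSet_Icc).2 ?_
      filter_upwards [hsupp] with x hx
      rw [abs_le] at hx
      simp only [hτ, mem_Icc]
      constructor <;> linarith
    · refine (ae_map_iff hτm.aemeasurable (p := (· ∈ Ioo (0 : ℝ) 1)) measurableSet_Ioo).2 ?_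
      rw [ofDensity_indicator_one, ← restrict_Ioo_eq_restrict_Icc]
      filter_upwards [ae_restrict_mem measurableSet_Ioo] with x hx
      simp only [hτ, mem_Ioo]
      constructor <;> linarith [hx.1, hx.2]
    · push_cast
      rw [show (2 * ((k : ℝ) + 1) + 1) * Real.pi * x = (2 * k + 1) * Real.pi * x +
        2 * (Real.pi * x) by ring, show (2 * ((k : ℝ) - 1) + 1) * Real.pi * x =
        (2 * k + 1) * Real.pi * x - 2 * (Real.pi * x) by ring, Real.sin_add, Real.sin_sub]
      ring
    · intro x hx
      have h1 := Real.sin_nonneg_of_nonneg_of_le_pi (x := Real.pi * x)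
        (mul_nonneg Real.pi_pos.le hx.1) (by nlinarith [hx.2, Real.pi_pos])
      simp only [Int.cast_zero, mul_zero, zero_add, one_mul]
      rw [show Real.pi * (1 - x) = Real.pi - Real.pi * x by ring, Real.sin_pi_sub]
      linarith
    · intro x hx
      have h1 := Real.sin_pos_of_pos_of_lt_pi (x := Real.pi * x)
        (mul_pos Real.pi_pos hx.1) (by nlinarith [hx.2, Real.pi_pos])
      simp only [Int.cast_zero, mul_zero, zero_add, one_mul]
      rw [show Real.pi * (1 - x) = Real.pi - Real.pi * x by ring, Real.sin_pi_sub]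
      linarith
  rw [← map_sub_map_add μ (1 / 2), ← map_sub_map_add (ofDensity f₁) (1 / 2), key]

/-- The extremizers for `(α, 1, 1)`, `α ≥ 2`. -/
theorem isExtremizer_iff_isRescaling_f₁ {α : ℝ} (hα : 2 ≤ α) (μ : Measure ℝ) :
    IsExtremizer α 1 μ ↔ IsRescaling μ (ofDensity f₁) := by
  have hFν := fourierNorm_le zero_le_one norm_fourier_f₁_mul_le
  have hν0 : ofDensity f₁ ≠ 0 := by
    intro h
    have := ofDensity_f₁_univ
    rw [h] at this
    simp at this
  have hm : Measurable fun x : ℝ => |x| ^ α :=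
    ((continuous_rpow_of_nonneg (by linarith)).comp continuous_abs).measurable
  have hsupp : ∀ᵐ x ∂(ofDensity f₁), |x| ^ α = (1 / 2 : ℝ) ^ α -
      ∑' k, powerCoeff α k * signedCos k x := by
    rw [ofDensity_indicator_one]
    filter_upwards [ae_restrict_mem measurableSet_Icc] with x hx
    have := powerWave_eq hα hx
    rw [powerWave] at this
    linarith
  have dual := fun (μ : Measure ℝ) (_ : IsFiniteMeasure μ) (hu : μ univ = ofDensity f₁ univ)
      (hF : fourierNorm 1 μ ≤ fourierNorm 1 (ofDensity f₁)) =>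
    lintegral_le_of_dual hu hm (fun x => Real.rpow_nonneg (abs_nonneg x) α) (powerCoeff_pos hα)
      abs_signedCos_le (fun k => by unfold signedCos; fun_prop) (summable_powerCoeff hα)
      (sub_powerWave_le hα) hsupp (fun k => by
        rw [integral_signedCos_f₁]; exact (integral_signedCos_le (hF.trans hFν) k).1)
  have hmom : ∀ μ : Measure ℝ, moment α μ = ∫⁻ x, ENNReal.ofReal (|x| ^ α) ∂μ := fun μ =>
    moment_eq_lintegral_ofReal (by linarith) μ
  have := extremizers_eq_rescalings (α := α) (β := 1) (by linarith) one_pos hν0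
    (ne_top_of_le_ne_top ENNReal.ofReal_ne_top hFν)
    (by rw [hmom]; exact (dual _ inferInstance rfl le_rfl).2.1)
    (P := fun _ => True) (fun _ _ _ _ => trivial) trivial
    (fun μ hμ hu hF => by
      rw [hmom, hmom]
      obtain ⟨h1, -, h3⟩ := dual μ hμ hu hF
      refine ⟨h1, fun heq _ => ?_⟩
      obtain ⟨h4, h5⟩ := h3 heq
      refine eq_of_signedCos_moments hu (hF.trans hFν)
        (fun k => by rw [h4, integral_signedCos_f₁]) ?_
      filter_upwards [h5] with x hx
      by_contra hlt
      exact (sub_powerWave_lt hα (not_le.1 hlt)).ne' hx) μ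
  simpa using this

end Indicator

/-! ### Integration against a density -/

section Density

variable {E : Type*} [MeasureSpace E] {f : E → ℝ}

lemma integral_ofDensity (hf : Measurable f) (h0 : ∀ x, 0 ≤ f x) (F : E → ℝ) :
    ∫ x, F x ∂(ofDensity f) = ∫ x, f x * F x := by
  have : ofDensity f = volume.withDensity (fun x => ((f x).toNNReal : ℝ≥0∞)) := rfl
  rw [this, integral_withDensity_eq_integral_smul hf.real_toNNReal]
  refine integral_congr_ae (ae_of_all _ fun x => ?_)
  simp [NNReal.smul_def, Real.coe_toNNReal _ (h0 x)]

lemma isFiniteMeasure_ofDensity (hf : Integrable f) : IsFiniteMeasure (ofDensity f) :=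
  isFiniteMeasure_withDensity hf.lintegral_lt_top.ne

lemma ae_ofDensity_of_ne_zero (hf : Measurable f) {p : E → Prop} (h : ∀ x, f x ≠ 0 → p x) :
    ∀ᵐ x ∂(ofDensity f), p x := by
  rw [ofDensity, ae_withDensity_iff (by fun_prop)]
  exact ae_of_all _ fun x hx => h x fun h0 => hx (by simp [h0])

end Density

/-! ### Fourier transforms of radial measures -/

section Radial

variable {E : Type*} [NormedAddCommGroup E] [InnerProductSpace ℝ E] [MeasurableSpace E]
  [BorelSpace E]

lemma fourier_map_isometry (μ : Measure E) (R : E ≃ₗᵢ[ℝ] E) (ξ : E) :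
    fourier (μ.map fun x => R x) ξ = fourier μ (R.symm ξ) := by
  have hR : Measurable fun x : E => R x := R.continuous.measurable
  unfold fourier
  rw [integral_map hR.aemeasurable]
  · have : ∀ x : E, inner ℝ (R x) ξ = inner ℝ x (R.symm ξ) := fun x => by
      rw [← R.inner_map_map x (R.symm ξ), R.apply_symm_apply]
    simp_rw [this]
  · apply Continuous.aestronglyMeasurable
    fun_prop

/-- The reflection in the hyperplane orthogonal to ξ - η carries ξ to η, and μ is invariant under
it. -/
lemma IsRadial.fourier_eq {μ : Measure E} (h : IsRadial μ) {ξ η : E} (hξ : ‖ξ‖ = ‖η‖) :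
    fourier μ ξ = fourier μ η := by
  set R := (Submodule.span ℝ {ξ - η})ᗮ.reflection
  have hR : R ξ = η := Submodule.reflection_sub hξ
  have h1 := fourier_map_isometry μ R η
  rw [h R] at h1
  rw [h1, ← hR, R.symm_apply_apply]

lemma isRadial_of_fourier [SecondCountableTopology E] [CompleteSpace E] {μ : Measure E}
    [IsFiniteMeasure μ] (h : ∀ ξ η : E, ‖ξ‖ = ‖η‖ → fourier μ ξ = fourier μ η) : IsRadial μ := by
  intro R
  apply ext_of_fourier
  intro ξ
  rw [fourier_map_isometry]
  exact h _ _ (R.symm.norm_map ξ)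

lemma fourier_neg (μ : Measure E) [IsFiniteMeasure μ] (ξ : E) :
    fourier μ (-ξ) = (starRingEnd ℂ) (fourier μ ξ) := by
  apply Complex.ext
  · simp [fourier_re]
  · simp only [fourier_im, Complex.conj_im, inner_neg_right, mul_neg, Real.sin_neg, integral_neg]

lemma IsRadial.fourier_im_eq_zero {μ : Measure E} [IsFiniteMeasure μ] (h : IsRadial μ) (ξ : E) :
    (fourier μ ξ).im = 0 := by
  have h1 := h.fourier_eq (norm_neg ξ)
  rw [fourier_neg] at h1
  exact Complex.conj_eq_iff_im.1 h1

end Radial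

/-! ### The hat function and its odd perturbation: norm bound -/

section Hat

lemma f₂Tilde_eq_indicator (ε : ℝ) : f₂Tilde ε =
    (Icc (-1 : ℝ) 1).indicator fun x => 1 - |x| + ε * Real.sin (2 * Real.pi * x) := by
  ext x
  by_cases hx : x ∈ Icc (-1 : ℝ) 1
  · rw [f₂Tilde, f₂, indicator_of_mem hx, indicator_of_mem hx, indicator_of_mem hx]
  · rw [f₂Tilde, f₂, indicator_of_notMem hx, indicator_of_notMem hx, indicator_of_notMem hx]
    simp

lemma f₂Tilde_zero : f₂Tilde 0 = f₂ := by
  ext x; simp [f₂Tilde]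

lemma measurable_f₂Tilde (ε : ℝ) : Measurable (f₂Tilde ε) := by
  rw [f₂Tilde_eq_indicator]
  exact Measurable.indicator (by fun_prop) measurableSet_Icc

lemma integrable_f₂Tilde (ε : ℝ) : Integrable (f₂Tilde ε) := by
  rw [f₂Tilde_eq_indicator, integrable_indicator_iff measurableSet_Icc]
  exact (Continuous.continuousOn (by fun_prop)).integrableOn_compact isCompact_Icc

/-- The sine vanishes at ±1 with slope at most 2π, so the hat, which also vanishes linearly there,
dominates a small multiple of it. -/
lemma abs_sin_two_pi_le {x : ℝ} (hx : |x| ≤ 1) :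
    |Real.sin (2 * Real.pi * x)| ≤ 2 * Real.pi * (1 - |x|) := by
  wlog h : 0 ≤ x generalizing x
  · have := this (x := -x) (by simpa using hx) (by linarith)
    simpa using this
  rw [abs_of_nonneg h] at hx ⊢
  have : Real.sin (2 * Real.pi * x) = -Real.sin (2 * Real.pi * (1 - x)) := by
    rw [show 2 * Real.pi * (1 - x) = 2 * Real.pi - 2 * Real.pi * x by ring, Real.sin_two_pi_sub,
      neg_neg]
  rw [this, abs_neg]
  refine Real.abs_sin_le_abs.trans (le_of_eq (abs_of_nonneg ?_))
  exact mul_nonneg (by positivity) (by linarith)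

lemma f₂Tilde_nonneg {ε : ℝ} (hε : |ε| ≤ 1 / 40) (x : ℝ) : 0 ≤ f₂Tilde ε x := by
  rw [f₂Tilde_eq_indicator]
  refine indicator_nonneg (fun x hx => ?_) x
  have hx' : |x| ≤ 1 := abs_le.2 hx
  have h1 := abs_sin_two_pi_le hx'
  have h2 : |ε * Real.sin (2 * Real.pi * x)| ≤ 1 - |x| := by
    rw [abs_mul]
    calc |ε| * |Real.sin (2 * Real.pi * x)| ≤ (1 / 40) * (2 * Real.pi * (1 - |x|)) :=
          mul_le_mul hε h1 (abs_nonneg _) (by norm_num)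
      _ ≤ 1 - |x| := by nlinarith [Real.pi_lt_four]
  have := neg_le_of_abs_le h2
  linarith

lemma isFiniteMeasure_f₂Tilde (ε : ℝ) : IsFiniteMeasure (ofDensity (f₂Tilde ε)) :=
  isFiniteMeasure_ofDensity (integrable_f₂Tilde ε)

lemma integral_f₂Tilde {ε : ℝ} (hε : |ε| ≤ 1 / 40) {F : ℝ → ℝ} (hF : Continuous F) :
    ∫ x, F x ∂(ofDensity (f₂Tilde ε)) = (∫ x in (-1 : ℝ)..1, (1 - |x|) * F x) +
      ε * ∫ x in (-1 : ℝ)..1, Real.sin (2 * Real.pi * x) * F x := by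
  rw [integral_ofDensity (measurable_f₂Tilde ε) (f₂Tilde_nonneg hε)]
  have : ∀ x, f₂Tilde ε x * F x = (Icc (-1 : ℝ) 1).indicator
      (fun x => (1 - |x|) * F x + ε * (Real.sin (2 * Real.pi * x) * F x)) x := fun x => by
    rw [f₂Tilde_eq_indicator]
    by_cases hx : x ∈ Icc (-1 : ℝ) 1
    · rw [indicator_of_mem hx, indicator_of_mem hx]; ring
    · rw [indicator_of_notMem hx, indicator_of_notMem hx]; ring
  simp_rw [this]
  rw [integral_indicator measurableSet_Icc, integral_Icc_eq_integral_Ioc,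
    ← intervalIntegral.integral_of_le (by norm_num),
    intervalIntegral.integral_add (Continuous.intervalIntegrable (by fun_prop) _ _)
      (Continuous.intervalIntegrable (by fun_prop) _ _), intervalIntegral.integral_const_mul]

lemma integral_hat_cos {ω : ℝ} (hω : ω ≠ 0) :
    ∫ x in (-1 : ℝ)..1, (1 - |x|) * Real.cos (ω * x) = 2 * (1 - Real.cos ω) / ω ^ 2 := by
  rw [integral_symm_eq_two_mul (f := fun x => (1 - |x|) * Real.cos (ω * x)) (by fun_prop)
    (fun x => by simp)]
  have e : ∫ x in (0 : ℝ)..1, (1 - |x|) * Real.cos (ω * x) =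
      ∫ x in (0 : ℝ)..1, (1 - x) * Real.cos (ω * x) := by
    refine intervalIntegral.integral_congr fun x hx => ?_
    rw [uIcc_of_le (by norm_num)] at hx
    simp only [abs_of_nonneg hx.1]
  have hd : ∀ x : ℝ, HasDerivAt (fun x => (1 - x) * (Real.sin (ω * x) / ω) +
      1 / ω * (-Real.cos (ω * x) / ω)) ((1 - x) * Real.cos (ω * x)) x := fun x => by
    have h1 := ((hasDerivAt_id x).const_sub 1).mul (hasDerivAt_sin_mul_div hω x)
    have h2 := (hasDerivAt_neg_cos_mul_div hω x).const_mul (1 / ω)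
    refine (h1.add h2).congr_deriv ?_
    simp only [id]
    ring
  rw [e, intervalIntegral.integral_eq_sub_of_hasDerivAt (fun x _ => hd x)
    (Continuous.intervalIntegrable (by fun_prop) _ _)]
  simp
  field_simp
  ring

lemma integral_one_sub_abs : ∫ x in (-1 : ℝ)..1, (1 - |x|) = 1 := by
  rw [integral_symm_eq_two_mul (f := fun x => (1 - |x|)) (by fun_prop) (fun x => by simp)]
  have e : ∫ x in (0 : ℝ)..1, (1 - |x|) = ∫ x in (0 : ℝ)..1, (1 - x) := by
    refine intervalIntegral.integral_congr fun x hx => ?_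
    rw [uIcc_of_le (by norm_num)] at hx
    simp only [abs_of_nonneg hx.1]
  rw [e, intervalIntegral.integral_sub (by simp) (by simp)]
  simp
  norm_num

lemma integral_cos_f₂Tilde {ε : ℝ} (hε : |ε| ≤ 1 / 40) {ω : ℝ} (hω : ω ≠ 0) :
    ∫ x, Real.cos (ω * x) ∂(ofDensity (f₂Tilde ε)) = 2 * (1 - Real.cos ω) / ω ^ 2 := by
  rw [integral_f₂Tilde hε (by fun_prop), integral_hat_cos hω,
    integral_odd_symm (f := fun x => Real.sin (2 * Real.pi * x) * Real.cos (ω * x))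
      (fun x => by simp)]
  ring

lemma f₂Tilde_univ {ε : ℝ} (hε : |ε| ≤ 1 / 40) : ofDensity (f₂Tilde ε) univ = 1 := by
  have := isFiniteMeasure_f₂Tilde ε
  have h := integral_f₂Tilde hε (F := fun _ => 1) continuous_const
  simp only [mul_one, integral_const, smul_eq_mul] at h
  rw [integral_one_sub_abs, integral_odd_symm (fun x => by simp), mul_zero, add_zero] at h
  rw [Measure.real, ENNReal.toReal_eq_one_iff] at h
  exact h

/-- The sine transform of `sin (2πx)` on `[-1, 1]` has zeros at the half-integers. -/
lemma integral_sin_mul_sin (ξ : ℝ) :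
    ∫ x in (-1 : ℝ)..1, Real.sin (2 * Real.pi * x) * Real.sin (2 * Real.pi * ξ * x) =
      -2 * Real.cos (Real.pi * ξ) * ∫ y in (-(1 / 2 : ℝ))..(1 / 2),
        Real.sin (2 * Real.pi * y) * Real.sin (2 * Real.pi * ξ * y) := by
  rw [integral_symm_eq_two_mul
    (f := fun x => Real.sin (2 * Real.pi * x) * Real.sin (2 * Real.pi * ξ * x)) (by fun_prop)
    (fun x => by simp)]
  have h := intervalIntegral.integral_comp_add_right (a := -(1 / 2 : ℝ)) (b := 1 / 2)
    (fun x => Real.sin (2 * Real.pi * x) * Real.sin (2 * Real.pi * ξ * x)) (1 / 2)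
  rw [show -(1 / 2 : ℝ) + 1 / 2 = 0 by norm_num, show (1 / 2 : ℝ) + 1 / 2 = 1 by norm_num] at h
  rw [← h]
  have e : ∀ y : ℝ, Real.sin (2 * Real.pi * (y + 1 / 2)) *
      Real.sin (2 * Real.pi * ξ * (y + 1 / 2)) =
      -Real.cos (Real.pi * ξ) * (Real.sin (2 * Real.pi * y) * Real.sin (2 * Real.pi * ξ * y)) +
      -Real.sin (Real.pi * ξ) *
        (Real.sin (2 * Real.pi * y) * Real.cos (2 * Real.pi * ξ * y)) := fun y => by
    rw [show 2 * Real.pi * (y + 1 / 2) = 2 * Real.pi * y + Real.pi by ring, Real.sin_add_pi,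
      show 2 * Real.pi * ξ * (y + 1 / 2) = 2 * Real.pi * ξ * y + Real.pi * ξ by ring,
      Real.sin_add]
    ring
  simp_rw [e]
  rw [intervalIntegral.integral_add (Continuous.intervalIntegrable (by fun_prop) _ _)
      (Continuous.intervalIntegrable (by fun_prop) _ _), intervalIntegral.integral_const_mul,
    intervalIntegral.integral_const_mul,
    integral_odd_symm (f := fun y => Real.sin (2 * Real.pi * y) * Real.cos (2 * Real.pi * ξ * y))
      (fun x => by simp)]
  ring

/-- Two integrations by parts reproduce the integral J: ξ² J = J - sin(πξ)/π. Both terms on the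
right are at most 1 in modulus. -/
lemma sq_mul_abs_integral_sin_le (ξ : ℝ) :
    ξ ^ 2 * |∫ y in (-(1 / 2 : ℝ))..(1 / 2),
      Real.sin (2 * Real.pi * y) * Real.sin (2 * Real.pi * ξ * y)| ≤ 2 := by
  rcases eq_or_ne ξ 0 with rfl | hξ
  · simp
  have hpi := Real.pi_pos
  have hω : 2 * Real.pi * ξ ≠ 0 := by simp [hξ, Real.pi_ne_zero]
  have h2 : 2 * Real.pi ≠ 0 := by positivity
  have dsin : ∀ y : ℝ, HasDerivAt (fun y => Real.sin (2 * Real.pi * y))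
      (2 * Real.pi * Real.cos (2 * Real.pi * y)) y := fun y => by
    have := ((hasDerivAt_id y).const_mul (2 * Real.pi)).sin
    simpa [mul_comm] using this
  have dcos : ∀ y : ℝ, HasDerivAt (fun y => Real.cos (2 * Real.pi * y))
      (-(2 * Real.pi * Real.sin (2 * Real.pi * y))) y := fun y => by
    have := ((hasDerivAt_id y).const_mul (2 * Real.pi)).cos
    simpa [mul_comm] using this
  have i1 := intervalIntegral.integral_mul_deriv_eq_deriv_mul (a := -(1 / 2 : ℝ)) (b := 1 / 2)
    (fun x _ => dsin x) (fun x _ => hasDerivAt_neg_cos_mul_div hω x)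
    (Continuous.intervalIntegrable (by fun_prop) _ _)
    (Continuous.intervalIntegrable (by fun_prop) _ _)
  have i2 := intervalIntegral.integral_mul_deriv_eq_deriv_mul (a := -(1 / 2 : ℝ)) (b := 1 / 2)
    (fun x _ => dcos x) (fun x _ => hasDerivAt_sin_mul_div hω x)
    (Continuous.intervalIntegrable (by fun_prop) _ _)
    (Continuous.intervalIntegrable (by fun_prop) _ _)
  have e1 : ∀ x : ℝ, 2 * Real.pi * Real.cos (2 * Real.pi * x) *
      (-Real.cos (2 * Real.pi * ξ * x) / (2 * Real.pi * ξ)) =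
      -(1 / ξ) * (Real.cos (2 * Real.pi * x) * Real.cos (2 * Real.pi * ξ * x)) := fun x => by
    field_simp
  have e2 : ∀ x : ℝ, -(2 * Real.pi * Real.sin (2 * Real.pi * x)) *
      (Real.sin (2 * Real.pi * ξ * x) / (2 * Real.pi * ξ)) =
      -(1 / ξ) * (Real.sin (2 * Real.pi * x) * Real.sin (2 * Real.pi * ξ * x)) := fun x => by
    field_simp
  have a1 : 2 * Real.pi * (1 / 2) = Real.pi := by ring
  have a2 : 2 * Real.pi * ξ * (1 / 2) = Real.pi * ξ := by ring
  simp_rw [e1] at i1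
  simp_rw [e2] at i2
  rw [intervalIntegral.integral_const_mul] at i1 i2
  simp only [mul_neg, Real.sin_neg, Real.cos_neg, a1, a2, Real.sin_pi, Real.cos_pi] at i1 i2
  set J := ∫ y in (-(1 / 2 : ℝ))..(1 / 2),
      Real.sin (2 * Real.pi * y) * Real.sin (2 * Real.pi * ξ * y) with hJ
  set K := ∫ y in (-(1 / 2 : ℝ))..(1 / 2),
      Real.cos (2 * Real.pi * y) * Real.cos (2 * Real.pi * ξ * y) with hK
  have hJ1 : |J| ≤ 1 := by
    have := intervalIntegral.norm_integral_le_of_norm_le_const (a := -(1 / 2 : ℝ)) (b := 1 / 2)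
      (C := 1) (f := fun y => Real.sin (2 * Real.pi * y) * Real.sin (2 * Real.pi * ξ * y))
      (fun x _ => by
        rw [norm_mul]
        exact mul_le_one₀ (Real.abs_sin_le_one _) (norm_nonneg _) (Real.abs_sin_le_one _))
    refine this.trans ?_
    norm_num
  have hid : ξ ^ 2 * J = -(Real.sin (Real.pi * ξ) / Real.pi) + J := by
    have h3 : J = 1 / ξ * K := by rw [i1]; ring
    have h4 : K = -(Real.sin (Real.pi * ξ) / (Real.pi * ξ)) + 1 / ξ * J := by
      rw [i2]; field_simp; ring
    have h5 : ξ * K = -(Real.sin (Real.pi * ξ) / Real.pi) + J := by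
      rw [h4]; field_simp
    rw [← h5, h3]
    field_simp
  rw [← abs_of_nonneg (sq_nonneg ξ), ← abs_mul, hid]
  refine (abs_add_le _ _).trans ?_
  have h6 : |-(Real.sin (Real.pi * ξ) / Real.pi)| ≤ 1 := by
    rw [abs_neg, abs_div, abs_of_pos hpi, div_le_one hpi]
    exact (Real.abs_sin_le_one _).trans (by linarith [Real.pi_gt_three])
  linarith

/-- With S = sin²(πξ) the sum is at most B²(S² + 1 - S), and S² ≤ S. Thus an imaginary part that
vanishes where the real part is maximal costs nothing. -/
lemma sq_add_sq_le_of_cos {a b ξ B : ℝ} (ha : |a| = B * Real.sin (Real.pi * ξ) ^ 2)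
    (hb : |b| ≤ B * |Real.cos (Real.pi * ξ)|) : a ^ 2 + b ^ 2 ≤ B ^ 2 := by
  have h1 : a ^ 2 = (B * Real.sin (Real.pi * ξ) ^ 2) ^ 2 := by rw [← ha, sq_abs]
  have h2 : b ^ 2 ≤ (B * |Real.cos (Real.pi * ξ)|) ^ 2 := by
    rw [← sq_abs b]; gcongr
  rw [mul_pow, sq_abs] at h2
  have h3 := Real.sin_sq_add_cos_sq (Real.pi * ξ)
  have h4 : Real.sin (Real.pi * ξ) ^ 2 ≤ 1 := Real.sin_sq_le_one _
  have h5 : (Real.sin (Real.pi * ξ) ^ 2) ^ 2 ≤ Real.sin (Real.pi * ξ) ^ 2 := by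
    nlinarith [sq_nonneg (Real.sin (Real.pi * ξ))]
  have h6 : Real.cos (Real.pi * ξ) ^ 2 = 1 - Real.sin (Real.pi * ξ) ^ 2 := by linarith
  rw [h6] at h2
  rw [h1, mul_pow]
  nlinarith [sq_nonneg B]

lemma norm_fourier_f₂Tilde_mul_le {ε : ℝ} (hε : |ε| ≤ 1 / 40) (ξ : ℝ) :
    ‖fourier (ofDensity (f₂Tilde ε)) ξ‖ * ‖ξ‖ ^ (2 : ℝ) ≤ 1 / Real.pi ^ 2 := by
  have := isFiniteMeasure_f₂Tilde ε
  rcases eq_or_ne ξ 0 with rfl | hξ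
  · simp
    positivity
  have hpi := Real.pi_pos
  have hω : 2 * Real.pi * ξ ≠ 0 := by simp [hξ, Real.pi_ne_zero]
  have hin : ∀ x : ℝ, 2 * Real.pi * inner ℝ x ξ = 2 * Real.pi * ξ * x := fun x => by simp; ring
  have hre := fourier_re (ofDensity (f₂Tilde ε)) ξ
  have him := fourier_im (ofDensity (f₂Tilde ε)) ξ
  simp_rw [hin] at hre him
  rw [integral_cos_f₂Tilde hε hω] at hre
  rw [integral_f₂Tilde hε (by fun_prop),
    integral_odd_symm (f := fun x => (1 - |x|) * Real.sin (2 * Real.pi * ξ * x))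
      (fun x => by simp), zero_add, integral_sin_mul_sin] at him
  have hJ := sq_mul_abs_integral_sin_le ξ
  set J := ∫ y in (-(1 / 2 : ℝ))..(1 / 2),
      Real.sin (2 * Real.pi * y) * Real.sin (2 * Real.pi * ξ * y)
  set z := fourier (ofDensity (f₂Tilde ε)) ξ
  rw [Real.rpow_two, Real.norm_eq_abs, sq_abs]
  have hn : ‖z‖ * ξ ^ 2 = ‖z * ((ξ ^ 2 : ℝ) : ℂ)‖ := by
    rw [norm_mul, Complex.norm_real, Real.norm_eq_abs, abs_of_nonneg (sq_nonneg ξ)]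
  rw [hn]
  refine (sq_le_sq₀ (norm_nonneg _) (by positivity)).1 ?_
  rw [← Complex.normSq_eq_norm_sq, Complex.normSq_apply, ← sq, ← sq]
  refine sq_add_sq_le_of_cos (ξ := ξ) ?_ ?_
  · rw [Complex.re_mul_ofReal, hre, show 2 * Real.pi * ξ = 2 * (Real.pi * ξ) by ring,
      Real.cos_two_mul, Real.cos_sq']
    rw [show 2 * (1 - (2 * (1 - Real.sin (Real.pi * ξ) ^ 2) - 1)) / (2 * (Real.pi * ξ)) ^ 2 * ξ ^ 2
      = 1 / Real.pi ^ 2 * Real.sin (Real.pi * ξ) ^ 2 by field_simp; ring]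
    exact abs_of_nonneg (by positivity)
  · rw [Complex.im_mul_ofReal, him,
      show -(ε * (-2 * Real.cos (Real.pi * ξ) * J)) * ξ ^ 2 =
        (2 * ε) * Real.cos (Real.pi * ξ) * (ξ ^ 2 * J) by ring, abs_mul, abs_mul, abs_mul, abs_two,
      abs_mul (ξ ^ 2), abs_of_nonneg (sq_nonneg ξ)]
    -- The perturbation contributes at most 4|ε||cos(πξ)|. As π² < 10, the bound 4/40 stays below
    -- 1/π²; this is the origin of 1/40.
    have h1 : 1 / 10 ≤ 1 / Real.pi ^ 2 := by
      apply one_div_le_one_div_of_le (by positivity)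
      have := Real.pi_lt_d2
      nlinarith
    calc 2 * |ε| * |Real.cos (Real.pi * ξ)| * (ξ ^ 2 * |J|)
        ≤ 2 * (1 / 40) * |Real.cos (Real.pi * ξ)| * 2 := by gcongr
      _ = 1 / 10 * |Real.cos (Real.pi * ξ)| := by ring
      _ ≤ _ := by gcongr

end Hat

/-! ### Extra moments from saturated constraints -/

section CriticalPoints

variable {ρ : Measure ℝ} [IsFiniteMeasure ρ]

lemma hasDerivAt_integral_cos (hρ : ∀ᵐ x ∂ρ, x ∈ Icc (0 : ℝ) 1) (θ : ℝ) :
    HasDerivAt (fun θ => ∫ x, Real.cos (θ * x) ∂ρ) (∫ x, -(x * Real.sin (θ * x)) ∂ρ) θ := by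
  refine (hasDerivAt_integral_of_dominated_loc_of_deriv_le (μ := ρ) (s := univ)
    (F := fun θ x => Real.cos (θ * x)) (F' := fun θ x => -(x * Real.sin (θ * x)))
    (bound := fun _ => 1) Filter.univ_mem
    (Filter.Eventually.of_forall fun θ => Continuous.aestronglyMeasurable (by fun_prop))
    (integrable_of_continuous_of_Icc hρ (by fun_prop))
    (Continuous.aestronglyMeasurable (by fun_prop)) ?_ (integrable_const _) ?_).2
  · filter_upwards [hρ] with x hx θ _
    rw [norm_neg, norm_mul]
    refine mul_le_one₀ ?_ (norm_nonneg _) (Real.abs_sin_le_one _)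
    rw [Real.norm_eq_abs, abs_of_nonneg hx.1]
    exact hx.2
  · refine ae_of_all _ fun x θ _ => ?_
    have := ((hasDerivAt_id θ).mul_const x).cos
    refine this.congr_deriv ?_
    simp only [id]
    ring

lemma hasDerivAt_mul_sinc (x θ : ℝ) :
    HasDerivAt (fun θ => θ * Real.sinc (θ * x)) (Real.cos (θ * x)) θ := by
  rcases eq_or_ne x 0 with rfl | hx
  · simpa using hasDerivAt_id' θ
  · have e : (fun θ => θ * Real.sinc (θ * x)) = fun θ => Real.sin (x * θ) / x := by
      ext θ
      rcases eq_or_ne θ 0 with rfl | hθ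
      · simp
      · rw [Real.sinc_of_ne_zero (mul_ne_zero hθ hx), mul_comm x θ]
        field_simp
    rw [e, mul_comm θ x]
    exact hasDerivAt_sin_mul_div hx θ

lemma hasDerivAt_integral_sinc (hρ : ∀ᵐ x ∂ρ, x ∈ Icc (0 : ℝ) 1) (θ : ℝ) :
    HasDerivAt (fun θ => ∫ x, θ * Real.sinc (θ * x) ∂ρ) (∫ x, Real.cos (θ * x) ∂ρ) θ := by
  refine (hasDerivAt_integral_of_dominated_loc_of_deriv_le (μ := ρ) (s := univ)
    (F := fun θ x => θ * Real.sinc (θ * x)) (F' := fun θ x => Real.cos (θ * x))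
    (bound := fun _ => 1) Filter.univ_mem
    (Filter.Eventually.of_forall fun θ => Continuous.aestronglyMeasurable (by fun_prop))
    (integrable_of_continuous_of_Icc hρ (by fun_prop))
    (Continuous.aestronglyMeasurable (by fun_prop)) ?_ (integrable_const _) ?_).2
  · exact ae_of_all _ fun x θ _ => Real.abs_cos_le_one _
  · exact ae_of_all _ fun x θ _ => hasDerivAt_mul_sinc x θ

/-- A saturated constraint is a global maximum in θ, so the derivative 2θK(θ) - θ²S(θ) vanishes at
ω, where K is the cosine integral and S the integral of x sin(θx). -/
lemma integral_mul_sin_of_maximum (hρ : ∀ᵐ x ∂ρ, x ∈ Icc (0 : ℝ) 1) {C ω : ℝ} (hω : ω ≠ 0)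
    (hle : ∀ θ, θ ^ 2 * ∫ x, Real.cos (θ * x) ∂ρ ≤ C)
    (heq : ω ^ 2 * ∫ x, Real.cos (ω * x) ∂ρ = C) :
    ∫ x, x * Real.sin (ω * x) ∂ρ = 2 * C / ω ^ 3 := by
  have hd := (hasDerivAt_pow 2 ω).mul (hasDerivAt_integral_cos hρ ω)
  have hmax : IsLocalMax (fun θ => θ ^ 2 * ∫ x, Real.cos (θ * x) ∂ρ) ω :=
    Filter.Eventually.of_forall fun θ => by simp only [heq]; exact hle θ
  have h0 := hmax.hasDerivAt_eq_zero hd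
  rw [integral_neg] at h0
  set S := ∫ x, x * Real.sin (ω * x) ∂ρ
  set K := ∫ x, Real.cos (ω * x) ∂ρ
  rw [← heq]
  have h1 : ω * S = 2 * K := by
    have : ω * (ω * S) = ω * (2 * K) := by
      simp at h0
      linear_combination -h0
    exact mul_left_cancel₀ hω this
  field_simp
  linear_combination h1

/-- Written as θ times the integral of θ sinc(θx), whose inner derivative is the integral of
cos(θx), the maximised quantity has critical point equation sinc integral + cosine integral = 0. -/
lemma integral_cos_of_maximum (hρ : ∀ᵐ x ∂ρ, x ∈ Icc (0 : ℝ) 1) {C ω : ℝ} (hω : ω ≠ 0)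
    (hle : ∀ θ, θ ^ 2 * ∫ x, Real.sinc (θ * x) ∂ρ ≤ C)
    (heq : ω ^ 2 * ∫ x, Real.sinc (ω * x) ∂ρ = C) :
    ∫ x, Real.cos (ω * x) ∂ρ = -C / ω ^ 2 := by
  have hd := (hasDerivAt_id ω).mul (hasDerivAt_integral_sinc hρ ω)
  have e : ∀ θ, θ * ∫ x, θ * Real.sinc (θ * x) ∂ρ = θ ^ 2 * ∫ x, Real.sinc (θ * x) ∂ρ := fun θ => by
    rw [integral_const_mul]; ring
  have hmax : IsLocalMax (fun θ => θ * ∫ x, θ * Real.sinc (θ * x) ∂ρ) ω :=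
    Filter.Eventually.of_forall fun θ => by simp only [e, heq]; exact hle θ
  have h0 := hmax.hasDerivAt_eq_zero hd
  rw [integral_const_mul] at h0
  set S := ∫ x, Real.sinc (ω * x) ∂ρ
  set K := ∫ x, Real.cos (ω * x) ∂ρ
  rw [← heq]
  have h1 : S + K = 0 := by
    have : ω * (S + K) = ω * 0 := by
      simp at h0
      linear_combination h0
    exact mul_left_cancel₀ hω this
  field_simp
  linear_combination h1

end CriticalPoints

/-! ### Extremality and radial uniqueness of the hat -/

section HatExtremizer

/-- The triangle wave of period two. -/
def triangleWave (x : ℝ) : ℝ := ∑' k : ℤ, 2 / freq k ^ 2 * Real.cos (freq k * x)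

lemma triangleWave_eq {x : ℝ} (hx : |x| ≤ 1) : triangleWave x = 1 / 2 - |x| :=
  (hasSum_triangle (abs_le.1 hx)).tsum_eq

lemma triangleWave_periodic : Function.Periodic triangleWave 2 := fun x => by
  unfold triangleWave
  congr 1
  ext k
  rw [show x + 2 = (x + 1) + 1 by ring, cos_freq_add_one, cos_freq_add_one, neg_neg]

lemma neg_half_le_triangleWave (x : ℝ) : -(1 / 2) ≤ triangleWave x := by
  have h1 := triangleWave_periodic.sub_int_mul_eq (x := x) (round (x / 2))
  have h2 := abs_sub_round (x / 2)
  have h3 : |x - round (x / 2) * 2| ≤ 1 := by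
    rw [show x - round (x / 2) * 2 = 2 * (x / 2 - round (x / 2)) by ring, abs_mul, abs_two]
    linarith
  rw [← h1, triangleWave_eq h3]
  linarith

lemma half_sub_triangleWave_lt {x : ℝ} (hx : 1 < |x|) : 1 / 2 - triangleWave x < |x| := by
  have := neg_half_le_triangleWave x
  linarith

lemma half_sub_triangleWave_le (x : ℝ) : 1 / 2 - triangleWave x ≤ |x| := by
  rcases le_or_gt |x| 1 with h | h
  · rw [triangleWave_eq h]; linarith
  · exact (half_sub_triangleWave_lt h).le

lemma integral_cos_freq_f₂Tilde {ε : ℝ} (hε : |ε| ≤ 1 / 40) (k : ℤ) :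
    ∫ x, Real.cos (freq k * x) ∂(ofDensity (f₂Tilde ε)) = 4 / freq k ^ 2 := by
  rw [integral_cos_f₂Tilde hε (freq_ne_zero k), cos_freq]
  norm_num

lemma sq_mul_integral_cos_le {μ : Measure ℝ} [IsFiniteMeasure μ]
    (hF : fourierNorm 2 μ ≤ ENNReal.ofReal (1 / Real.pi ^ 2)) (θ : ℝ) :
    θ ^ 2 * ∫ x, Real.cos (θ * x) ∂μ ≤ 4 := by
  have hpi := Real.pi_pos
  have h := norm_fourier_mul_le (by norm_num) (by positivity) hF (θ / (2 * Real.pi))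
  have hre := fourier_re μ (θ / (2 * Real.pi))
  have hin : ∀ x : ℝ, 2 * Real.pi * inner ℝ x (θ / (2 * Real.pi)) = θ * x := fun x => by
    simp; field_simp
  simp_rw [hin] at hre
  rw [← hre]
  have h1 := Complex.re_le_norm (fourier μ (θ / (2 * Real.pi)))
  rw [Real.rpow_two, Real.norm_eq_abs, sq_abs, div_pow] at h
  calc _ ≤ θ ^ 2 * ‖fourier μ (θ / (2 * Real.pi))‖ := by gcongr
    _ = (2 * Real.pi) ^ 2 * (‖fourier μ (θ / (2 * Real.pi))‖ * (θ ^ 2 / (2 * Real.pi) ^ 2)) := by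
        field_simp
    _ ≤ (2 * Real.pi) ^ 2 * (1 / Real.pi ^ 2) := by gcongr
    _ = 4 := by field_simp; norm_num

lemma integral_cos_freq_le {μ : Measure ℝ} [IsFiniteMeasure μ]
    (hF : fourierNorm 2 μ ≤ ENNReal.ofReal (1 / Real.pi ^ 2)) (k : ℤ) :
    ∫ x, Real.cos (freq k * x) ∂μ ≤ 4 / freq k ^ 2 := by
  have := sq_mul_integral_cos_le hF (freq k)
  have h0 := freq_ne_zero k
  rw [le_div_iff₀ (by positivity)]
  linarith

lemma ae_f₂Tilde (ε : ℝ) : ∀ᵐ x ∂(ofDensity (f₂Tilde ε)), |x| ≤ 1 := by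
  refine ae_ofDensity_of_ne_zero (measurable_f₂Tilde ε) fun x hx => ?_
  rw [f₂Tilde_eq_indicator] at hx
  have hx' : x ∈ Icc (-1 : ℝ) 1 := mem_of_indicator_ne_zero hx
  exact abs_le.2 hx'

/-- One certificate serves every small ε: the perturbation is odd, so it leaves the cosine integrals
unchanged, and its support stays in [-1, 1], where the triangle wave minorant is exact. -/
lemma hat_dual {ε : ℝ} (hε : |ε| ≤ 1 / 40) (μ : Measure ℝ) (hμ : IsFiniteMeasure μ)
    (hu : μ univ = ofDensity (f₂Tilde ε) univ)
    (hF : fourierNorm 2 μ ≤ fourierNorm 2 (ofDensity (f₂Tilde ε))) :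
    moment 1 (ofDensity (f₂Tilde ε)) ≤ moment 1 μ ∧ moment 1 (ofDensity (f₂Tilde ε)) ≠ ∞ ∧
      (moment 1 μ = moment 1 (ofDensity (f₂Tilde ε)) →
        (∀ k : ℤ, ∫ x, Real.cos (freq k * x) ∂μ = 4 / freq k ^ 2) ∧ ∀ᵐ x ∂μ, |x| ≤ 1) := by
  have := isFiniteMeasure_f₂Tilde ε
  have hFν := fourierNorm_le (by norm_num) (norm_fourier_f₂Tilde_mul_le hε)
  have hmom : ∀ μ : Measure ℝ, moment 1 μ = ∫⁻ x, ENNReal.ofReal |x| ∂μ := fun μ => by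
    rw [moment_eq_lintegral_ofReal zero_le_one μ]
    simp
  have key := lintegral_le_of_dual hu measurable_abs abs_nonneg (c := 1 / 2)
    (d := fun k : ℤ => 2 / freq k ^ 2) (e := fun k x => Real.cos (freq k * x)) (B := fun _ => 1)
    (fun k => by have := freq_ne_zero k; positivity) (fun k x => Real.abs_cos_le_one _)
    (fun k => by fun_prop)
    (by simpa [div_eq_mul_inv] using summable_inv_freq_sq.mul_left 2) half_sub_triangleWave_le
    ((ae_f₂Tilde ε).mono fun x hx => by
      have := triangleWave_eq hx
      rw [triangleWave] at this
      linarith)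
    (fun k => by rw [integral_cos_freq_f₂Tilde hε]; exact integral_cos_freq_le (hF.trans hFν) k)
  simp only [← hmom] at key
  refine ⟨key.1, key.2.1, fun heq => ?_⟩
  obtain ⟨h1, h2⟩ := key.2.2 heq
  refine ⟨fun k => by rw [h1, integral_cos_freq_f₂Tilde hε], ?_⟩
  filter_upwards [h2] with x hx
  by_contra hlt
  exact (half_sub_triangleWave_lt (not_le.1 hlt)).ne' hx

lemma ofDensity_f₂Tilde_ne_zero {ε : ℝ} (hε : |ε| ≤ 1 / 40) : ofDensity (f₂Tilde ε) ≠ 0 := by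
  intro h
  have := f₂Tilde_univ hε
  rw [h] at this
  simp at this

theorem isExtremizer_f₂Tilde {ε : ℝ} (hε : |ε| ≤ 1 / 40) :
    IsExtremizer 1 2 (ofDensity (f₂Tilde ε)) := by
  have := isFiniteMeasure_f₂Tilde ε
  have hFν := fourierNorm_le (by norm_num) (norm_fourier_f₂Tilde_mul_le hε)
  exact isExtremizer_of_forall one_pos two_pos (ofDensity_f₂Tilde_ne_zero hε)
    (ne_top_of_le_ne_top ENNReal.ofReal_ne_top hFν)
    fun μ h1 h2 h3 => (hat_dual hε μ h1 h2 h3).1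

/-- A radial measure has a real transform, but at ξ = 1 the imaginary part is -ε times the integral
of sin²(2πx) over [-1, 1]. -/
theorem not_isRadial_f₂Tilde {ε : ℝ} (hε : |ε| ≤ 1 / 40) (h0 : ε ≠ 0) :
    ¬ IsRadial (ofDensity (f₂Tilde ε)) := by
  intro h
  have := isFiniteMeasure_f₂Tilde ε
  have h1 := h.fourier_im_eq_zero 1
  rw [fourier_im] at h1
  have hin : ∀ x : ℝ, 2 * Real.pi * inner ℝ x (1 : ℝ) = 2 * Real.pi * x := fun x => by simp
  simp_rw [hin] at h1
  rw [integral_f₂Tilde hε (by fun_prop),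
    integral_odd_symm (f := fun x => (1 - |x|) * Real.sin (2 * Real.pi * x)) (fun x => by simp)]
    at h1
  have e : ∀ x : ℝ, Real.sin (2 * Real.pi * x) * Real.sin (2 * Real.pi * x) =
      1 / 2 - 1 / 2 * Real.cos (4 * Real.pi * x) := fun x => by
    rw [show 4 * Real.pi * x = 2 * (2 * Real.pi * x) by ring, Real.cos_two_mul, Real.cos_sq']
    ring
  simp_rw [e] at h1
  rw [intervalIntegral.integral_sub (by simp) (Continuous.intervalIntegrable (by fun_prop) _ _),
    intervalIntegral.integral_const_mul, integral_cos_symm (by positivity),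
    show 4 * Real.pi * 1 = Real.pi + Real.pi + Real.pi + Real.pi by ring] at h1
  simp only [Real.sin_add, Real.cos_add, Real.sin_pi, Real.cos_pi] at h1
  norm_num at h1
  exact h0 h1

lemma isRadial_f₂ : IsRadial (ofDensity f₂) := by
  rw [← f₂Tilde_zero]
  have := isFiniteMeasure_f₂Tilde 0
  have hε : |(0 : ℝ)| ≤ 1 / 40 := by norm_num
  have him : ∀ ξ, (fourier (ofDensity (f₂Tilde 0)) ξ).im = 0 := fun ξ => by
    rw [fourier_im, integral_f₂Tilde hε (by fun_prop), integral_odd_symm (fun x => by simp)]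
    simp
  refine isRadial_of_fourier fun ξ η h => ?_
  rcases abs_eq_abs.1 h with rfl | rfl
  · rfl
  · rw [fourier_neg]
    exact Complex.conj_eq_iff_im.2 (him η)

lemma IsRadial.fourier_eq_integral_abs {μ : Measure ℝ} [IsFiniteMeasure μ] (h : IsRadial μ)
    (ξ : ℝ) : fourier μ ξ = ((∫ x, Real.cos (2 * Real.pi * ξ * x) ∂(μ.map (|·|)) : ℝ) : ℂ) := by
  apply Complex.ext
  · rw [fourier_re, Complex.ofReal_re, integral_map measurable_abs.aemeasurable
      (Continuous.aestronglyMeasurable (by fun_prop))]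
    refine integral_congr_ae (ae_of_all _ fun x => ?_)
    simp only
    rw [← Real.cos_abs (2 * Real.pi * ξ * |x|), abs_mul, abs_abs, ← abs_mul, Real.cos_abs]
    congr 1
    simp; ring
  · rw [h.fourier_im_eq_zero, Complex.ofReal_im]

lemma eq_of_map_abs {μ ν : Measure ℝ} [IsFiniteMeasure μ] [IsFiniteMeasure ν] (hμ : IsRadial μ)
    (hν : IsRadial ν) (h : μ.map (|·|) = ν.map (|·|)) : μ = ν :=
  ext_of_fourier fun ξ => by rw [hμ.fourier_eq_integral_abs, hν.fourier_eq_integral_abs, h]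

/-- Folding by the absolute value moves everything to [0, 1]. The cosine moments are given, and the
critical points provide those of x sin((2k+1)πx). The symmetrised weight is x sin(πx) + (1 - x)
sin(πx) = sin(πx), positive inside. -/
lemma eq_f₂_of_moments {μ : Measure ℝ} [IsFiniteMeasure μ] (hrad : IsRadial μ)
    (huniv : μ univ = ofDensity f₂ univ)
    (hF : fourierNorm 2 μ ≤ ENNReal.ofReal (1 / Real.pi ^ 2))
    (hk : ∀ k : ℤ, ∫ x, Real.cos (freq k * x) ∂μ = 4 / freq k ^ 2) (hsupp : ∀ᵐ x ∂μ, |x| ≤ 1) :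
    μ = ofDensity f₂ := by
  have hfin : IsFiniteMeasure (ofDensity f₂) := by
    rw [← f₂Tilde_zero]; exact isFiniteMeasure_f₂Tilde 0
  have hε : |(0 : ℝ)| ≤ 1 / 40 := by norm_num
  have hFν : fourierNorm 2 (ofDensity f₂) ≤ ENNReal.ofReal (1 / Real.pi ^ 2) := by
    rw [← f₂Tilde_zero]
    exact fourierNorm_le (by norm_num) (norm_fourier_f₂Tilde_mul_le hε)
  have hνk : ∀ k : ℤ, ∫ x, Real.cos (freq k * x) ∂(ofDensity f₂) = 4 / freq k ^ 2 := fun k => by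
    rw [← f₂Tilde_zero, integral_cos_freq_f₂Tilde hε]
  have hνs : ∀ᵐ x ∂(ofDensity f₂), |x| ≤ 1 := by
    rw [← f₂Tilde_zero]; exact ae_f₂Tilde 0
  have habs : Measurable fun x : ℝ => |x| := measurable_abs
  have hI : ∀ ρ : Measure ℝ, (∀ᵐ x ∂ρ, |x| ≤ 1) → ∀ᵐ x ∂(ρ.map (|·|)), x ∈ Icc (0 : ℝ) 1 :=
    fun ρ hρ => (ae_map_iff habs.aemeasurable (p := (· ∈ Icc (0 : ℝ) 1)) measurableSet_Icc).2
      (hρ.mono fun x hx => ⟨abs_nonneg x, hx⟩)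
  have hcos : ∀ (ρ : Measure ℝ) (θ : ℝ),
      ∫ x, Real.cos (θ * x) ∂(ρ.map (|·|)) = ∫ x, Real.cos (θ * x) ∂ρ := fun ρ θ => by
    rw [integral_map habs.aemeasurable (Continuous.aestronglyMeasurable (by fun_prop))]
    refine integral_congr_ae (ae_of_all _ fun x => ?_)
    simp only
    rw [← Real.cos_abs, abs_mul, abs_abs, ← abs_mul, Real.cos_abs]
  have hsin : ∀ (ρ : Measure ℝ) [IsFiniteMeasure ρ],
      fourierNorm 2 ρ ≤ ENNReal.ofReal (1 / Real.pi ^ 2) →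
      (∀ k : ℤ, ∫ x, Real.cos (freq k * x) ∂ρ = 4 / freq k ^ 2) → (∀ᵐ x ∂ρ, |x| ≤ 1) → ∀ k : ℤ,
      ∫ x, x * Real.sin (freq k * x) ∂(ρ.map (|·|)) = 2 * 4 / freq k ^ 3 := by
    intro ρ _ h1 h2 h3 k
    refine integral_mul_sin_of_maximum (hI ρ h3) (freq_ne_zero k)
      (fun θ => by rw [hcos]; exact sq_mul_integral_cos_le h1 θ) ?_
    rw [hcos, h2]
    have := freq_ne_zero k
    field_simp
  refine eq_of_map_abs hrad isRadial_f₂ ?_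
  refine eq_of_trig_moments ?_ (hI μ hsupp) ?_ (fun k => ?_)
    (s := fun k y => y * Real.sin ((2 * k + 1) * Real.pi * y)) (fun k => by fun_prop)
    (fun k x => ?_) (fun k => ?_) ?_ ?_
  · rw [Measure.map_apply habs .univ, Measure.map_apply habs .univ]
    exact huniv
  · refine (ae_map_iff habs.aemeasurable (p := (· ∈ Ioo (0 : ℝ) 1)) measurableSet_Ioo).2 ?_
    have hac : ofDensity f₂ ≪ volume := withDensity_absolutelyContinuous _ _
    have hne : ∀ a : ℝ, ∀ᵐ x ∂(ofDensity f₂), x ≠ a := fun a =>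
      hac.ae_le (Measure.ae_ne volume a)
    filter_upwards [hνs, hne 0, hne 1, hne (-1)] with x h1 h2 h3 h4
    refine ⟨abs_pos.2 h2, lt_of_le_of_ne h1 fun h => ?_⟩
    rcases (abs_eq zero_le_one).1 h with h | h
    · exact h3 h
    · exact h4 h
  · have h1 := hcos μ (freq k)
    have h2 := hcos (ofDensity f₂) (freq k)
    rw [hk] at h1
    rw [hνk, ← h1] at h2
    exact h2.symm
  · push_cast
    rw [show (2 * ((k : ℝ) + 1) + 1) * Real.pi * x = (2 * k + 1) * Real.pi * x +
      2 * (Real.pi * x) by ring, show (2 * ((k : ℝ) - 1) + 1) * Real.pi * x =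
      (2 * k + 1) * Real.pi * x - 2 * (Real.pi * x) by ring, Real.sin_add, Real.sin_sub]
    ring
  · have h1 := hsin μ hF hk hsupp k
    have h2 := hsin (ofDensity f₂) hFν hνk hνs k
    rw [← h2] at h1
    exact h1
  · intro x hx
    have h1 := Real.sin_nonneg_of_nonneg_of_le_pi (x := Real.pi * x)
      (mul_nonneg Real.pi_pos.le hx.1) (by nlinarith [hx.2, Real.pi_pos])
    simp only [Int.cast_zero, mul_zero, zero_add, one_mul]
    rw [show Real.pi * (1 - x) = Real.pi - Real.pi * x by ring, Real.sin_pi_sub]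
    linarith
  · intro x hx
    have h1 := Real.sin_pos_of_pos_of_lt_pi (x := Real.pi * x)
      (mul_pos Real.pi_pos hx.1) (by nlinarith [hx.2, Real.pi_pos])
    simp only [Int.cast_zero, mul_zero, zero_add, one_mul]
    rw [show Real.pi * (1 - x) = Real.pi - Real.pi * x by ring, Real.sin_pi_sub]
    linarith

/-- The radial extremizers for `(1, 2, 1)`. -/
theorem isRadial_isExtremizer_iff_isRescaling_f₂ (μ : Measure ℝ) :
    (IsRadial μ ∧ IsExtremizer 1 2 μ) ↔ IsRescaling μ (ofDensity f₂) := by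
  have hε : |(0 : ℝ)| ≤ 1 / 40 := by norm_num
  have hd := hat_dual hε
  have hν0 := ofDensity_f₂Tilde_ne_zero hε
  have hFν := fourierNorm_le (by norm_num) (norm_fourier_f₂Tilde_mul_le hε)
  have hfin := isFiniteMeasure_f₂Tilde 0
  rw [f₂Tilde_zero] at hd hν0 hFν hfin
  exact extremizers_eq_rescalings one_pos two_pos hν0
    (ne_top_of_le_ne_top ENNReal.ofReal_ne_top hFν) (hd _ hfin rfl le_rfl).2.1
    (P := IsRadial) (fun μ h c t => h.rescale c t) isRadial_f₂
    (fun μ hμ hu hF => ⟨(hd μ hμ hu hF).1, fun heq hr => by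
      obtain ⟨h1, h2⟩ := (hd μ hμ hu hF).2.2 heq
      exact eq_f₂_of_moments hr hu (hF.trans hFν) h1 h2⟩) μ

end HatExtremizer

/-! ### Moments and Fourier transform of the unit sphere in dimension three -/

section Sphere

/-- Three-dimensional Euclidean space. -/
abbrev Space : Type := EuclideanSpace ℝ (Fin 3)

lemma integral_even_pow_mul_gaussian (k : ℕ) :
    ∫ t : ℝ, t ^ (2 * k) * Real.exp (-t ^ 2) = Real.Gamma (k + 1 / 2) := by
  have h := integral_comp_abs (f := fun t : ℝ => t ^ (2 * k) * Real.exp (-t ^ 2))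
  simp only [sq_abs, pow_mul] at h
  simp only [pow_mul]
  rw [h]
  have h2 := integral_rpow_mul_exp_neg_rpow (p := 2) (q := 2 * k) (by norm_num)
    (by have : (0 : ℝ) ≤ k := by positivity
        linarith)
  have e : ∫ x in Ioi (0 : ℝ), (x ^ 2) ^ k * Real.exp (-x ^ 2) =
      ∫ x in Ioi (0 : ℝ), x ^ (2 * (k : ℝ)) * Real.exp (-x ^ (2 : ℝ)) := by
    refine setIntegral_congr_fun measurableSet_Ioi fun x hx => ?_
    simp only [Real.rpow_two]
    congr 1
    rw [← pow_mul, ← Real.rpow_natCast]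
    push_cast
    rfl
  rw [e, h2, show (2 * (k : ℝ) + 1) / 2 = k + 1 / 2 by ring]
  ring

lemma integral_pow_add_two_mul_gaussian (n : ℕ) :
    ∫ r in Ioi (0 : ℝ), r ^ 2 * (r ^ n * Real.exp (-r ^ 2)) = Real.Gamma ((n + 3) / 2) / 2 := by
  have h2 := integral_rpow_mul_exp_neg_rpow (p := 2) (q := n + 2) (by norm_num)
    (by have : (0 : ℝ) ≤ n := by positivity
        linarith)
  have e : ∫ r in Ioi (0 : ℝ), r ^ 2 * (r ^ n * Real.exp (-r ^ 2)) =
      ∫ x in Ioi (0 : ℝ), x ^ ((n : ℝ) + 2) * Real.exp (-x ^ (2 : ℝ)) := by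
    refine setIntegral_congr_fun measurableSet_Ioi fun x hx => ?_
    simp only [Real.rpow_two]
    rw [← mul_assoc, ← pow_add]
    congr 1
    rw [← Real.rpow_natCast]
    push_cast
    rw [add_comm]
  rw [e, h2, show (n : ℝ) + 2 + 1 = n + 3 by ring]
  ring

lemma integral_coord_pow_mul_gaussian (n : ℕ) :
    ∫ y : Space, y 0 ^ n * Real.exp (-‖y‖ ^ 2) =
      Real.pi * ∫ t : ℝ, t ^ n * Real.exp (-t ^ 2) := by
  rw [← (PiLp.volume_preserving_toLp (Fin 3)).integral_comp
    (MeasurableEquiv.toLp 2 (Fin 3 → ℝ)).measurableEmbedding]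
  have e : ∀ y : Fin 3 → ℝ, (WithLp.toLp 2 y : Space) 0 ^ n *
      Real.exp (-‖(WithLp.toLp 2 y : Space)‖ ^ 2) =
      ∏ i, (if i = 0 then (fun t : ℝ => t ^ n * Real.exp (-t ^ 2))
        else fun t : ℝ => Real.exp (-t ^ 2)) (y i) := fun y => by
    rw [Fin.prod_univ_three, EuclideanSpace.norm_sq_eq, Fin.sum_univ_three]
    simp [Real.exp_add]
    ring
  simp_rw [e]
  rw [integral_fintype_prod_volume_eq_prod
    (fun i : Fin 3 => if i = 0 then (fun t : ℝ => t ^ n * Real.exp (-t ^ 2))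
        else fun t : ℝ => Real.exp (-t ^ 2)), Fin.prod_univ_three]
  have hg := integral_gaussian 1
  simp only [div_one, neg_mul, one_mul] at hg
  simp [hg]
  have := Real.mul_self_sqrt Real.pi_pos.le
  linear_combination (∫ t : ℝ, t ^ n * Real.exp (-t ^ 2)) * this

/-- The Gaussian is invariant under reflections, so `x` may be moved to the first coordinate axis,
where the integral factorises. -/
lemma integral_inner_pow_mul_gaussian (x : Space) (n : ℕ) :
    ∫ y : Space, inner ℝ x y ^ n * Real.exp (-‖y‖ ^ 2) =
      ‖x‖ ^ n * (Real.pi * ∫ t : ℝ, t ^ n * Real.exp (-t ^ 2)) := by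
  set v : Space := ‖x‖ • EuclideanSpace.single 0 1 with hv
  have hvn : ‖x‖ = ‖v‖ := by simp [hv, norm_smul]
  set R := (Submodule.span ℝ {x - v})ᗮ.reflection
  have hR : R x = v := Submodule.reflection_sub hvn
  rw [← R.symm.measurePreserving.integral_comp R.symm.toHomeomorph.measurableEmbedding]
  have e : ∀ y : Space, inner ℝ x (R.symm y) ^ n * Real.exp (-‖R.symm y‖ ^ 2) =
      ‖x‖ ^ n * (y 0 ^ n * Real.exp (-‖y‖ ^ 2)) := fun y => by
    rw [R.symm.norm_map, ← R.inner_map_map x (R.symm y), R.apply_symm_apply, hR, hv,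
      inner_smul_left]
    simp [EuclideanSpace.inner_single_left, mul_pow]
    ring
  simp_rw [e]
  rw [integral_const_mul, integral_coord_pow_mul_gaussian]

/-- In polar coordinates the angular factor is the desired sphere moment. Comparison with the
Cartesian value of the same Gaussian integral then determines that moment. -/
lemma integral_polar_inner_pow (x : Space) (n : ℕ) :
    ∫ y : Space, inner ℝ x y ^ n * Real.exp (-‖y‖ ^ 2) =
      (∫ ω, inner ℝ x (ω : Space) ^ n ∂(volume : Measure Space).toSphere) *
        ∫ r in Ioi (0 : ℝ), r ^ 2 * (r ^ n * Real.exp (-r ^ 2)) := by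
  have hdim : Module.finrank ℝ Space - 1 = 2 := by simp [Space]
  have hmp := (volume : Measure Space).measurePreserving_homeomorphUnitSphereProd
  rw [hdim] at hmp
  calc ∫ y : Space, inner ℝ x y ^ n * Real.exp (-‖y‖ ^ 2)
      = ∫ y : ({0}ᶜ : Set Space), inner ℝ x (y : Space) ^ n * Real.exp (-‖(y : Space)‖ ^ 2)
          ∂(Measure.comap Subtype.val volume) := by
        rw [integral_subtype_comap (measurableSet_singleton _).compl
          fun y : Space => inner ℝ x y ^ n * Real.exp (-‖y‖ ^ 2), restrict_compl_singleton]
    _ = ∫ p, (inner ℝ x (p.1 : Space) ^ n) * ((p.2 : ℝ) ^ n * Real.exp (-(p.2 : ℝ) ^ 2))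
          ∂((volume : Measure Space).toSphere.prod (Measure.volumeIoiPow 2)) := by
        rw [← hmp.integral_comp (Homeomorph.measurableEmbedding _)]
        refine integral_congr_ae (ae_of_all _ fun y => ?_)
        have hy : ‖(y : Space)‖ ≠ 0 := norm_ne_zero_iff.2 y.2
        simp only [homeomorphUnitSphereProd_apply_snd_coe, homeomorphUnitSphereProd_apply_fst_coe,
          inner_smul_right]
        have h1 : ‖(y : Space)‖⁻¹ ^ n * ‖(y : Space)‖ ^ n = 1 := by
          rw [← mul_pow, inv_mul_cancel₀ hy, one_pow]
        rw [mul_pow]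
        linear_combination (-(inner ℝ x (y : Space) ^ n * Real.exp (-‖(y : Space)‖ ^ 2))) * h1
    _ = _ := by
        rw [integral_prod_mul (fun ω : Metric.sphere (0 : Space) 1 => inner ℝ x (ω : Space) ^ n)
          (fun r : Ioi (0 : ℝ) => (r : ℝ) ^ n * Real.exp (-(r : ℝ) ^ 2)), Measure.volumeIoiPow]
        congr 1
        simp_rw [ENNReal.ofReal]
        rw [integral_withDensity_eq_integral_smul (by fun_prop),
          integral_subtype_comap measurableSet_Ioi fun r : ℝ =>
            Real.toNNReal (r ^ 2) • (r ^ n * Real.exp (-r ^ 2))]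
        refine setIntegral_congr_fun measurableSet_Ioi fun r hr => ?_
        simp [NNReal.smul_def, Real.coe_toNNReal _ (sq_nonneg r)]

/-- The Cartesian side carries Γ(k + 1/2) and the radial side Γ(k + 3/2) = (k + 1/2)Γ(k + 1/2); the
Gamma factor cancels and leaves the denominator 2k + 1. -/
lemma integral_sphere_inner_pow_even (x : Space) (k : ℕ) :
    ∫ ω, inner ℝ x (ω : Space) ^ (2 * k) ∂(volume : Measure Space).toSphere =
      4 * Real.pi / (2 * k + 1) * ‖x‖ ^ (2 * k) := by
  have h1 := integral_polar_inner_pow x (2 * k)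
  rw [integral_inner_pow_mul_gaussian, integral_even_pow_mul_gaussian,
    integral_pow_add_two_mul_gaussian] at h1
  have hk : (0 : ℝ) < k + 1 / 2 := by positivity
  have hG := Real.Gamma_pos_of_pos hk
  rw [show (((2 * k : ℕ) : ℝ) + 3) / 2 = (k + 1 / 2) + 1 by push_cast; ring,
    Real.Gamma_add_one hk.ne'] at h1
  set I := ∫ ω, inner ℝ x (ω : Space) ^ (2 * k) ∂(volume : Measure Space).toSphere
  set G := Real.Gamma (k + 1 / 2)
  have h2 : G * (‖x‖ ^ (2 * k) * Real.pi) = G * (I * ((k + 1 / 2) / 2)) := by linarith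
  have h3 := mul_left_cancel₀ hG.ne' h2
  rw [div_mul_eq_mul_div, eq_div_iff (by positivity)]
  linear_combination -4 * h3

lemma integral_sphere_inner_pow_odd (x : Space) (k : ℕ) :
    ∫ ω, inner ℝ x (ω : Space) ^ (2 * k + 1) ∂(volume : Measure Space).toSphere = 0 := by
  have h1 := integral_polar_inner_pow x (2 * k + 1)
  have h0 : ∫ t : ℝ, t ^ (2 * k + 1) * Real.exp (-t ^ 2) = 0 := by
    have := integral_neg_eq_self (fun t : ℝ => t ^ (2 * k + 1) * Real.exp (-t ^ 2)) volume
    simp only [Odd.neg_pow (odd_two_mul_add_one k), neg_sq, neg_mul, integral_neg] at this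
    linarith
  rw [integral_inner_pow_mul_gaussian, h0, integral_pow_add_two_mul_gaussian] at h1
  have hG : 0 < Real.Gamma ((((2 * k + 1 : ℕ) : ℝ) + 3) / 2) :=
    Real.Gamma_pos_of_pos (by positivity)
  have h2 : (∫ ω, inner ℝ x (ω : Space) ^ (2 * k + 1) ∂(volume : Measure Space).toSphere) *
    (Real.Gamma ((((2 * k + 1 : ℕ) : ℝ) + 3) / 2) / 2) = 0 := by rw [← h1]; ring
  rcases mul_eq_zero.1 h2 with h3 | h3
  · exact h3
  · linarith

lemma abs_inner_sphere_le (x : Space) (ω : Metric.sphere (0 : Space) 1) :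
    |inner ℝ x (ω : Space)| ≤ ‖x‖ := by
  have := abs_real_inner_le_norm x (ω : Space)
  rwa [norm_eq_of_mem_sphere, mul_one] at this

/-- On the sphere |⟨x, ω⟩| ≤ ‖x‖, so the exponential series dominates and Taylor series integrate
termwise. The exponents `m` are left free to cover both cosine and sine. -/
lemma hasSum_sphere_series (x : Space) {m : ℕ → ℕ} (hm : Function.Injective m) {f : ℝ → ℝ}
    (hf : ∀ t, HasSum (fun n : ℕ => (-1 : ℝ) ^ n * t ^ m n / (m n).factorial) (f t)) :
    HasSum (fun n : ℕ => (-1 : ℝ) ^ n / (m n).factorial *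
      ∫ ω, inner ℝ x (ω : Space) ^ m n ∂(volume : Measure Space).toSphere)
      (∫ ω, f (inner ℝ x (ω : Space)) ∂(volume : Measure Space).toSphere) := by
  set σ := (volume : Measure Space).toSphere
  have hintegral : ∀ n, Integrable (fun ω : Metric.sphere (0 : Space) 1 =>
      (-1 : ℝ) ^ n / (m n).factorial * inner ℝ x (ω : Space) ^ m n) σ := fun n => by
    refine Integrable.of_bound (Continuous.aestronglyMeasurable (by fun_prop))
      (1 / (m n).factorial * ‖x‖ ^ m n) (ae_of_all _ fun ω => ?_)
    rw [norm_mul, norm_div, norm_pow, norm_neg, norm_one, one_pow, Real.norm_natCast, norm_pow]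
    gcongr
    exact abs_inner_sphere_le x ω
  have key := hasSum_integral_of_summable_integral_norm hintegral (by
    have hs := ((Real.summable_pow_div_factorial ‖x‖).comp_injective hm).mul_right (σ.real univ)
    refine Summable.of_nonneg_of_le (fun n => integral_nonneg fun ω => norm_nonneg _)
      (fun n => ?_) hs
    calc ∫ ω, ‖(-1 : ℝ) ^ n / (m n).factorial * inner ℝ x (ω : Space) ^ m n‖ ∂σ
        ≤ ∫ _ω, ‖x‖ ^ m n / (m n).factorial ∂σ := by
          refine integral_mono (hintegral n).norm (integrable_const _) fun ω => ?_
          simp only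
          rw [norm_mul, norm_div, norm_pow, norm_neg, norm_one, one_pow, Real.norm_natCast,
            norm_pow, div_mul_eq_mul_div, one_mul]
          gcongr
          exact abs_inner_sphere_le x ω
      _ = _ := by simp [mul_comm])
  simp_rw [integral_const_mul] at key
  have e : ∫ ω, f (inner ℝ x (ω : Space)) ∂σ = ∫ ω : Metric.sphere (0 : Space) 1,
      ∑' n, (-1 : ℝ) ^ n / (m n).factorial * inner ℝ x (ω : Space) ^ m n ∂σ := by
    refine integral_congr_ae (ae_of_all _ fun ω => ?_)
    simp only
    rw [← (hf (inner ℝ x (ω : Space))).tsum_eq]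
    congr 1
    ext n
    ring
  rw [e]
  exact key

/-- The cosine transform of the surface measure of the unit sphere. -/
lemma integral_sphere_cos (x : Space) :
    ∫ ω, Real.cos (inner ℝ x (ω : Space)) ∂(volume : Measure Space).toSphere =
      4 * Real.pi * Real.sinc ‖x‖ := by
  have h := hasSum_sphere_series x (m := fun n => 2 * n) (fun a b h => by simpa using h)
    Real.hasSum_cos
  simp_rw [integral_sphere_inner_pow_even] at h
  refine h.unique ?_
  rcases eq_or_ne x 0 with rfl | hx
  · convert hasSum_single (α := ℝ) (β := ℕ) 0 fun n hn => ?_ using 1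
    · simp
    · simp [hn]
  · have hx' : ‖x‖ ≠ 0 := norm_ne_zero_iff.2 hx
    rw [Real.sinc_of_ne_zero hx']
    have := (Real.hasSum_sin ‖x‖).mul_left (4 * Real.pi / ‖x‖)
    rw [show 4 * Real.pi * (Real.sin ‖x‖ / ‖x‖) = 4 * Real.pi / ‖x‖ * Real.sin ‖x‖ by ring]
    refine (funext fun n => ?_ : (fun n : ℕ => (-1 : ℝ) ^ n / ((2 * n).factorial : ℝ) *
      (4 * Real.pi / (2 * n + 1) * ‖x‖ ^ (2 * n))) = _) ▸ this
    rw [Nat.factorial_succ, pow_succ]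
    have : ((2 * n).factorial : ℝ) ≠ 0 := by positivity
    push_cast
    field_simp

lemma integral_sphere_sin (x : Space) :
    ∫ ω, Real.sin (inner ℝ x (ω : Space)) ∂(volume : Measure Space).toSphere = 0 := by
  have h := hasSum_sphere_series x (m := fun n => 2 * n + 1) (fun a b h => by simpa using h)
    Real.hasSum_sin
  simp_rw [integral_sphere_inner_pow_odd, mul_zero] at h
  exact h.unique hasSum_zero

lemma toSphere_univ : (volume : Measure Space).toSphere univ = ENNReal.ofReal (4 * Real.pi) := by
  rw [Measure.toSphere_apply_univ, EuclideanSpace.volume_ball_fin_three]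
  simp only [finrank_euclideanSpace, Fintype.card_fin, ENNReal.ofReal_one, one_pow, one_mul]
  rw [show ((3 : ℕ) : ℝ≥0∞) = ENNReal.ofReal 3 by simp, ← ENNReal.ofReal_mul (by norm_num)]
  congr 1
  ring

end Sphere

/-! ### Spherical averages and radial integrals in dimension three -/

section RadialSpace

lemma integral_sphere_cos_smul (x : Space) {ρ : ℝ} (hρ : 0 ≤ ρ) :
    ∫ ω, Real.cos (2 * Real.pi * inner ℝ x (ρ • (ω : Space))) ∂(volume : Measure Space).toSphere =
      4 * Real.pi * Real.sinc (2 * Real.pi * ρ * ‖x‖) := by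
  have h := integral_sphere_cos ((2 * Real.pi * ρ) • x)
  have hpi := Real.pi_pos
  rw [norm_smul, Real.norm_eq_abs, abs_of_nonneg (by positivity)] at h
  rw [← h]
  refine integral_congr_ae (ae_of_all _ fun ω => ?_)
  simp only [inner_smul_left, inner_smul_right]
  congr 1
  simp
  ring

lemma toSphere_real_univ : (volume : Measure Space).toSphere.real univ = 4 * Real.pi := by
  rw [Measure.real, toSphere_univ, ENNReal.toReal_ofReal (by positivity)]

/-- Fubini reduces this to the transform of the sphere. The weight `f` allows use with a general
measure (`f = 1`) as well as with a radial density. -/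
lemma integral_sphere_weighted {μ : Measure Space} [SFinite μ] {f : Space → ℝ}
    (hf : Integrable f μ) {ρ : ℝ} (hρ : 0 ≤ ρ) :
    ∫ ω, (∫ x, f x * Real.cos (2 * Real.pi * inner ℝ x (ρ • (ω : Space))) ∂μ)
      ∂(volume : Measure Space).toSphere =
      4 * Real.pi * ∫ x, f x * Real.sinc (2 * Real.pi * ρ * ‖x‖) ∂μ := by
  rw [integral_integral_swap]
  · rw [← integral_const_mul]
    refine integral_congr_ae (ae_of_all _ fun x => ?_)
    simp only
    rw [integral_const_mul, integral_sphere_cos_smul x hρ]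
    ring
  · have h1 : Integrable (fun p : Metric.sphere (0 : Space) 1 × Space => f p.2)
        ((volume : Measure Space).toSphere.prod μ) := hf.comp_snd _
    refine h1.mul_bdd (c := 1) (Continuous.aestronglyMeasurable ?_)
      (ae_of_all _ fun p => Real.abs_cos_le_one _)
    fun_prop

lemma norm_smul_sphere {ρ : ℝ} (hρ : 0 ≤ ρ) (ω : Metric.sphere (0 : Space) 1) :
    ‖ρ • (ω : Space)‖ = ρ := by
  rw [norm_smul, norm_eq_of_mem_sphere, mul_one, Real.norm_eq_abs, abs_of_nonneg hρ]

lemma integral_sphere_fourier_re (μ : Measure Space) [IsFiniteMeasure μ] {ρ : ℝ} (hρ : 0 ≤ ρ) :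
    ∫ ω, (fourier μ (ρ • ((ω : Metric.sphere (0 : Space) 1) : Space))).re
      ∂(volume : Measure Space).toSphere =
      4 * Real.pi * ∫ x, Real.sinc (2 * Real.pi * ρ * ‖x‖) ∂μ := by
  have := integral_sphere_weighted (μ := μ) (f := fun _ => 1) (integrable_const 1) hρ
  simp only [one_mul] at this
  rw [← this]
  simp_rw [fourier_re]

/-- The pointwise bound on μ̂ is averaged over the sphere |ξ| = ρ. Radiality is not needed, so the
resulting lower bounds on moments hold for all competitors. -/
lemma integral_sinc_le {β A : ℝ} (hβ : 0 ≤ β) (hA : 0 ≤ A) {μ : Measure Space} [IsFiniteMeasure μ]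
    (hF : fourierNorm β μ ≤ ENNReal.ofReal A) {ρ : ℝ} (hρ : 0 < ρ) :
    (∫ x, Real.sinc (2 * Real.pi * ρ * ‖x‖) ∂μ) ≤ A / ρ ^ β := by
  have h1 := integral_sphere_fourier_re μ hρ.le
  have hpi := Real.pi_pos
  have h2 : ∫ ω, (fourier μ (ρ • ((ω : Metric.sphere (0 : Space) 1) : Space))).re
      ∂(volume : Measure Space).toSphere ≤
      ∫ _ω, A / ρ ^ β ∂(volume : Measure Space).toSphere := by
    have hle : ∀ ω : Metric.sphere (0 : Space) 1,
        |(fourier μ (ρ • (ω : Space))).re| ≤ A / ρ ^ β := fun ω => by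
      refine (Complex.abs_re_le_norm _).trans ?_
      have := norm_fourier_mul_le hβ hA hF (ρ • (ω : Space))
      rw [norm_smul_sphere hρ.le] at this
      rwa [le_div_iff₀ (Real.rpow_pos_of_pos hρ β)]
    refine integral_mono (Integrable.of_bound (Continuous.aestronglyMeasurable ?_) (A / ρ ^ β)
      (ae_of_all _ hle)) (integrable_const _) fun ω => (le_abs_self _).trans (hle ω)
    exact Complex.continuous_re.comp ((continuous_fourier μ).comp (by fun_prop))
  rw [h1, integral_const, toSphere_real_univ, smul_eq_mul] at h2
  exact le_of_mul_le_mul_left h2 (by positivity)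

lemma IsRadial.fourier_eq_integral_sinc {μ : Measure Space} [IsFiniteMeasure μ] (h : IsRadial μ)
    (ξ : Space) :
    fourier μ ξ = ((∫ x, Real.sinc (2 * Real.pi * ‖ξ‖ * ‖x‖) ∂μ : ℝ) : ℂ) := by
  apply Complex.ext
  · rw [Complex.ofReal_re]
    have h1 := integral_sphere_fourier_re μ (norm_nonneg ξ)
    have h2 : ∀ ω : Metric.sphere (0 : Space) 1,
        (fourier μ (‖ξ‖ • (ω : Space))).re = (fourier μ ξ).re := fun ω => by
      rw [h.fourier_eq (norm_smul_sphere (norm_nonneg ξ) ω)]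
    simp_rw [h2] at h1
    rw [integral_const, toSphere_real_univ, smul_eq_mul] at h1
    exact mul_left_cancel₀ (by positivity) h1
  · rw [h.fourier_im_eq_zero, Complex.ofReal_im]

/-- The transform of a radial measure equals its spherical average, a sinc integral that sees only
the distribution of the norm. -/
lemma eq_of_map_norm {μ ν : Measure Space} [IsFiniteMeasure μ] [IsFiniteMeasure ν]
    (hμ : IsRadial μ) (hν : IsRadial ν) (h : μ.map (‖·‖) = ν.map (‖·‖)) : μ = ν := by
  have e : ∀ (ρ : Measure Space) (θ : ℝ),
      ∫ x, Real.sinc (θ * ‖x‖) ∂ρ = ∫ r, Real.sinc (θ * r) ∂(ρ.map (‖·‖)) := fun ρ θ => by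
    rw [integral_map measurable_norm.aemeasurable
      (Continuous.aestronglyMeasurable (by fun_prop))]
  exact ext_of_fourier fun ξ => by
    rw [hμ.fourier_eq_integral_sinc, hν.fourier_eq_integral_sinc, e, e, h]

/-- The cosine transform of a radial function on three-dimensional space. -/
lemma integral_radial_mul_cos {g : ℝ → ℝ} (hg : Integrable fun x : Space => g ‖x‖) (ξ : Space) :
    ∫ x : Space, g ‖x‖ * Real.cos (2 * Real.pi * inner ℝ x ξ) =
      ∫ x : Space, g ‖x‖ * Real.sinc (2 * Real.pi * ‖ξ‖ * ‖x‖) := by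
  have inv : ∀ η : Space, ‖ξ‖ = ‖η‖ →
      ∫ x : Space, g ‖x‖ * Real.cos (2 * Real.pi * inner ℝ x η) =
        ∫ x : Space, g ‖x‖ * Real.cos (2 * Real.pi * inner ℝ x ξ) := fun η hη => by
    set R := (Submodule.span ℝ {ξ - η})ᗮ.reflection
    have hR : R ξ = η := Submodule.reflection_sub hη
    rw [← R.measurePreserving.integral_comp R.toHomeomorph.measurableEmbedding]
    refine integral_congr_ae (ae_of_all _ fun x => ?_)
    simp only
    rw [R.norm_map, ← hR, R.inner_map_map]
  have h1 := integral_sphere_weighted hg (norm_nonneg ξ)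
  have h2 : ∀ ω : Metric.sphere (0 : Space) 1,
      ∫ x : Space, g ‖x‖ * Real.cos (2 * Real.pi * inner ℝ x (‖ξ‖ • (ω : Space))) =
        ∫ x : Space, g ‖x‖ * Real.cos (2 * Real.pi * inner ℝ x ξ) := fun ω =>
    inv _ (norm_smul_sphere (norm_nonneg ξ) ω).symm
  simp_rw [h2] at h1
  rw [integral_const, toSphere_real_univ, smul_eq_mul] at h1
  exact mul_left_cancel₀ (by positivity) h1

lemma integral_radial (g : ℝ → ℝ) :
    ∫ x : Space, g ‖x‖ = 4 * Real.pi * ∫ r in Ioi (0 : ℝ), r ^ 2 * g r := by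
  rw [integral_fun_norm_addHaar]
  have h : (volume : Measure Space).real (Metric.ball 0 1) = Real.pi * 4 / 3 := by
    rw [Measure.real, EuclideanSpace.volume_ball_fin_three]
    simp
    positivity
  rw [h]
  simp
  ring

lemma integrable_radial_of_bounded {g : ℝ → ℝ} (hg : Measurable g) {a C : ℝ}
    (hgC : ∀ r, |g r| ≤ C) (hga : ∀ r, a < r → g r = 0) : Integrable fun x : Space => g ‖x‖ := by
  have h1 : IntegrableOn (fun x : Space => g ‖x‖) (Metric.closedBall 0 a) :=
    Measure.integrableOn_of_bounded (M := C)
      (measure_closedBall_lt_top).ne (hg.comp measurable_norm).aestronglyMeasurable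
      (ae_of_all _ fun x => hgC _)
  rw [← integrableOn_univ]
  refine (h1.of_forall_sdiff_eq_zero MeasurableSet.univ fun x hx => ?_)
  apply hga
  have := hx.2
  simpa using this

end RadialSpace

/-! ### The radial dual function for the inverse norm -/

section ParabolaWave

/-- The antiperiodic extension of `x (1 - x)` from `[0, 1]`. -/
def parabolaWave (x : ℝ) : ℝ := ∑' k : ℤ, 4 / freq k ^ 3 * Real.sin (freq k * x)

lemma parabolaWave_eq {x : ℝ} (hx : x ∈ Icc (0 : ℝ) 1) : parabolaWave x = x * (1 - x) :=
  (hasSum_parabola hx).tsum_eq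

lemma parabolaWave_add_one (x : ℝ) : parabolaWave (x + 1) = -parabolaWave x := by
  unfold parabolaWave
  rw [← tsum_neg]
  congr 1
  ext k
  rw [mul_add, mul_one, Real.sin_add, cos_freq, sin_freq]
  ring

lemma abs_parabolaWave_le (x : ℝ) : |parabolaWave x| ≤ 1 / 4 := by
  have hper : Function.Periodic (fun x => |parabolaWave x|) 1 := fun x => by
    simp only [parabolaWave_add_one, abs_neg]
  have h1 := hper.sub_int_mul_eq (x := x) ⌊x⌋
  rw [mul_one] at h1
  rw [← h1]
  have h2 : x - ⌊x⌋ ∈ Icc (0 : ℝ) 1 := ⟨Int.fract_nonneg x, (Int.fract_lt_one x).le⟩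
  rw [parabolaWave_eq h2, abs_of_nonneg (mul_nonneg h2.1 (by linarith [h2.2]))]
  nlinarith [sq_nonneg (x - ⌊x⌋ - 1 / 2)]

/-- The radial dual function `∑ 4 ω⁻² sinc (ω r)`. -/
def sincWave (r : ℝ) : ℝ := ∑' k : ℤ, 4 / freq k ^ 2 * Real.sinc (freq k * r)

lemma mul_sincWave (r : ℝ) : r * sincWave r = parabolaWave r := by
  rcases eq_or_ne r 0 with rfl | hr
  · simp [parabolaWave]
  unfold sincWave parabolaWave
  rw [← tsum_mul_left]
  congr 1
  ext k
  have := freq_ne_zero k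
  rw [Real.sinc_of_ne_zero (mul_ne_zero this hr)]
  field_simp

/-- For r > 0 this is the parabola divided by r. At r = 0 that relation is empty, and the value
comes from the triangle series at 0. -/
lemma sincWave_eq {r : ℝ} (hr : r ∈ Icc (0 : ℝ) 1) : sincWave r = 1 - r := by
  rcases eq_or_lt_of_le hr.1 with rfl | h0
  · have h := (hasSum_triangle (x := 0) (by simp)).mul_left 2
    simp only [mul_zero, Real.cos_zero, mul_one, abs_zero, sub_zero] at h
    unfold sincWave
    simp only [mul_zero, Real.sinc_zero, mul_one, sub_zero]
    rw [show (1 : ℝ) = 2 * (1 / 2) by norm_num, ← h.tsum_eq]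
    congr 1
    ext k
    ring
  · have h := mul_sincWave r
    rw [parabolaWave_eq hr] at h
    exact mul_left_cancel₀ h0.ne' h

/-- After multiplication by r the claim is r - r² < parabolaWave r. On (1, 2] the wave equals -(r -
1)(2 - r), and 2 - r < r; beyond 2 the lower bound -1/4 is ample. -/
lemma one_sub_sincWave_lt {r : ℝ} (hr : 1 < r) : 1 - sincWave r < r := by
  have h0 : 0 < r := by linarith
  have h := mul_sincWave r
  have key : r - r ^ 2 < parabolaWave r := by
    rcases le_or_gt r 2 with h2 | h2
    · have h3 := parabolaWave_add_one (r - 1)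
      rw [sub_add_cancel, parabolaWave_eq (x := r - 1) ⟨by linarith, by linarith⟩] at h3
      rw [h3]
      nlinarith
    · have := neg_le_of_abs_le (abs_parabolaWave_le r)
      nlinarith
  rw [← h] at key
  have : r * (1 - sincWave r) < r * r := by nlinarith
  exact lt_of_mul_lt_mul_left this h0.le

lemma one_sub_sincWave_le {r : ℝ} (hr : 0 ≤ r) : 1 - sincWave r ≤ r := by
  rcases le_or_gt r 1 with h | h
  · rw [sincWave_eq ⟨hr, h⟩]; linarith
  · exact (one_sub_sincWave_lt h).le

end ParabolaWave

/-! ### The truncated inverse norm and a non-radial perturbation -/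

section InverseNorm

/-- The radial profile of `f₃`. -/
def f₃Profile : ℝ → ℝ := (Iic (1 : ℝ)).indicator fun r => r⁻¹

lemma f₃_eq_profile (x : Space) : f₃ x = f₃Profile ‖x‖ := by
  unfold f₃ f₃Profile
  by_cases hx : ‖x‖ ≤ 1
  · rw [indicator_of_mem (by simpa using hx), indicator_of_mem (by simpa using hx)]
  · rw [indicator_of_notMem (by simpa using hx), indicator_of_notMem (by simpa using hx)]

lemma measurable_f₃ : Measurable f₃ := by
  unfold f₃
  exact Measurable.indicator (by fun_prop) Metric.isClosed_closedBall.measurableSet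

lemma sq_mul_f₃Profile (h : ℝ → ℝ) {r : ℝ} (hr : r ∈ Ioi (0 : ℝ)) :
    r ^ 2 * (f₃Profile r * h r) = (Ioc (0 : ℝ) 1).indicator (fun r => r * h r) r := by
  have hr0 : (0 : ℝ) < r := hr
  unfold f₃Profile
  by_cases h1 : r ≤ 1
  · rw [indicator_of_mem (by simpa using h1),
      indicator_of_mem (show r ∈ Ioc (0 : ℝ) 1 from ⟨hr0, h1⟩)]
    field_simp
  · rw [indicator_of_notMem (by simpa using h1), indicator_of_notMem (fun h => h1 h.2)]
    ring

lemma integrable_f₃ : Integrable f₃ := by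
  have e : f₃ = fun x : Space => f₃Profile ‖x‖ := funext f₃_eq_profile
  rw [e, integrable_fun_norm_addHaar]
  have h2 : IntegrableOn ((Ioc (0 : ℝ) 1).indicator fun r : ℝ => r * 1) (Ioi 0) := by
    apply Integrable.integrableOn
    rw [integrable_indicator_iff measurableSet_Ioc, ← intervalIntegrable_iff_integrableOn_Ioc_of_le
      zero_le_one]
    exact Continuous.intervalIntegrable (by fun_prop) _ _
  refine h2.congr_fun (fun r hr => ?_) measurableSet_Ioi
  have := sq_mul_f₃Profile (fun _ => 1) hr
  simp only [mul_one] at this ⊢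
  rw [← this]
  simp

lemma integral_f₃_mul_radial (h : ℝ → ℝ) :
    ∫ x : Space, f₃ x * h ‖x‖ = 4 * Real.pi * ∫ r in (0 : ℝ)..1, r * h r := by
  simp_rw [f₃_eq_profile]
  rw [integral_radial (fun r => f₃Profile r * h r),
    setIntegral_congr_fun measurableSet_Ioi (fun r hr => sq_mul_f₃Profile h hr),
    setIntegral_indicator measurableSet_Ioc, intervalIntegral.integral_of_le zero_le_one]
  congr 3
  ext r
  simp only [mem_inter_iff, mem_Ioi, mem_Ioc]
  tauto

lemma integral_mul_sinc {θ : ℝ} (hθ : θ ≠ 0) :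
    ∫ r in (0 : ℝ)..1, r * Real.sinc (θ * r) = (1 - Real.cos θ) / θ ^ 2 := by
  have e : ∀ r : ℝ, r * Real.sinc (θ * r) = 1 / θ * Real.sin (θ * r) := fun r => by
    rcases eq_or_ne r 0 with rfl | hr
    · simp
    · rw [Real.sinc_of_ne_zero (mul_ne_zero hθ hr)]
      field_simp
  simp_rw [e]
  rw [intervalIntegral.integral_const_mul, intervalIntegral.integral_eq_sub_of_hasDerivAt
    (fun x _ => hasDerivAt_neg_cos_mul_div hθ x)
    (Continuous.intervalIntegrable (by fun_prop) _ _)]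
  simp
  field_simp
  ring

lemma f₃_neg (x : Space) : f₃ (-x) = f₃ x := by
  simp [f₃_eq_profile]

lemma f₃_nonneg (x : Space) : 0 ≤ f₃ x := by
  unfold f₃
  exact indicator_nonneg (fun x _ => by positivity) x

/-- The profile of a bounded radial function whose transform vanishes on the spheres of
half-integer radius. -/
def bumpProfile : ℝ → ℝ := (Icc (1 / 4 : ℝ) (3 / 4)).indicator
  fun r => Real.sin (4 * Real.pi * r) / r

/-- The radial function with profile `bumpProfile`. -/
def bump (x : Space) : ℝ := bumpProfile ‖x‖

/-- The translation vector of the perturbation. -/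
def shift : Space := EuclideanSpace.single 0 (1 / 8)

/-- A non-radial perturbation of `f₃`. -/
def f₃Tilde (ε : ℝ) (x : Space) : ℝ := f₃ x + ε * (bump (x - shift) - bump (x + shift))

lemma f₃Tilde_zero : f₃Tilde 0 = f₃ := by
  ext x; simp [f₃Tilde]

lemma norm_shift : ‖shift‖ = 1 / 8 := by
  simp [shift]

lemma measurable_bumpProfile : Measurable bumpProfile :=
  Measurable.indicator (by fun_prop) measurableSet_Icc

lemma abs_bumpProfile_le (r : ℝ) : |bumpProfile r| ≤ 4 := by
  unfold bumpProfile
  by_cases hr : r ∈ Icc (1 / 4 : ℝ) (3 / 4)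
  · rw [indicator_of_mem hr, abs_div]
    have h0 : 0 < r := by linarith [hr.1]
    rw [abs_of_pos h0, div_le_iff₀ h0]
    linarith [Real.abs_sin_le_one (4 * Real.pi * r), hr.1]
  · rw [indicator_of_notMem hr]
    norm_num

lemma bumpProfile_eq_zero {r : ℝ} (hr : 3 / 4 < r) : bumpProfile r = 0 :=
  indicator_of_notMem (fun h => by linarith [h.2]) _

lemma measurable_bump : Measurable bump := measurable_bumpProfile.comp measurable_norm

lemma integrable_bump : Integrable bump :=
  integrable_radial_of_bounded measurable_bumpProfile abs_bumpProfile_le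
    fun _ hr => bumpProfile_eq_zero hr

lemma bump_neg (x : Space) : bump (-x) = bump x := by simp [bump]

lemma measurable_f₃Tilde (ε : ℝ) : Measurable (f₃Tilde ε) :=
  measurable_f₃.add (((measurable_bump.comp (by fun_prop)).sub
    (measurable_bump.comp (by fun_prop))).const_mul ε)

lemma integrable_f₃Tilde (ε : ℝ) : Integrable (f₃Tilde ε) :=
  integrable_f₃.add (((integrable_bump.comp_sub_right shift).sub
    (integrable_bump.comp_add_right shift)).const_mul ε)

lemma f₃_ge_one {x : Space} (hx : ‖x‖ ≤ 1) (h0 : x ≠ 0) : 1 ≤ f₃ x := by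
  unfold f₃
  rw [indicator_of_mem (by simpa using hx)]
  exact (one_le_inv₀ (norm_pos_iff.2 h0)).2 hx

/-- The bump lives in ‖x‖ ≤ 3/4 and the shift has length 1/8, so both translates stay inside the
unit ball. -/
lemma bump_shift_eq_zero {x : Space} (hx : 1 < ‖x‖) :
    bump (x - shift) = 0 ∧ bump (x + shift) = 0 := by
  have h1 := norm_sub_norm_le x shift
  have h2 := norm_sub_norm_le x (-shift)
  rw [norm_neg, sub_neg_eq_add] at h2
  rw [norm_shift] at h1 h2
  exact ⟨bumpProfile_eq_zero (by linarith), bumpProfile_eq_zero (by linarith)⟩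

lemma f₃Tilde_nonneg {ε : ℝ} (hε : |ε| ≤ 1 / 8) (x : Space) : 0 ≤ f₃Tilde ε x := by
  unfold f₃Tilde
  rcases le_or_gt ‖x‖ 1 with hx | hx
  -- At the origin the convention `0⁻¹ = 0` leaves no room for a negative perturbation, but the two
  -- even translates cancel there. Elsewhere in the ball `f₃` is at least 1, while the difference of
  -- translates is at most 8; hence the bound 1/8.
  · rcases eq_or_ne x 0 with rfl | h0
    · rw [zero_sub, bump_neg, zero_add, sub_self, mul_zero, add_zero]
      exact f₃_nonneg 0
    · have h1 := f₃_ge_one hx h0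
      have h2 : |ε * (bump (x - shift) - bump (x + shift))| ≤ 1 := by
        rw [abs_mul]
        have h3 : |bump (x - shift) - bump (x + shift)| ≤ 8 := by
          refine (abs_sub _ _).trans ?_
          have := abs_bumpProfile_le ‖x - shift‖
          have := abs_bumpProfile_le ‖x + shift‖
          unfold bump
          linarith
        calc |ε| * _ ≤ 1 / 8 * 8 := mul_le_mul hε h3 (abs_nonneg _) (by norm_num)
          _ = 1 := by norm_num
      have := neg_le_of_abs_le h2
      linarith
  · obtain ⟨h1, h2⟩ := bump_shift_eq_zero hx
    rw [h1, h2, sub_self, mul_zero, add_zero]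
    exact f₃_nonneg x

lemma isFiniteMeasure_f₃Tilde (ε : ℝ) : IsFiniteMeasure (ofDensity (f₃Tilde ε)) :=
  isFiniteMeasure_ofDensity (integrable_f₃Tilde ε)

lemma integral_f₃Tilde {ε : ℝ} (hε : |ε| ≤ 1 / 8) {F : Space → ℝ} (hF : Continuous F)
    (hF1 : ∀ x, |F x| ≤ 1) :
    ∫ x, F x ∂(ofDensity (f₃Tilde ε)) = (∫ x, f₃ x * F x) +
      ε * ∫ x, bump x * (F (x + shift) - F (x - shift)) := by
  rw [integral_ofDensity (measurable_f₃Tilde ε) (f₃Tilde_nonneg hε)]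
  have I1 : Integrable fun x => f₃ x * F x :=
    integrable_f₃.mul_bdd hF.aestronglyMeasurable (ae_of_all _ hF1)
  have I2 : Integrable fun x => bump (x - shift) * F x :=
    (integrable_bump.comp_sub_right shift).mul_bdd hF.aestronglyMeasurable (ae_of_all _ hF1)
  have I3 : Integrable fun x => bump (x + shift) * F x :=
    (integrable_bump.comp_add_right shift).mul_bdd hF.aestronglyMeasurable (ae_of_all _ hF1)
  have J2 : Integrable fun x => bump x * F (x + shift) :=
    integrable_bump.mul_bdd (hF.comp (by fun_prop)).aestronglyMeasurable
      (ae_of_all _ fun x => hF1 _)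
  have J3 : Integrable fun x => bump x * F (x - shift) :=
    integrable_bump.mul_bdd (hF.comp (by fun_prop)).aestronglyMeasurable
      (ae_of_all _ fun x => hF1 _)
  have e : ∀ x, f₃Tilde ε x * F x =
      f₃ x * F x + ε * (bump (x - shift) * F x - bump (x + shift) * F x) := fun x => by
    unfold f₃Tilde; ring
  have I4 : Integrable fun x => ε * (bump (x - shift) * F x - bump (x + shift) * F x) :=
    (I2.sub I3).const_mul ε
  simp_rw [e]
  rw [integral_add I1 I4, integral_const_mul]
  congr 2
  rw [integral_sub I2 I3]
  simp_rw [mul_sub]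
  rw [integral_sub J2 J3]
  congr 1
  · rw [← integral_add_right_eq_self (fun x => bump (x - shift) * F x) shift]
    simp
  · rw [← integral_sub_right_eq_self (fun x => bump (x + shift) * F x) shift]
    simp

lemma integral_space_odd {F : Space → ℝ} (hF : ∀ x, F (-x) = -F x) : ∫ x, F x = 0 := by
  have := integral_neg_eq_self F volume
  simp only [hF, integral_neg] at this
  linarith

lemma integral_f₃Tilde_even {ε : ℝ} (hε : |ε| ≤ 1 / 8) {F : Space → ℝ} (hF : Continuous F)
    (hF1 : ∀ x, |F x| ≤ 1) (heven : ∀ x, F (-x) = F x) :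
    ∫ x, F x ∂(ofDensity (f₃Tilde ε)) = ∫ x, f₃ x * F x := by
  have hz : ∫ x, bump x * (F (x + shift) - F (x - shift)) = 0 := integral_space_odd fun x => by
    rw [bump_neg, show -x + shift = -(x - shift) by abel, show -x - shift = -(x + shift) by abel,
      heven, heven]
    ring
  rw [integral_f₃Tilde hε hF hF1, hz, mul_zero, add_zero]

lemma f₃Tilde_univ {ε : ℝ} (hε : |ε| ≤ 1 / 8) :
    ofDensity (f₃Tilde ε) univ = ENNReal.ofReal (2 * Real.pi) := by
  have := isFiniteMeasure_f₃Tilde ε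
  have h := integral_f₃Tilde_even hε (F := fun _ => 1) continuous_const (by simp) (by simp)
  rw [integral_f₃_mul_radial (fun _ => 1)] at h
  simp at h
  rw [← ENNReal.ofReal_toReal (measure_ne_top (ofDensity (f₃Tilde ε)) univ)]
  rw [Measure.real] at h
  rw [h]
  congr 1
  ring

lemma integral_sinc_f₃Tilde {ε : ℝ} (hε : |ε| ≤ 1 / 8) {θ : ℝ} (hθ : θ ≠ 0) :
    ∫ x, Real.sinc (θ * ‖x‖) ∂(ofDensity (f₃Tilde ε)) =
      4 * Real.pi * ((1 - Real.cos θ) / θ ^ 2) := by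
  rw [integral_f₃Tilde_even hε (by fun_prop) (fun x => Real.abs_sinc_le_one _) (fun x => by simp),
    integral_f₃_mul_radial (fun r => Real.sinc (θ * r)), integral_mul_sinc hθ]

lemma fourier_re_f₃Tilde {ε : ℝ} (hε : |ε| ≤ 1 / 8) {ξ : Space} (hξ : ξ ≠ 0) :
    (fourier (ofDensity (f₃Tilde ε)) ξ).re =
      4 * Real.pi * ((1 - Real.cos (2 * Real.pi * ‖ξ‖)) / (2 * Real.pi * ‖ξ‖) ^ 2) := by
  have := isFiniteMeasure_f₃Tilde ε
  have hξ' : 2 * Real.pi * ‖ξ‖ ≠ 0 := by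
    simp [Real.pi_ne_zero, hξ]
  rw [fourier_re, integral_f₃Tilde_even hε (by fun_prop) (fun x => Real.abs_cos_le_one _)
    (fun x => by simp), ← integral_mul_sinc hξ',
    ← integral_f₃_mul_radial (fun r => Real.sinc (2 * Real.pi * ‖ξ‖ * r))]
  have h := integrable_f₃
  rw [show f₃ = fun x : Space => f₃Profile ‖x‖ from funext f₃_eq_profile] at h ⊢
  exact integral_radial_mul_cos h ξ

/-- The even part `f₃` contributes nothing. Moving the translations onto the sine and using its
addition formula factors out 2 sin(2π⟨shift, ξ⟩) and leaves the radial transform of the bump. -/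
lemma fourier_im_f₃Tilde {ε : ℝ} (hε : |ε| ≤ 1 / 8) (ξ : Space) :
    (fourier (ofDensity (f₃Tilde ε)) ξ).im =
      -(ε * (2 * Real.sin (2 * Real.pi * inner ℝ shift ξ) *
        ∫ x : Space, bump x * Real.sinc (2 * Real.pi * ‖ξ‖ * ‖x‖))) := by
  have := isFiniteMeasure_f₃Tilde ε
  rw [fourier_im, integral_f₃Tilde hε (by fun_prop) (fun x => Real.abs_sin_le_one _),
    integral_space_odd (fun x => by simp [f₃_neg]), zero_add]
  congr 2
  have hc : ∫ x, bump x * Real.cos (2 * Real.pi * inner ℝ x ξ) =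
      ∫ x : Space, bump x * Real.sinc (2 * Real.pi * ‖ξ‖ * ‖x‖) :=
    integral_radial_mul_cos integrable_bump ξ
  rw [← hc, ← integral_const_mul]
  refine integral_congr_ae (ae_of_all _ fun x => ?_)
  simp only [inner_add_left, inner_sub_left, mul_add, mul_sub, Real.sin_add, Real.sin_sub, bump]
  ring

/-- The half-period integral governing the transform of `bump`. -/
def bumpIntegral (ρ : ℝ) : ℝ :=
  ∫ y in (-(1 / 4 : ℝ))..(1 / 4), Real.sin (4 * Real.pi * y) * Real.sin (2 * Real.pi * ρ * y)

/-- The Jacobian r² cancels the 1/r of the profile and the 1/r of sinc. Since sin(4πr) is odd about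
the midpoint 1/2 of the support, recentring there produces the factor cos(πρ), which vanishes at
half-integer radii. -/
lemma integral_bump_mul_sinc {ρ : ℝ} (hρ : ρ ≠ 0) :
    ∫ x : Space, bump x * Real.sinc (2 * Real.pi * ρ * ‖x‖) =
      2 / ρ * (Real.cos (Real.pi * ρ) * bumpIntegral ρ) := by
  unfold bump
  rw [integral_radial (fun r => bumpProfile r * Real.sinc (2 * Real.pi * ρ * r))]
  have hpi := Real.pi_ne_zero
  have e : ∀ r ∈ Ioi (0 : ℝ), r ^ 2 * (bumpProfile r * Real.sinc (2 * Real.pi * ρ * r)) =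
      (Icc (1 / 4 : ℝ) (3 / 4)).indicator (fun r => 1 / (2 * Real.pi * ρ) *
        (Real.sin (4 * Real.pi * r) * Real.sin (2 * Real.pi * ρ * r))) r := fun r hr => by
    have hr0 : r ≠ 0 := ne_of_gt hr
    unfold bumpProfile
    by_cases h : r ∈ Icc (1 / 4 : ℝ) (3 / 4)
    · rw [indicator_of_mem h, indicator_of_mem h, Real.sinc_of_ne_zero (by positivity)]
      field_simp
    · rw [indicator_of_notMem h, indicator_of_notMem h]
      ring
  rw [setIntegral_congr_fun measurableSet_Ioi e, setIntegral_indicator measurableSet_Icc]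
  have hset : Ioi (0 : ℝ) ∩ Icc (1 / 4) (3 / 4) = Icc (1 / 4) (3 / 4) :=
    inter_eq_right.2 fun r hr => lt_of_lt_of_le (by norm_num) hr.1
  rw [hset, integral_Icc_eq_integral_Ioc, ← intervalIntegral.integral_of_le (by norm_num),
    intervalIntegral.integral_const_mul]
  have h := intervalIntegral.integral_comp_add_right (a := -(1 / 4 : ℝ)) (b := 1 / 4)
    (fun x => Real.sin (4 * Real.pi * x) * Real.sin (2 * Real.pi * ρ * x)) (1 / 2)
  rw [show -(1 / 4 : ℝ) + 1 / 2 = 1 / 4 by norm_num,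
    show (1 / 4 : ℝ) + 1 / 2 = 3 / 4 by norm_num] at h
  rw [← h]
  have e2 : ∀ y : ℝ, Real.sin (4 * Real.pi * (y + 1 / 2)) *
      Real.sin (2 * Real.pi * ρ * (y + 1 / 2)) =
      Real.cos (Real.pi * ρ) * (Real.sin (4 * Real.pi * y) * Real.sin (2 * Real.pi * ρ * y)) +
      Real.sin (Real.pi * ρ) *
        (Real.sin (4 * Real.pi * y) * Real.cos (2 * Real.pi * ρ * y)) := fun y => by
    rw [show 4 * Real.pi * (y + 1 / 2) = 4 * Real.pi * y + 2 * Real.pi by ring,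
      Real.sin_add_two_pi,
      show 2 * Real.pi * ρ * (y + 1 / 2) = 2 * Real.pi * ρ * y + Real.pi * ρ by ring,
      Real.sin_add]
    ring
  simp_rw [e2]
  rw [intervalIntegral.integral_add (Continuous.intervalIntegrable (by fun_prop) _ _)
      (Continuous.intervalIntegrable (by fun_prop) _ _), intervalIntegral.integral_const_mul,
    intervalIntegral.integral_const_mul,
    integral_odd_symm (f := fun y => Real.sin (4 * Real.pi * y) * Real.cos (2 * Real.pi * ρ * y))
      (fun x => by simp)]
  unfold bumpIntegral
  field_simp
  ring

/-- One integration by parts gains the factor 1/ρ; the boundary terms vanish because sin(4πy) is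
zero at ±1/4. -/
lemma abs_mul_bumpIntegral_le {ρ : ℝ} (hρ : ρ ≠ 0) : |ρ * bumpIntegral ρ| ≤ 1 := by
  have hω : 2 * Real.pi * ρ ≠ 0 := by simp [hρ, Real.pi_ne_zero]
  have dsin : ∀ y : ℝ, HasDerivAt (fun y => Real.sin (4 * Real.pi * y))
      (4 * Real.pi * Real.cos (4 * Real.pi * y)) y := fun y => by
    have := ((hasDerivAt_id y).const_mul (4 * Real.pi)).sin
    simpa [mul_comm] using this
  have i1 := intervalIntegral.integral_mul_deriv_eq_deriv_mul (a := -(1 / 4 : ℝ)) (b := 1 / 4)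
    (fun x _ => dsin x) (fun x _ => hasDerivAt_neg_cos_mul_div hω x)
    (Continuous.intervalIntegrable (by fun_prop) _ _)
    (Continuous.intervalIntegrable (by fun_prop) _ _)
  have e1 : ∀ x : ℝ, 4 * Real.pi * Real.cos (4 * Real.pi * x) *
      (-Real.cos (2 * Real.pi * ρ * x) / (2 * Real.pi * ρ)) =
      -(2 / ρ) * (Real.cos (4 * Real.pi * x) * Real.cos (2 * Real.pi * ρ * x)) := fun x => by
    have := Real.pi_ne_zero
    field_simp
    ring
  simp_rw [e1] at i1
  rw [intervalIntegral.integral_const_mul] at i1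
  have a1 : 4 * Real.pi * (1 / 4) = Real.pi := by ring
  simp only [mul_neg, Real.sin_neg, a1, Real.sin_pi] at i1
  have hb : bumpIntegral ρ = 2 / ρ * ∫ y in (-(1 / 4 : ℝ))..(1 / 4),
      Real.cos (4 * Real.pi * y) * Real.cos (2 * Real.pi * ρ * y) := by
    unfold bumpIntegral
    rw [i1]
    ring
  have := intervalIntegral.norm_integral_le_of_norm_le_const (a := -(1 / 4 : ℝ)) (b := 1 / 4)
      (C := 1) (f := fun y => Real.cos (4 * Real.pi * y) * Real.cos (2 * Real.pi * ρ * y))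
      (fun x _ => by
        rw [norm_mul]
        exact mul_le_one₀ (Real.abs_cos_le_one _) (norm_nonneg _) (Real.abs_cos_le_one _))
  rw [hb, ← mul_assoc, mul_div_cancel₀ _ hρ, abs_mul, abs_two]
  rw [Real.norm_eq_abs] at this
  norm_num at this
  norm_num
  linarith

lemma norm_fourier_f₃Tilde_mul_le {ε : ℝ} (hε : |ε| ≤ 1 / 8) (ξ : Space) :
    ‖fourier (ofDensity (f₃Tilde ε)) ξ‖ * ‖ξ‖ ^ (2 : ℝ) ≤ 2 / Real.pi := by
  rcases eq_or_ne ξ 0 with rfl | hξ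
  · simp
    positivity
  have hpi := Real.pi_pos
  have hn0 : ‖ξ‖ ≠ 0 := norm_ne_zero_iff.2 hξ
  have hre := fourier_re_f₃Tilde hε hξ
  have him := fourier_im_f₃Tilde hε ξ
  rw [integral_bump_mul_sinc hn0] at him
  have hJ := abs_mul_bumpIntegral_le hn0
  set ρ := ‖ξ‖
  set z := fourier (ofDensity (f₃Tilde ε)) ξ
  rw [Real.rpow_two]
  have hn : ‖z‖ * ρ ^ 2 = ‖z * ((ρ ^ 2 : ℝ) : ℂ)‖ := by
    rw [norm_mul, Complex.norm_real, Real.norm_eq_abs, abs_of_nonneg (sq_nonneg ρ)]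
  rw [hn]
  refine (sq_le_sq₀ (norm_nonneg _) (by positivity)).1 ?_
  rw [← Complex.normSq_eq_norm_sq, Complex.normSq_apply, ← sq, ← sq]
  refine sq_add_sq_le_of_cos (ξ := ρ) ?_ ?_
  · rw [Complex.re_mul_ofReal, hre, show 2 * Real.pi * ρ = 2 * (Real.pi * ρ) by ring,
      Real.cos_two_mul, Real.cos_sq']
    rw [show 4 * Real.pi * ((1 - (2 * (1 - Real.sin (Real.pi * ρ) ^ 2) - 1)) /
      (2 * (Real.pi * ρ)) ^ 2) * ρ ^ 2 = 2 / Real.pi * Real.sin (Real.pi * ρ) ^ 2 by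
        field_simp; ring]
    exact abs_of_nonneg (by positivity)
  · rw [Complex.im_mul_ofReal, him]
    rw [show -(ε * (2 * Real.sin (2 * Real.pi * inner ℝ shift ξ) *
      (2 / ρ * (Real.cos (Real.pi * ρ) * bumpIntegral ρ)))) * ρ ^ 2 =
      -(4 * ε * Real.sin (2 * Real.pi * inner ℝ shift ξ) * (ρ * bumpIntegral ρ) *
        Real.cos (Real.pi * ρ)) by field_simp; ring]
    rw [abs_neg, abs_mul, abs_mul, abs_mul, abs_mul, abs_of_pos (show (0 : ℝ) < 4 by norm_num)]
    -- The imaginary part is at most 4|ε||cos(πρ)|, hence at most half the cosine for |ε| ≤ 1/8,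
    -- which fits under 2/π.
    have h1 : 1 / 2 ≤ 2 / Real.pi := by
      rw [div_le_div_iff₀ (by positivity) (by positivity)]
      linarith [Real.pi_lt_four]
    calc 4 * |ε| * |Real.sin (2 * Real.pi * inner ℝ shift ξ)| * |ρ * bumpIntegral ρ| *
        |Real.cos (Real.pi * ρ)| ≤ 4 * (1 / 8) * 1 * 1 * |Real.cos (Real.pi * ρ)| := by
          gcongr
          exact Real.abs_sin_le_one _
      _ = 1 / 2 * |Real.cos (Real.pi * ρ)| := by ring
      _ ≤ _ := by gcongr

lemma ae_f₃Tilde (ε : ℝ) : ∀ᵐ x ∂(ofDensity (f₃Tilde ε)), ‖x‖ ≤ 1 := by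
  refine ae_ofDensity_of_ne_zero (measurable_f₃Tilde ε) fun x hx => ?_
  by_contra h
  have h1 := not_le.1 h
  obtain ⟨h2, h3⟩ := bump_shift_eq_zero h1
  apply hx
  rw [f₃Tilde, h2, h3, f₃, indicator_of_notMem (by simpa using h1)]
  simp

lemma sinc_abs_mul (a x : ℝ) : Real.sinc (|a| * x) = Real.sinc (a * x) := by
  rcases abs_choice a with h | h <;> rw [h]
  rw [neg_mul, Real.sinc_neg]

lemma sq_mul_integral_sinc_le {μ : Measure Space} [IsFiniteMeasure μ]
    (hF : fourierNorm 2 μ ≤ ENNReal.ofReal (2 / Real.pi)) (θ : ℝ) :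
    θ ^ 2 * ∫ x, Real.sinc (θ * ‖x‖) ∂μ ≤ 8 * Real.pi := by
  have hpi := Real.pi_pos
  rcases eq_or_ne θ 0 with rfl | hθ
  · simp
    positivity
  have h := integral_sinc_le (by norm_num) (by positivity) hF (ρ := |θ| / (2 * Real.pi))
    (by positivity)
  have e : ∀ x : Space, Real.sinc (2 * Real.pi * (|θ| / (2 * Real.pi)) * ‖x‖) =
      Real.sinc (θ * ‖x‖) := fun x => by
    rw [mul_div_cancel₀ _ (by positivity), sinc_abs_mul]
  simp_rw [e] at h
  rw [Real.rpow_two, div_pow, sq_abs] at h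
  calc _ ≤ θ ^ 2 * (2 / Real.pi / (θ ^ 2 / (2 * Real.pi) ^ 2)) := by gcongr
    _ = 8 * Real.pi := by field_simp; ring

lemma integral_sinc_freq_le {μ : Measure Space} [IsFiniteMeasure μ]
    (hF : fourierNorm 2 μ ≤ ENNReal.ofReal (2 / Real.pi)) (k : ℤ) :
    ∫ x, Real.sinc (freq k * ‖x‖) ∂μ ≤ 8 * Real.pi / freq k ^ 2 := by
  have := sq_mul_integral_sinc_le hF (freq k)
  have h0 := freq_ne_zero k
  rw [le_div_iff₀ (by positivity)]
  linarith

lemma integral_sinc_freq_f₃Tilde {ε : ℝ} (hε : |ε| ≤ 1 / 8) (k : ℤ) :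
    ∫ x, Real.sinc (freq k * ‖x‖) ∂(ofDensity (f₃Tilde ε)) = 8 * Real.pi / freq k ^ 2 := by
  rw [integral_sinc_f₃Tilde hε (freq_ne_zero k), cos_freq]
  ring

/-- The perturbation is odd and the sinc test functions are even, so all small ε share the same test
integrals and the same certificate. -/
lemma inverseNorm_dual {ε : ℝ} (hε : |ε| ≤ 1 / 8) (μ : Measure Space) (hμ : IsFiniteMeasure μ)
    (hu : μ univ = ofDensity (f₃Tilde ε) univ)
    (hF : fourierNorm 2 μ ≤ fourierNorm 2 (ofDensity (f₃Tilde ε))) :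
    moment 1 (ofDensity (f₃Tilde ε)) ≤ moment 1 μ ∧ moment 1 (ofDensity (f₃Tilde ε)) ≠ ∞ ∧
      (moment 1 μ = moment 1 (ofDensity (f₃Tilde ε)) →
        (∀ k : ℤ, ∫ x, Real.sinc (freq k * ‖x‖) ∂μ = 8 * Real.pi / freq k ^ 2) ∧
          ∀ᵐ x ∂μ, ‖x‖ ≤ 1) := by
  have := isFiniteMeasure_f₃Tilde ε
  have hFν := fourierNorm_le (by norm_num) (norm_fourier_f₃Tilde_mul_le hε)
  have hmom : ∀ μ : Measure Space, moment 1 μ = ∫⁻ x, ENNReal.ofReal ‖x‖ ∂μ := fun μ => by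
    rw [moment_eq_lintegral_ofReal zero_le_one μ]
    simp
  have key := lintegral_le_of_dual hu measurable_norm norm_nonneg (c := 1)
    (d := fun k : ℤ => 4 / freq k ^ 2) (e := fun k x => Real.sinc (freq k * ‖x‖)) (B := fun _ => 1)
    (fun k => by have := freq_ne_zero k; positivity) (fun k x => Real.abs_sinc_le_one _)
    (fun k => by fun_prop)
    (by simpa [div_eq_mul_inv] using summable_inv_freq_sq.mul_left 4)
    (fun x => one_sub_sincWave_le (norm_nonneg x))
    ((ae_f₃Tilde ε).mono fun x hx => by
      have := sincWave_eq ⟨norm_nonneg x, hx⟩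
      rw [sincWave] at this
      linarith)
    (fun k => by
      rw [integral_sinc_freq_f₃Tilde hε]; exact integral_sinc_freq_le (hF.trans hFν) k)
  simp only [← hmom] at key
  refine ⟨key.1, key.2.1, fun heq => ?_⟩
  obtain ⟨h1, h2⟩ := key.2.2 heq
  refine ⟨fun k => by rw [h1, integral_sinc_freq_f₃Tilde hε], ?_⟩
  filter_upwards [h2] with x hx
  by_contra hlt
  exact (one_sub_sincWave_lt (not_le.1 hlt)).ne' hx

lemma ofDensity_f₃Tilde_ne_zero {ε : ℝ} (hε : |ε| ≤ 1 / 8) : ofDensity (f₃Tilde ε) ≠ 0 := by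
  intro h
  have h1 := f₃Tilde_univ hε
  have hpi := Real.pi_pos
  rw [h, Measure.coe_zero, Pi.zero_apply, eq_comm, ENNReal.ofReal_eq_zero] at h1
  linarith

theorem isExtremizer_f₃Tilde {ε : ℝ} (hε : |ε| ≤ 1 / 8) :
    IsExtremizer 1 2 (ofDensity (f₃Tilde ε)) := by
  have := isFiniteMeasure_f₃Tilde ε
  have hFν := fourierNorm_le (by norm_num) (norm_fourier_f₃Tilde_mul_le hε)
  exact isExtremizer_of_forall one_pos two_pos (ofDensity_f₃Tilde_ne_zero hε)
    (ne_top_of_le_ne_top ENNReal.ofReal_ne_top hFν)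
    fun μ h1 h2 h3 => (inverseNorm_dual hε μ h1 h2 h3).1

lemma bumpIntegral_two : bumpIntegral 2 = 1 / 4 := by
  unfold bumpIntegral
  have e : ∀ x : ℝ, Real.sin (4 * Real.pi * x) * Real.sin (2 * Real.pi * 2 * x) =
      1 / 2 - 1 / 2 * Real.cos (8 * Real.pi * x) := fun x => by
    rw [show 2 * Real.pi * 2 * x = 4 * Real.pi * x by ring,
      show 8 * Real.pi * x = 2 * (4 * Real.pi * x) by ring, Real.cos_two_mul, Real.cos_sq']
    ring
  simp_rw [e]
  rw [intervalIntegral.integral_sub (by simp) (Continuous.intervalIntegrable (by fun_prop) _ _),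
    intervalIntegral.integral_const_mul, integral_cos_symm (by positivity),
    show 8 * Real.pi * (1 / 4) = 2 * Real.pi by ring, Real.sin_two_pi]
  norm_num

theorem not_isRadial_f₃Tilde {ε : ℝ} (hε : |ε| ≤ 1 / 8) (h0 : ε ≠ 0) :
    ¬ IsRadial (ofDensity (f₃Tilde ε)) := by
  intro h
  have := isFiniteMeasure_f₃Tilde ε
  -- At length 2 along the shift axis no factor of the imaginary part vanishes: ⟨shift, ξ⟩ = 1/4
  -- makes the sine 1, and cos(2π) = 1.
  have h1 := h.fourier_im_eq_zero (EuclideanSpace.single 0 2)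
  have hn : ‖(EuclideanSpace.single 0 2 : Space)‖ = 2 := by simp
  rw [fourier_im_f₃Tilde hε, hn, integral_bump_mul_sinc two_ne_zero, bumpIntegral_two,
    mul_comm Real.pi 2, Real.cos_two_pi] at h1
  have hin : 2 * Real.pi * inner ℝ shift (EuclideanSpace.single 0 2 : Space) = Real.pi / 2 := by
    simp [shift, EuclideanSpace.inner_single_left]
    ring
  rw [hin, Real.sin_pi_div_two] at h1
  norm_num at h1
  exact h0 h1

lemma isRadial_f₃ : IsRadial (ofDensity f₃) := by
  rw [← f₃Tilde_zero]
  have := isFiniteMeasure_f₃Tilde 0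
  have hε : |(0 : ℝ)| ≤ 1 / 8 := by norm_num
  have him : ∀ ξ, (fourier (ofDensity (f₃Tilde 0)) ξ).im = 0 := fun ξ => by
    rw [fourier_im_f₃Tilde hε]
    simp
  refine isRadial_of_fourier fun ξ η h => ?_
  rcases eq_or_ne ξ 0 with rfl | hξ
  · rw [norm_zero] at h
    rw [norm_eq_zero.1 h.symm]
  · have hη : η ≠ 0 := by
      rw [← norm_ne_zero_iff, ← h]; exact norm_ne_zero_iff.2 hξ
    apply Complex.ext
    · rw [fourier_re_f₃Tilde hε hξ, fourier_re_f₃Tilde hε hη, h]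
    · rw [him, him]

/-- On the distribution of the norm, the saturated sinc constraints are the weighted sine data, and
the critical point equations supply the cosine data. -/
lemma eq_f₃_of_moments {μ : Measure Space} [IsFiniteMeasure μ] (hrad : IsRadial μ)
    (huniv : μ univ = ofDensity f₃ univ)
    (hF : fourierNorm 2 μ ≤ ENNReal.ofReal (2 / Real.pi))
    (hk : ∀ k : ℤ, ∫ x, Real.sinc (freq k * ‖x‖) ∂μ = 8 * Real.pi / freq k ^ 2)
    (hsupp : ∀ᵐ x ∂μ, ‖x‖ ≤ 1) : μ = ofDensity f₃ := by
  have hfin : IsFiniteMeasure (ofDensity f₃) := by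
    rw [← f₃Tilde_zero]; exact isFiniteMeasure_f₃Tilde 0
  have hε : |(0 : ℝ)| ≤ 1 / 8 := by norm_num
  have hFν : fourierNorm 2 (ofDensity f₃) ≤ ENNReal.ofReal (2 / Real.pi) := by
    rw [← f₃Tilde_zero]
    exact fourierNorm_le (by norm_num) (norm_fourier_f₃Tilde_mul_le hε)
  have hνk : ∀ k : ℤ, ∫ x, Real.sinc (freq k * ‖x‖) ∂(ofDensity f₃) =
      8 * Real.pi / freq k ^ 2 := fun k => by
    rw [← f₃Tilde_zero, integral_sinc_freq_f₃Tilde hε]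
  have hνs : ∀ᵐ x ∂(ofDensity f₃), ‖x‖ ≤ 1 := by
    rw [← f₃Tilde_zero]; exact ae_f₃Tilde 0
  have hnm : Measurable fun x : Space => ‖x‖ := measurable_norm
  have hI : ∀ ρ : Measure Space, (∀ᵐ x ∂ρ, ‖x‖ ≤ 1) → ∀ᵐ x ∂(ρ.map (‖·‖)), x ∈ Icc (0 : ℝ) 1 :=
    fun ρ hρ => (ae_map_iff hnm.aemeasurable (p := (· ∈ Icc (0 : ℝ) 1)) measurableSet_Icc).2
      (hρ.mono fun x hx => ⟨norm_nonneg x, hx⟩)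
  have hsinc : ∀ (ρ : Measure Space) (θ : ℝ),
      ∫ x, Real.sinc (θ * x) ∂(ρ.map (‖·‖)) = ∫ x, Real.sinc (θ * ‖x‖) ∂ρ := fun ρ θ =>
    integral_map hnm.aemeasurable (Continuous.aestronglyMeasurable (by fun_prop))
  have hcos : ∀ (ρ : Measure Space) [IsFiniteMeasure ρ],
      fourierNorm 2 ρ ≤ ENNReal.ofReal (2 / Real.pi) →
      (∀ k : ℤ, ∫ x, Real.sinc (freq k * ‖x‖) ∂ρ = 8 * Real.pi / freq k ^ 2) →
      (∀ᵐ x ∂ρ, ‖x‖ ≤ 1) → ∀ k : ℤ,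
      ∫ x, Real.cos (freq k * x) ∂(ρ.map (‖·‖)) = -(8 * Real.pi) / freq k ^ 2 := by
    intro ρ _ h1 h2 h3 k
    refine integral_cos_of_maximum (hI ρ h3) (freq_ne_zero k)
      (fun θ => by rw [hsinc]; exact sq_mul_integral_sinc_le h1 θ) ?_
    rw [hsinc, h2]
    have := freq_ne_zero k
    field_simp
  refine eq_of_map_norm hrad isRadial_f₃ ?_
  -- The factor `freq k` makes the family equal to sin((2k+1)πx)/x off the origin, so the recurrence
  -- of the sines carries over; sinc keeps it continuous at 0.
  have hs0 : ∀ x : ℝ, x ≠ 0 → ∀ k : ℤ, freq k * Real.sinc (freq k * x) =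
      Real.sin ((2 * k + 1) * Real.pi * x) / x := fun x hx k => by
    have := freq_ne_zero k
    rw [Real.sinc_of_ne_zero (mul_ne_zero this hx), freq]
    rw [freq] at this
    have h1 := left_ne_zero_of_mul this
    have h2 := Real.pi_ne_zero
    field_simp
  have hpos : ∀ x ∈ Icc (0 : ℝ) 1, 0 ≤ Real.sinc (freq 0 * x) := fun x hx => by
    rcases eq_or_lt_of_le hx.1 with rfl | h0
    · simp
    · rw [Real.sinc_of_ne_zero (mul_ne_zero (freq_ne_zero 0) h0.ne'), freq]
      have := Real.pi_pos
      simp only [Int.cast_zero, mul_zero, zero_add, one_mul]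
      exact div_nonneg (Real.sin_nonneg_of_nonneg_of_le_pi (by positivity)
        (by nlinarith [hx.2])) (by positivity)
  have hpos' : ∀ x ∈ Ioo (0 : ℝ) 1, 0 < Real.sinc (freq 0 * x) := fun x hx => by
    rw [Real.sinc_of_ne_zero (mul_ne_zero (freq_ne_zero 0) hx.1.ne'), freq]
    have := Real.pi_pos
    have := hx.1
    simp only [Int.cast_zero, mul_zero, zero_add, one_mul]
    exact div_pos (Real.sin_pos_of_pos_of_lt_pi (by positivity)
      (by nlinarith [hx.2])) (by positivity)
  have hf0 : 0 < freq 0 := by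
    simp [freq, Real.pi_pos]
  refine eq_of_trig_moments ?_ (hI μ hsupp) ?_ (fun k => ?_)
    (s := fun k y => freq k * Real.sinc (freq k * y)) (fun k => by fun_prop)
    (fun k x => ?_) (fun k => ?_) ?_ ?_
  · rw [Measure.map_apply hnm .univ, Measure.map_apply hnm .univ]
    exact huniv
  · refine (ae_map_iff hnm.aemeasurable (p := (· ∈ Ioo (0 : ℝ) 1)) measurableSet_Ioo).2 ?_
    have hac : ofDensity f₃ ≪ volume := withDensity_absolutelyContinuous _ _
    have h0 : ∀ᵐ x ∂(ofDensity f₃), x ≠ 0 := hac.ae_le (Measure.ae_ne volume 0)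
    have h1 : ∀ᵐ x ∂(ofDensity f₃), ‖x‖ ≠ 1 := by
      have hv : ∀ᵐ x ∂(volume : Measure Space), ‖x‖ ≠ 1 := by
        rw [ae_iff]
        have := Measure.addHaar_sphere (volume : Measure Space) 0 1
        convert this using 2
        ext x
        simp
      exact hac.ae_le hv
    filter_upwards [hνs, h0, h1] with x h1 h2 h3
    exact ⟨norm_pos_iff.2 h2, lt_of_le_of_ne h1 h3⟩
  · have h1 := hcos μ hF hk hsupp k
    have h2 := hcos (ofDensity f₃) hFν hνk hνs k
    rw [← h2] at h1
    exact h1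
  · rcases eq_or_ne x 0 with rfl | hx
    · simp [freq]
      ring
    · simp only [hs0 x hx]
      push_cast
      rw [show (2 * ((k : ℝ) + 1) + 1) * Real.pi * x = (2 * k + 1) * Real.pi * x +
        2 * (Real.pi * x) by ring, show (2 * ((k : ℝ) - 1) + 1) * Real.pi * x =
        (2 * k + 1) * Real.pi * x - 2 * (Real.pi * x) by ring, Real.sin_add, Real.sin_sub]
      ring
  · rw [integral_const_mul, integral_const_mul, hsinc, hsinc, hk, hνk]
  · intro x hx
    have h1 := hpos x hx
    have h2 := hpos (1 - x) ⟨by linarith [hx.2], by linarith [hx.1]⟩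
    positivity
  · intro x hx
    have h1 := hpos' x hx
    have h2 := hpos' (1 - x) ⟨by linarith [hx.2], by linarith [hx.1]⟩
    positivity

/-- The radial extremizers for `(1, 2, 3)`. -/
theorem isRadial_isExtremizer_iff_isRescaling_f₃ (μ : Measure Space) :
    (IsRadial μ ∧ IsExtremizer 1 2 μ) ↔ IsRescaling μ (ofDensity f₃) := by
  have hε : |(0 : ℝ)| ≤ 1 / 8 := by norm_num
  have hd := inverseNorm_dual hε
  have hν0 := ofDensity_f₃Tilde_ne_zero hε
  have hFν := fourierNorm_le (by norm_num) (norm_fourier_f₃Tilde_mul_le hε)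
  have hfin := isFiniteMeasure_f₃Tilde 0
  rw [f₃Tilde_zero] at hd hν0 hFν hfin
  exact extremizers_eq_rescalings one_pos two_pos hν0
    (ne_top_of_le_ne_top ENNReal.ofReal_ne_top hFν) (hd _ hfin rfl le_rfl).2.1
    (P := IsRadial) (fun μ h c t => h.rescale c t) isRadial_f₃
    (fun μ hμ hu hF => ⟨(hd μ hμ hu hF).1, fun heq hr => by
      obtain ⟨h1, h2⟩ := (hd μ hμ hu hF).2.2 heq
      exact eq_f₃_of_moments hr hu (hF.trans hFν) h1 h2⟩) μ

end InverseNorm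

/-! ### Tangent inequalities for cos and sinc in the squared variable -/

section SincInequalities

lemma mul_sinc (t : ℝ) : t * Real.sinc t = Real.sin t := by
  rcases eq_or_ne t 0 with rfl | h
  · simp
  · rw [Real.sinc_of_ne_zero h]
    field_simp

/-- The value at t is the slope of the chord from 0 to t of the strictly concave sine. -/
lemma strictAntiOn_sinc : StrictAntiOn Real.sinc (Icc 0 Real.pi) := by
  intro t ht s hs hts
  have hs0 : 0 < s := ht.1.trans_lt hts
  rcases eq_or_lt_of_le ht.1 with h0 | h0
  · subst h0
    rw [Real.sinc_zero, Real.sinc_of_ne_zero hs0.ne', div_lt_one hs0]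
    exact Real.sin_lt hs0
  · have h := strictConcaveOn_sin_Icc.2 (left_mem_Icc.2 Real.pi_pos.le) hs hs0.ne
      (sub_pos.2 ((div_lt_one hs0).2 hts)) (div_pos h0 hs0) (sub_add_cancel 1 (t / s))
    simp only [Real.sin_zero, smul_eq_mul, mul_zero, zero_add, div_mul_cancel₀ _ hs0.ne'] at h
    rw [Real.sinc_of_ne_zero h0.ne', Real.sinc_of_ne_zero hs0.ne', lt_div_iff₀ h0]
    calc Real.sin s / s * t = t / s * Real.sin s := by ring
      _ < _ := h

lemma sinc_half_pi : Real.sinc (Real.pi / 2) = 2 / Real.pi := by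
  rw [Real.sinc_of_ne_zero (by positivity), Real.sin_pi_div_two]
  field_simp

/-- Up to π this is monotonicity. Beyond π the bound 1/t is already below 2/π = sinc(π/2), which is
why `s` stops at π/2. -/
lemma sinc_lt_sinc {s t : ℝ} (hs0 : 0 ≤ s) (hs : s ≤ Real.pi / 2) (hst : s < t) :
    Real.sinc t < Real.sinc s := by
  have hpi := Real.pi_pos
  rcases le_or_gt t Real.pi with ht | ht
  · exact strictAntiOn_sinc ⟨hs0, by linarith⟩ ⟨by linarith, ht⟩ hst
  · have ht0 : 0 < t := by linarith
    calc Real.sinc t ≤ |t|⁻¹ := Real.sinc_le_inv_abs ht0.ne'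
      _ = 1 / t := by rw [abs_of_pos ht0, one_div]
      _ < 2 / Real.pi := by rw [div_lt_div_iff₀ ht0 hpi]; linarith
      _ = Real.sinc (Real.pi / 2) := sinc_half_pi.symm
      _ ≤ Real.sinc s := strictAntiOn_sinc.antitoneOn ⟨hs0, by linarith⟩
          ⟨by linarith, by linarith⟩ hs

/-- The graph of `cos`, as a function of the square of the argument, lies above its tangents. -/
lemma cos_sub_cos_lt {s t : ℝ} (hs0 : 0 ≤ s) (hs : s ≤ Real.pi / 2) (ht0 : 0 ≤ t) (hts : t ≠ s) :
    Real.cos s - Real.cos t < Real.sinc s * ((t ^ 2 - s ^ 2) / 2) := by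
  have hpi := Real.pi_pos
  -- The derivative has the sign of sinc s - sinc u, negative before `s` and positive after it, so
  -- `s` is the strict minimum on [0, ∞).
  have hd : ∀ u : ℝ, HasDerivAt (fun u => Real.cos u + Real.sinc s * (u ^ 2 / 2))
      (u * (Real.sinc s - Real.sinc u)) u := fun u => by
    have h := (Real.hasDerivAt_cos u).add
      (((hasDerivAt_pow 2 u).div_const 2).const_mul (Real.sinc s))
    refine h.congr_deriv ?_
    rw [mul_sub, mul_sinc]
    simp
    ring
  have hc : ∀ D : Set ℝ, ContinuousOn (fun u => Real.cos u + Real.sinc s * (u ^ 2 / 2)) D :=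
    fun D => Continuous.continuousOn (by fun_prop)
  have key : Real.cos s + Real.sinc s * (s ^ 2 / 2) < Real.cos t + Real.sinc s * (t ^ 2 / 2) := by
    rcases lt_or_gt_of_ne hts with h | h
    · refine strictAntiOn_of_deriv_neg (convex_Icc 0 s) (hc _) (fun u hu => ?_) ⟨ht0, h.le⟩
        ⟨hs0, le_rfl⟩ h
      rw [interior_Icc] at hu
      rw [(hd u).deriv]
      exact mul_neg_of_pos_of_neg hu.1
        (sub_neg.2 (strictAntiOn_sinc ⟨hu.1.le, by linarith [hu.2]⟩ ⟨hs0, by linarith⟩ hu.2))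
    · refine strictMonoOn_of_deriv_pos (convex_Ici s) (hc _) (fun u hu => ?_)
        (mem_Ici.2 le_rfl) h.le h
      rw [interior_Ici] at hu
      rw [(hd u).deriv]
      exact mul_pos (hs0.trans_lt hu) (sub_pos.2 (sinc_lt_sinc hs0 hs hu))
  linarith [key]

/-- The graph of `sinc`, as a function of the square of the argument, lies above its tangents. -/
lemma sinc_sub_sinc_lt {s t : ℝ} (hs0 : 0 < s) (hs : s ≤ Real.pi / 2) (ht0 : 0 ≤ t)
    (hts : t ≠ s) :
    Real.sinc s - Real.sinc t <
      (Real.sinc s - Real.cos s) * (((t / s) ^ 2 - 1) / 2) := by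
  -- As sinc t is the integral of cos(tx) over [0, 1], the claim is the integrated cosine inequality
  -- with arguments sx and tx. `K` is that integral up to x, and `K 0 = 0`.
  set K : ℝ → ℝ := fun x => x * Real.sinc (t * x) - x * Real.sinc (s * x) +
    (t ^ 2 - s ^ 2) / 2 * ((x * Real.sinc (s * x) - x * Real.cos (s * x)) / s ^ 2) with hK
  have hsin : ∀ ω x : ℝ, HasDerivAt (fun x => x * Real.sinc (ω * x)) (Real.cos (ω * x)) x := by
    intro ω x
    rcases eq_or_ne ω 0 with rfl | hω
    · simpa using hasDerivAt_id' x
    · have : (fun x => x * Real.sinc (ω * x)) = fun x => Real.sin (ω * x) / ω := by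
        ext x
        rw [← mul_sinc]
        field_simp
      rw [this]
      exact hasDerivAt_sin_mul_div hω x
  have hd : ∀ x, HasDerivAt K (Real.cos (t * x) - Real.cos (s * x) +
      (t ^ 2 - s ^ 2) / 2 * (x ^ 2 * Real.sinc (s * x))) x := fun x => by
    have hcos : HasDerivAt (fun x => x * Real.cos (s * x))
        (Real.cos (s * x) - s * x * Real.sin (s * x)) x := by
      refine ((hasDerivAt_id x).mul (((hasDerivAt_id x).const_mul s).cos)).congr_deriv ?_
      simp
      ring
    refine (((hsin t x).sub (hsin s x)).add
      ((((hsin s x).sub hcos).div_const (s ^ 2)).const_mul ((t ^ 2 - s ^ 2) / 2))).congr_deriv ?_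
    rw [← mul_sinc (s * x)]
    field_simp
    ring
  have hmono : StrictMonoOn K (Icc 0 1) := by
    refine strictMonoOn_of_deriv_pos (convex_Icc 0 1)
      (fun x _ => (hd x).continuousAt.continuousWithinAt) fun x hx => ?_
    rw [interior_Icc] at hx
    rw [(hd x).deriv]
    have h := cos_sub_cos_lt (s := s * x) (t := t * x) (mul_nonneg hs0.le hx.1.le)
      (by nlinarith [hx.2]) (mul_nonneg ht0 hx.1.le)
      (fun h => hts (mul_right_cancel₀ hx.1.ne' h))
    nlinarith [h]
  have h := hmono (left_mem_Icc.2 zero_le_one) (right_mem_Icc.2 zero_le_one) zero_lt_one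
  simp only [hK, mul_one, one_mul, zero_mul, sub_zero, zero_div, mul_zero, add_zero] at h
  have e : (t ^ 2 - s ^ 2) / 2 * ((Real.sinc s - Real.cos s) / s ^ 2) =
      (Real.sinc s - Real.cos s) * (((t / s) ^ 2 - 1) / 2) := by
    field_simp
  linarith

/-- At t = 2s the tangent inequality bounds the positive number sinc s - sinc 2s by a positive
multiple of sinc s - cos s. -/
lemma cos_lt_sinc {s : ℝ} (hs0 : 0 < s) (hs : s ≤ Real.pi / 2) : Real.cos s < Real.sinc s := by
  have h1 := sinc_sub_sinc_lt hs0 hs (t := 2 * s) (by linarith) (by linarith)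
  have h2 := sinc_lt_sinc hs0.le hs (t := 2 * s) (by linarith)
  rw [mul_div_cancel_right₀ _ hs0.ne'] at h1
  linarith

end SincInequalities

/-! ### The threshold exponent for the sphere -/

section Exponent

/-- The threshold exponent for the sphere. -/
def sphereExponent : ℝ := (Real.pi / 2 - 1)⁻¹

lemma sphereExponent_mul : sphereExponent * (Real.pi / 2 - 1) = 1 :=
  inv_mul_cancel₀ (by linarith [Real.pi_gt_three])

lemma sphereExponent_bounds : 5 / 3 < sphereExponent ∧ sphereExponent < 2 := by
  have h3 := Real.pi_gt_three
  have h4 := Real.pi_lt_d2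
  have h : 0 < Real.pi / 2 - 1 := by linarith
  unfold sphereExponent
  constructor
  · rw [← one_div, lt_div_iff₀ h]
    linarith
  · rw [← one_div, div_lt_iff₀ h]
    linarith

/-- Up to a positive factor, the derivative of `x ↦ (1 - sinc x) / x ^ sphereExponent`. -/
def sphereSlope (x : ℝ) : ℝ :=
  Real.sin x - x * Real.cos x - sphereExponent * (x - Real.sin x)

lemma hasDerivAt_sphereSlope (x : ℝ) : HasDerivAt sphereSlope
    (2 * Real.sin (x / 2) * (x * Real.cos (x / 2) - sphereExponent * Real.sin (x / 2))) x := by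
  refine (((Real.hasDerivAt_sin x).sub ((hasDerivAt_id x).mul (Real.hasDerivAt_cos x))).sub
    (((hasDerivAt_id x).sub (Real.hasDerivAt_sin x)).const_mul sphereExponent)).congr_deriv ?_
  have h1 : Real.sin x = 2 * Real.sin (x / 2) * Real.cos (x / 2) := by
    rw [← Real.sin_two_mul]; ring_nf
  have h2 : Real.cos x = 1 - 2 * Real.sin (x / 2) ^ 2 := by
    have := Real.cos_two_mul (x / 2)
    rw [show 2 * (x / 2) = x by ring] at this
    nlinarith [Real.sin_sq_add_cos_sq (x / 2)]
  simp only [id]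
  rw [h1, h2]
  ring

/-- The function x cot(x/2) is decreasing. Cleared of denominators this is the comparison of sinc at
(v - u)/2 and (v + u)/2, expanded by the addition formulas. -/
lemma mul_cos_half_lt {u v : ℝ} (hu : 0 < u) (huv : u < v) (hv : v ≤ u + Real.pi)
    (hv2 : v < 2 * Real.pi)
    (h : u * Real.cos (u / 2) ≤ sphereExponent * Real.sin (u / 2)) :
    v * Real.cos (v / 2) < sphereExponent * Real.sin (v / 2) := by
  have hsu : 0 < Real.sin (u / 2) := Real.sin_pos_of_pos_of_lt_pi (by linarith) (by linarith)
  have hsv : 0 < Real.sin (v / 2) := Real.sin_pos_of_pos_of_lt_pi (by linarith) (by linarith)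
  have h1 := sinc_lt_sinc (s := v / 2 - u / 2) (t := v / 2 + u / 2) (by linarith) (by linarith)
    (by linarith)
  have h2 := mul_sinc (v / 2 - u / 2)
  have h3 := mul_sinc (v / 2 + u / 2)
  have h4 : 0 < (v / 2 + u / 2) * (v / 2 - u / 2) *
      (Real.sinc (v / 2 - u / 2) - Real.sinc (v / 2 + u / 2)) :=
    mul_pos (mul_pos (by linarith) (by linarith)) (sub_pos.2 h1)
  rw [show (v / 2 + u / 2) * (v / 2 - u / 2) *
      (Real.sinc (v / 2 - u / 2) - Real.sinc (v / 2 + u / 2)) =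
      (v / 2 + u / 2) * ((v / 2 - u / 2) * Real.sinc (v / 2 - u / 2)) -
      (v / 2 - u / 2) * ((v / 2 + u / 2) * Real.sinc (v / 2 + u / 2)) by ring, h2, h3,
    Real.sin_sub, Real.sin_add] at h4
  have h5 : v * Real.cos (v / 2) * Real.sin (u / 2) <
      u * Real.cos (u / 2) * Real.sin (v / 2) := by nlinarith
  have h6 := mul_le_mul_of_nonneg_right h hsv.le
  refine lt_of_mul_lt_mul_right (h5.trans_le ?_) hsu.le
  linarith

lemma sphereSlope_lt_of_le {x y : ℝ} (hx : 0 < x) (hxy : x < y) (hy : y ≤ x + Real.pi)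
    (hy2 : y < 2 * Real.pi)
    (h : x * Real.cos (x / 2) ≤ sphereExponent * Real.sin (x / 2)) :
    sphereSlope y < sphereSlope x := by
  refine strictAntiOn_of_deriv_neg (convex_Icc x y)
    (fun x _ => (hasDerivAt_sphereSlope x).continuousAt.continuousWithinAt) (fun u hu => ?_)
    (left_mem_Icc.2 hxy.le) (right_mem_Icc.2 hxy.le) hxy
  rw [interior_Icc] at hu
  rw [(hasDerivAt_sphereSlope u).deriv]
  have := mul_cos_half_lt hx hu.1 (by linarith [hu.2]) (by linarith [hu.2]) h
  have hs : 0 < Real.sin (u / 2) :=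
    Real.sin_pos_of_pos_of_lt_pi (by linarith [hu.1]) (by linarith [hu.2])
  exact mul_neg_of_pos_of_neg (by linarith) (by linarith)

lemma sphereSlope_half_pi : sphereSlope (Real.pi / 2) = 0 := by
  rw [sphereSlope, Real.sin_pi_div_two, Real.cos_pi_div_two, sphereExponent_mul]
  ring

/-- If the function has started to decrease by x, it keeps decreasing to its zero at π/2; otherwise
it has increased from its zero at 0. Either way it is positive. -/
lemma sphereSlope_pos {x : ℝ} (hx : 0 < x) (hx2 : x < Real.pi / 2) : 0 < sphereSlope x := by
  have hpi := Real.pi_pos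
  rcases le_or_gt (x * Real.cos (x / 2)) (sphereExponent * Real.sin (x / 2)) with h | h
  · have := sphereSlope_lt_of_le hx hx2 (by linarith) (by linarith) h
    rwa [sphereSlope_half_pi] at this
  · have h0 : sphereSlope 0 = 0 := by simp [sphereSlope]
    rw [← h0]
    refine strictMonoOn_of_deriv_pos (convex_Icc 0 x)
      (fun x _ => (hasDerivAt_sphereSlope x).continuousAt.continuousWithinAt) (fun u hu => ?_)
      (left_mem_Icc.2 hx.le) (right_mem_Icc.2 hx.le) hx
    rw [interior_Icc] at hu
    rw [(hasDerivAt_sphereSlope u).deriv]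
    have hs : 0 < Real.sin (u / 2) :=
      Real.sin_pos_of_pos_of_lt_pi (by linarith [hu.1]) (by linarith [hu.2])
    refine mul_pos (by linarith) (sub_pos.2 (lt_of_not_ge fun h' => ?_))
    exact (mul_cos_half_lt hu.1 hu.2 (by linarith [hu.1]) (by linarith) h').not_gt h

lemma sphereSlope_neg {x : ℝ} (hx : Real.pi / 2 < x) : sphereSlope x < 0 := by
  have h3 := Real.pi_gt_three
  have h4 := Real.pi_lt_d2
  obtain ⟨h5, h6⟩ := sphereExponent_bounds
  rcases le_or_gt x (3 * Real.pi / 2) with h | h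
  · rw [← sphereSlope_half_pi]
    refine sphereSlope_lt_of_le (by linarith) hx (by linarith) (by linarith) ?_
    rw [show Real.pi / 2 / 2 = Real.pi / 4 by ring, Real.cos_pi_div_four, Real.sin_pi_div_four]
    exact mul_le_mul_of_nonneg_right (by linarith) (by positivity)
  -- Past 3π/2 > 9/2 crude bounds suffice: the expression is at most (p + 1) - (p - 1)x with p the
  -- threshold, negative because p > 5/3.
  · unfold sphereSlope
    have h7 := Real.neg_one_le_cos x
    have h8 := Real.sin_le_one x
    nlinarith [mul_nonneg (show (0 : ℝ) ≤ x by linarith) (show 0 ≤ Real.cos x + 1 by linarith),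
      mul_nonneg (show 0 ≤ sphereExponent + 1 by linarith) (show 0 ≤ 1 - Real.sin x by linarith),
      mul_pos (show 0 < x - 9 / 2 by linarith) (show 0 < sphereExponent - 1 by linarith)]

/-- With p the threshold, the logarithm of (x - sin x)/x^(p+1) has a derivative with the sign of
`sphereSlope`, so π/2 is its unique maximum. -/
lemma sub_sin_lt {x : ℝ} (hx : 0 < x) (hx2 : x ≠ Real.pi / 2) :
    x - Real.sin x <
      (Real.pi / 2 - 1) * (x / (Real.pi / 2)) ^ (sphereExponent + 1) := by
  have hpi := Real.pi_pos
  have hpi3 := Real.pi_gt_three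
  have hsin : ∀ {x : ℝ}, 0 < x → 0 < x - Real.sin x := fun h => sub_pos.2 (Real.sin_lt h)
  set L : ℝ → ℝ := fun x => Real.log (x - Real.sin x) - (sphereExponent + 1) * Real.log x with hL
  have hd : ∀ u : ℝ, 0 < u →
      HasDerivAt L (sphereSlope u / (u * (u - Real.sin u))) u := fun u hu => by
    have h1 := (hasDerivAt_id' u).sub (Real.hasDerivAt_sin u)
    refine ((h1.log (hsin hu).ne').sub
      ((Real.hasDerivAt_log hu.ne').const_mul (sphereExponent + 1))).congr_deriv ?_
    have := (hsin hu).ne'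
    simp only [Pi.sub_apply]
    rw [sphereSlope]
    field_simp
    ring
  have key : L x < L (Real.pi / 2) := by
    rcases lt_or_gt_of_ne hx2 with h | h
    · refine strictMonoOn_of_deriv_pos (convex_Icc x (Real.pi / 2))
        (fun u hu => (hd u (hx.trans_le hu.1)).continuousAt.continuousWithinAt) (fun u hu => ?_)
        (left_mem_Icc.2 h.le) (right_mem_Icc.2 h.le) h
      rw [interior_Icc] at hu
      have hu0 := hx.trans hu.1
      rw [(hd u hu0).deriv]
      exact div_pos (sphereSlope_pos hu0 hu.2) (mul_pos hu0 (hsin hu0))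
    · refine strictAntiOn_of_deriv_neg (convex_Icc (Real.pi / 2) x)
        (fun u hu => (hd u (by linarith [hu.1])).continuousAt.continuousWithinAt)
        (fun u hu => ?_) (left_mem_Icc.2 h.le) (right_mem_Icc.2 h.le) h
      rw [interior_Icc] at hu
      have hu0 : 0 < u := by linarith [hu.1]
      rw [(hd u hu0).deriv]
      exact div_neg_of_neg_of_pos (sphereSlope_neg hu.1) (mul_pos hu0 (hsin hu0))
  have hq : 0 < Real.pi / 2 - 1 := by linarith
  have hr : 0 < x / (Real.pi / 2) := by positivity
  rw [← Real.log_lt_log_iff (hsin hx) (mul_pos hq (Real.rpow_pos_of_pos hr _)),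
    Real.log_mul hq.ne' (Real.rpow_pos_of_pos hr _).ne', Real.log_rpow hr,
    Real.log_div hx.ne' (by positivity)]
  simp only [hL, Real.sin_pi_div_two] at key
  linarith

end Exponent

/-! ### Comparison of sinc with powers -/

section Majorant

/-- Bernoulli's inequality for r^p with exponent q/p ≥ 1. It passes from the critical exponent (2 or
the threshold) to all larger ones. -/
lemma rpow_sub_one_le {p q r : ℝ} (hp : 0 < p) (hpq : p ≤ q) (hr : 0 ≤ r) :
    q * (r ^ p - 1) ≤ p * (r ^ q - 1) := by
  have h := one_add_mul_self_le_rpow_one_add (s := r ^ p - 1)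
    (by linarith [Real.rpow_nonneg hr p]) (p := q / p) ((one_le_div hp).2 hpq)
  rw [add_sub_cancel, ← Real.rpow_mul hr, mul_div_cancel₀ _ hp.ne'] at h
  have := mul_le_mul_of_nonneg_left h hp.le
  have e : p * (1 + q / p * (r ^ p - 1)) = p + q * (r ^ p - 1) := by
    field_simp
  linarith

lemma sinc_majorant_of_two_le {α s r : ℝ} (hα : 2 ≤ α) (hs0 : 0 < s) (hs : s ≤ Real.pi / 2)
    (hr : 0 ≤ r) (hr1 : r ≠ 1) :
    α * (Real.sinc s - Real.sinc (s * r)) < (Real.sinc s - Real.cos s) * (r ^ α - 1) := by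
  have h1 := sinc_sub_sinc_lt hs0 hs (mul_nonneg hs0.le hr)
    (fun h => hr1 (mul_left_cancel₀ hs0.ne' (h.trans (mul_one s).symm)))
  rw [mul_div_cancel_left₀ _ hs0.ne'] at h1
  have h2 := rpow_sub_one_le two_pos hα hr
  rw [Real.rpow_two] at h2
  have h3 := sub_pos.2 (cos_lt_sinc hs0 hs)
  nlinarith [mul_le_mul_of_nonneg_left h2 h3.le,
    mul_lt_mul_of_pos_left h1 (show 0 < α by linarith)]

lemma sinc_majorant_half_pi {α r : ℝ} (hα : sphereExponent ≤ α) (hr : 0 < r) (hr1 : r ≠ 1) :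
    α * (Real.sinc (Real.pi / 2) - Real.sinc (Real.pi / 2 * r)) <
      (Real.sinc (Real.pi / 2) - Real.cos (Real.pi / 2)) * (r ^ α - 1) := by
  have hpi := Real.pi_pos
  have hp : 0 < sphereExponent := by linarith [sphereExponent_bounds.1]
  have hx : Real.pi / 2 * r ≠ Real.pi / 2 := fun h =>
    hr1 (mul_left_cancel₀ (by positivity) (h.trans (mul_one _).symm))
  have h1 := sub_sin_lt (mul_pos (by positivity : 0 < Real.pi / 2) hr) hx
  rw [mul_div_cancel_left₀ _ (by positivity : Real.pi / 2 ≠ 0), Real.rpow_add_one hr.ne',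
    ← mul_sinc] at h1
  have h2 := rpow_sub_one_le hp hα hr.le
  have h3 : Real.pi / 2 * (1 - Real.sinc (Real.pi / 2 * r)) <
      (Real.pi / 2 - 1) * r ^ sphereExponent := by
    refine lt_of_mul_lt_mul_right (a := r) ?_ hr.le
    linarith
  have h4 := mul_lt_mul_of_pos_left h3 (mul_pos hp (hp.trans_le hα))
  have h5 := sphereExponent_mul
  rw [Real.cos_pi_div_two, sub_zero, sinc_half_pi]
  have h6 : sphereExponent * (α * (Real.pi / 2 * (2 / Real.pi - Real.sinc (Real.pi / 2 * r)))) <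
      sphereExponent * (r ^ α - 1) := by
    refine lt_of_lt_of_le ?_ h2
    have e : Real.pi / 2 * (2 / Real.pi - Real.sinc (Real.pi / 2 * r)) =
      1 - Real.pi / 2 * Real.sinc (Real.pi / 2 * r) := by field_simp
    rw [e]
    have e2 : sphereExponent * α * ((Real.pi / 2 - 1) * r ^ sphereExponent) =
      α * r ^ sphereExponent := by linear_combination α * r ^ sphereExponent * h5
    rw [e2] at h4
    have e3 : sphereExponent * α * (Real.pi / 2) = α + sphereExponent * α := by
      linear_combination α * h5
    nlinarith
  have h7 := lt_of_mul_lt_mul_left h6 hp.le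
  calc α * (2 / Real.pi - Real.sinc (Real.pi / 2 * r)) =
      2 / Real.pi * (α * (Real.pi / 2 * (2 / Real.pi - Real.sinc (Real.pi / 2 * r)))) := by
        field_simp
    _ < _ := mul_lt_mul_of_pos_left h7 (by positivity)

end Majorant

/-! ### Extremality and radial uniqueness of the sphere -/

section SphereMeasure

instance : IsFiniteMeasure μ₄ := by
  unfold μ₄
  infer_instance

lemma integral_μ₄ (F : Space → ℝ) :
    ∫ x, F x ∂μ₄ = ∫ ω, F (ω : Space) ∂(volume : Measure Space).toSphere :=
  (MeasurableEmbedding.subtype_coe Metric.isClosed_sphere.measurableSet).integral_map F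

lemma μ₄_univ : μ₄ univ = ENNReal.ofReal (4 * Real.pi) := by
  rw [μ₄, Measure.map_apply measurable_subtype_coe .univ, preimage_univ, toSphere_univ]

lemma μ₄_ne_zero : μ₄ ≠ 0 := by
  intro h
  have := μ₄_univ
  rw [h] at this
  simp at this
  linarith [Real.pi_pos]

lemma ae_norm_eq_one_μ₄ : ∀ᵐ x ∂μ₄, ‖x‖ = 1 := by
  rw [μ₄, ae_map_iff measurable_subtype_coe.aemeasurable
    (measurableSet_eq_fun measurable_norm measurable_const)]
  exact ae_of_all _ fun ω => norm_eq_of_mem_sphere ω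

lemma fourier_μ₄ (ξ : Space) :
    fourier μ₄ ξ = ((4 * Real.pi * Real.sinc (2 * Real.pi * ‖ξ‖) : ℝ) : ℂ) := by
  have e : ∀ ω : Metric.sphere (0 : Space) 1, 2 * Real.pi * inner ℝ (ω : Space) ξ =
      inner ℝ ((2 * Real.pi) • ξ) (ω : Space) := fun ω => by
    rw [real_inner_smul_left, real_inner_comm]
  apply Complex.ext
  · rw [fourier_re, integral_μ₄, Complex.ofReal_re]
    simp_rw [e]
    rw [integral_sphere_cos, norm_smul, Real.norm_of_nonneg (by positivity)]
  · rw [fourier_im, integral_μ₄, Complex.ofReal_im]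
    simp_rw [e]
    rw [integral_sphere_sin, neg_zero]

lemma isRadial_μ₄ : IsRadial μ₄ :=
  isRadial_of_fourier fun ξ η h => by rw [fourier_μ₄, fourier_μ₄, h]

lemma map_norm_eq_of_norm_eq_one {μ : Measure Space} (h : ∀ᵐ x ∂μ, ‖x‖ = 1) :
    μ.map (‖·‖) = μ univ • Measure.dirac 1 := by
  rw [Measure.map_congr (g := fun _ => (1 : ℝ)) h, Measure.map_const]

lemma integral_sinc_μ₄ (s : ℝ) :
    ∫ x, Real.sinc (s * ‖x‖) ∂μ₄ = 4 * Real.pi * Real.sinc s := by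
  have h : (fun x : Space => Real.sinc (s * ‖x‖)) =ᵐ[μ₄] fun _ => Real.sinc s := by
    filter_upwards [ae_norm_eq_one_μ₄] with x hx
    rw [hx, mul_one]
  rw [integral_congr_ae h, integral_const, Measure.real, μ₄_univ,
    ENNReal.toReal_ofReal (by positivity), smul_eq_mul]

lemma norm_fourier_μ₄_mul_le {β s : ℝ} (hs0 : 0 < s)
    (hmax : ∀ t, 0 ≤ t → t ^ β * |Real.sinc t| ≤ s ^ β * Real.sinc s) (ξ : Space) :
    ‖fourier μ₄ ξ‖ * ‖ξ‖ ^ β ≤ 4 * Real.pi * Real.sinc s * (s / (2 * Real.pi)) ^ β := by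
  have hpi := Real.pi_pos
  have h := hmax (2 * Real.pi * ‖ξ‖) (by positivity)
  rw [Real.mul_rpow (by positivity) (norm_nonneg ξ)] at h
  rw [fourier_μ₄, Complex.norm_real, Real.norm_eq_abs, abs_mul,
    abs_of_pos (by positivity : 0 < 4 * Real.pi), Real.div_rpow hs0.le (by positivity)]
  have hq : 0 < (2 * Real.pi) ^ β := Real.rpow_pos_of_pos (by positivity) β
  rw [mul_div_assoc', le_div_iff₀ hq]
  nlinarith [mul_le_mul_of_nonneg_left h (by positivity : 0 ≤ 4 * Real.pi)]

/-- A measure supported on the origin and the unit sphere that has the same mass and the same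
`sinc` integral as `μ₄` gives no mass to the origin. -/
lemma ae_norm_eq_one {μ : Measure Space} [IsFiniteMeasure μ] (hu : μ univ = μ₄ univ) {s : ℝ}
    (hs0 : 0 < s) (hintegral : ∫ x, Real.sinc (s * ‖x‖) ∂μ = 4 * Real.pi * Real.sinc s)
    (hsupp : ∀ᵐ x ∂μ, ‖x‖ = 0 ∨ ‖x‖ = 1) : ∀ᵐ x ∂μ, ‖x‖ = 1 := by
  have hi : Integrable (fun x : Space => Real.sinc (s * ‖x‖)) μ :=
    Integrable.of_bound (Continuous.aestronglyMeasurable (by fun_prop)) 1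
      (ae_of_all _ fun x => Real.abs_sinc_le_one _)
  have h0 : ∫ x, (Real.sinc (s * ‖x‖) - Real.sinc s) ∂μ = 0 := by
    rw [integral_sub hi (integrable_const _), hintegral, integral_const, Measure.real, hu, μ₄_univ,
      ENNReal.toReal_ofReal (by positivity), smul_eq_mul, sub_self]
  have hlt : Real.sinc s < 1 := by
    rw [← Real.sinc_zero]
    exact sinc_lt_sinc le_rfl (by positivity) hs0
  have hnn : 0 ≤ᵐ[μ] fun x : Space => Real.sinc (s * ‖x‖) - Real.sinc s := by
    filter_upwards [hsupp] with x hx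
    rcases hx with h | h <;> simp [h, hlt.le]
  have h1 := (integral_eq_zero_iff_of_nonneg_ae hnn (hi.sub (integrable_const _))).1 h0
  filter_upwards [hsupp, h1] with x hx hx1
  refine hx.resolve_left fun h => ?_
  simp [h] at hx1
  linarith

/-- One test function, sinc(s‖x‖), gives the whole certificate. The condition `h0` at the origin is
not strict, so the minorant may touch there as well; `ae_norm_eq_one` then excludes mass at 0, and a
radial measure on the sphere is determined by its mass. -/
lemma isRadial_isExtremizer_iff_of_majorant {α β s : ℝ} (hα : 0 < α) (hβ : 0 < β) (hs0 : 0 < s)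
    (hs : s ≤ Real.pi / 2)
    (hmax : ∀ t, 0 ≤ t → t ^ β * |Real.sinc t| ≤ s ^ β * Real.sinc s)
    (h0 : α * (Real.sinc s - 1) ≤ -(Real.sinc s - Real.cos s))
    (hmaj : ∀ r, 0 < r → r ≠ 1 →
      α * (Real.sinc s - Real.sinc (s * r)) < (Real.sinc s - Real.cos s) * (r ^ α - 1))
    (μ : Measure Space) : (IsRadial μ ∧ IsExtremizer α β μ) ↔ IsRescaling μ μ₄ := by
  have hpi := Real.pi_pos
  have hD : 0 < Real.sinc s - Real.cos s := sub_pos.2 (cos_lt_sinc hs0 hs)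
  have hsinc : 0 < Real.sinc s :=
    (Real.cos_nonneg_of_mem_Icc ⟨by linarith, hs⟩).trans_lt (cos_lt_sinc hs0 hs)
  have hFν := fourierNorm_le hβ.le (norm_fourier_μ₄_mul_le hs0 hmax)
  set A := 4 * Real.pi * Real.sinc s * (s / (2 * Real.pi)) ^ β with hA
  have hA0 : 0 ≤ A := by positivity
  -- Tangency at r = 1 forces this multiplier: r^α has slope α there, and -sinc(sr) has slope sinc s
  -- - cos s.
  set d := α / (Real.sinc s - Real.cos s) with hd
  have hd0 : 0 < d := div_pos hα hD
  have hle : ∀ r, 0 ≤ r → 1 + d * Real.sinc s - d * Real.sinc (s * r) ≤ r ^ α ∧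
      (1 + d * Real.sinc s - d * Real.sinc (s * r) = r ^ α → r = 0 ∨ r = 1) := fun r hr => by
    have e : 1 + d * Real.sinc s - d * Real.sinc (s * r) =
        1 + α * (Real.sinc s - Real.sinc (s * r)) / (Real.sinc s - Real.cos s) := by
      rw [hd]; ring
    rw [e]
    rcases eq_or_lt_of_le hr with rfl | hr
    · refine ⟨?_, fun _ => Or.inl rfl⟩
      rw [mul_zero, Real.sinc_zero, Real.zero_rpow hα.ne']
      have : α * (Real.sinc s - 1) / (Real.sinc s - Real.cos s) ≤ -1 := by
        rw [div_le_iff₀ hD]; linarith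
      linarith
    · rcases eq_or_ne r 1 with rfl | hr1
      · simp
      · have : α * (Real.sinc s - Real.sinc (s * r)) / (Real.sinc s - Real.cos s) < r ^ α - 1 := by
          rw [div_lt_iff₀ hD]; linarith [hmaj r hr hr1]
        exact ⟨by linarith, fun h => by linarith⟩
  have hm : Measurable fun x : Space => ‖x‖ ^ α :=
    ((continuous_rpow_of_nonneg hα.le).comp continuous_norm).measurable
  have hρ : 2 * Real.pi * (s / (2 * Real.pi)) = s := by field_simp
  have hdual := fun (μ : Measure Space) (_ : IsFiniteMeasure μ) (hu : μ univ = μ₄ univ)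
      (hF : fourierNorm β μ ≤ fourierNorm β μ₄) =>
    lintegral_le_of_dual (ι := Unit) hu hm (fun x => Real.rpow_nonneg (norm_nonneg x) α)
      (c := 1 + d * Real.sinc s) (d := fun _ => d) (e := fun _ x => Real.sinc (s * ‖x‖))
      (B := fun _ => 1) (fun _ => hd0) (fun _ x => Real.abs_sinc_le_one _)
      (fun _ => by fun_prop) (Summable.of_finite)
      (fun x => by simpa using (hle ‖x‖ (norm_nonneg x)).1)
      (by
        filter_upwards [ae_norm_eq_one_μ₄] with x hx
        simp [hx])
      (fun _ => by
        have := integral_sinc_le hβ.le hA0 (hF.trans hFν) (ρ := s / (2 * Real.pi)) (by positivity)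
        rw [hρ, hA, mul_div_cancel_right₀ _ (by positivity)] at this
        rwa [integral_sinc_μ₄])
  have hmom := moment_eq_lintegral_ofReal (E := Space) hα.le
  refine extremizers_eq_rescalings hα hβ μ₄_ne_zero
    (ne_top_of_le_ne_top ENNReal.ofReal_ne_top hFν)
    (by rw [hmom]; exact (hdual _ inferInstance rfl le_rfl).2.1)
    (P := IsRadial) (fun μ h c t => h.rescale c t) isRadial_μ₄ (fun μ hμ hu hF => ?_) μ
  rw [hmom, hmom]
  obtain ⟨h1, -, h3⟩ := hdual μ hμ hu hF
  refine ⟨h1, fun heq hr => ?_⟩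
  obtain ⟨h4, h5⟩ := h3 heq
  have h6 := ae_norm_eq_one hu hs0 ((h4 ()).trans (integral_sinc_μ₄ s)) (by
    filter_upwards [h5] with x hx
    exact (hle ‖x‖ (norm_nonneg x)).2 (by simpa using hx.symm))
  refine eq_of_map_norm hr isRadial_μ₄ ?_
  rw [map_norm_eq_of_norm_eq_one h6, map_norm_eq_of_norm_eq_one ae_norm_eq_one_μ₄, hu]

/-- Compactness gives a maximiser on [0, π/2]. Beyond, t^(β-1)|sin t| ≤ t^(β-1), which for β < 1 is
at most the value at t = π/2. -/
lemma exists_max_rpow_mul_sinc {β : ℝ} (hβ0 : 0 < β) (hβ1 : β < 1) :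
    ∃ s, 0 < s ∧ s ≤ Real.pi / 2 ∧
      ∀ t, 0 ≤ t → t ^ β * |Real.sinc t| ≤ s ^ β * Real.sinc s := by
  have hpi := Real.pi_pos
  have hc : Continuous fun t : ℝ => t ^ β * Real.sinc t :=
    (continuous_rpow_of_nonneg hβ0.le).mul Real.continuous_sinc
  have hpos : ∀ t ∈ Icc 0 (Real.pi / 2), 0 ≤ Real.sinc t := fun t ht => by
    rcases eq_or_lt_of_le ht.1 with rfl | h
    · simp
    · exact (Real.cos_nonneg_of_mem_Icc ⟨by linarith, ht.2⟩).trans (cos_lt_sinc h ht.2).le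
  obtain ⟨s, hs, hmax⟩ := isCompact_Icc.exists_isMaxOn (nonempty_Icc.2 (by positivity))
    (hc.continuousOn (s := Icc 0 (Real.pi / 2)))
  have hend : (Real.pi / 2) ^ (β - 1) ≤ s ^ β * Real.sinc s := by
    have h : (Real.pi / 2) ^ β * Real.sinc (Real.pi / 2) ≤ s ^ β * Real.sinc s :=
      hmax (right_mem_Icc.2 (by positivity))
    rwa [sinc_half_pi, ← inv_div Real.pi 2, ← div_eq_mul_inv,
      ← Real.rpow_sub_one (by positivity)] at h
  have hs0 : s ≠ 0 := by
    rintro rfl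
    rw [Real.zero_rpow hβ0.ne', zero_mul] at hend
    exact (Real.rpow_pos_of_pos (by positivity) _).not_ge hend
  refine ⟨s, lt_of_le_of_ne hs.1 hs0.symm, hs.2, fun t ht => ?_⟩
  rcases le_or_gt t (Real.pi / 2) with h | h
  · rw [abs_of_nonneg (hpos t ⟨ht, h⟩)]
    exact hmax ⟨ht, h⟩
  · refine le_trans ?_ hend
    have ht0 : 0 < t := by linarith
    have h1 : t ^ β * |Real.sinc t| = t ^ (β - 1) * |Real.sin t| := by
      rw [Real.rpow_sub_one ht0.ne', ← mul_sinc, abs_mul, abs_of_pos ht0]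
      field_simp
    rw [h1]
    calc t ^ (β - 1) * |Real.sin t| ≤ t ^ (β - 1) * 1 :=
          mul_le_mul_of_nonneg_left (Real.abs_sin_le_one t) (Real.rpow_nonneg ht _)
      _ = t ^ (β - 1) := mul_one _
      _ ≤ _ := Real.rpow_le_rpow_of_nonpos (by positivity) h.le (by linarith)

theorem isRadial_isExtremizer_iff_isRescaling_μ₄ {α β : ℝ}
    (h : (β = 1 ∧ (Real.pi / 2 - 1)⁻¹ ≤ α) ∨ (2 ≤ α ∧ 0 < β ∧ β < 1)) (μ : Measure Space) :
    (IsRadial μ ∧ IsExtremizer α β μ) ↔ IsRescaling μ μ₄ := by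
  have hpi := Real.pi_pos
  rcases h with ⟨rfl, hα⟩ | ⟨hα, hβ0, hβ1⟩
  · have hα0 : 0 < α := by
      have := sphereExponent_bounds.1
      have : sphereExponent ≤ α := hα
      linarith
    refine isRadial_isExtremizer_iff_of_majorant hα0 one_pos (s := Real.pi / 2) (by positivity)
      le_rfl (fun t ht => ?_) ?_ (fun r hr hr1 => sinc_majorant_half_pi hα hr hr1) μ
    · have e : t * |Real.sinc t| = |Real.sin t| := by rw [← mul_sinc, abs_mul, abs_of_nonneg ht]
      rw [Real.rpow_one, Real.rpow_one, mul_sinc, Real.sin_pi_div_two, e]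
      exact Real.abs_sin_le_one t
    · rw [Real.cos_pi_div_two, sinc_half_pi, sub_zero]
      have h1 : 1 ≤ α * (Real.pi / 2 - 1) := by
        have := mul_le_mul_of_nonneg_right (show sphereExponent ≤ α from hα)
          (show 0 ≤ Real.pi / 2 - 1 by linarith [Real.pi_gt_three])
        rwa [sphereExponent_mul] at this
      have e : α * (2 / Real.pi - 1) = -(2 / Real.pi * (α * (Real.pi / 2 - 1))) := by
        field_simp
        ring
      rw [e, neg_le_neg_iff]
      exact le_mul_of_one_le_right (by positivity) h1
  · obtain ⟨s, hs0, hs, hmax⟩ := exists_max_rpow_mul_sinc hβ0 hβ1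
    refine isRadial_isExtremizer_iff_of_majorant (by linarith) hβ0 hs0 hs hmax ?_
      (fun r hr hr1 => sinc_majorant_of_two_le hα hs0 hs hr.le hr1) μ
    have := sinc_majorant_of_two_le hα hs0 hs le_rfl zero_ne_one
    rw [mul_zero, Real.sinc_zero, Real.zero_rpow (by linarith)] at this
    linarith

end SphereMeasure

end FourierUncertainty

end

/-! ### The classification of extremizers -/

theorem mainTheorem7 :
    -- case (1): uniqueness up to dilation and normalization
    (∀ α : ℝ, 2 ≤ α → ∀ μ : MeasureTheory.Measure ℝ,
      FourierUncertainty.IsExtremizer α 1 μ ↔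
        FourierUncertainty.IsRescaling μ
          (FourierUncertainty.ofDensity FourierUncertainty.f₁)) ∧
    -- cases (2)-(4): uniqueness among radial measures
    (∀ μ : MeasureTheory.Measure ℝ,
      (FourierUncertainty.IsRadial μ ∧ FourierUncertainty.IsExtremizer 1 2 μ) ↔
        FourierUncertainty.IsRescaling μ
          (FourierUncertainty.ofDensity FourierUncertainty.f₂)) ∧
    (∀ μ : MeasureTheory.Measure (EuclideanSpace ℝ (Fin 3)),
      (FourierUncertainty.IsRadial μ ∧ FourierUncertainty.IsExtremizer 1 2 μ) ↔
        FourierUncertainty.IsRescaling μ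
          (FourierUncertainty.ofDensity FourierUncertainty.f₃)) ∧
    (∀ α β : ℝ,
      ((β = 1 ∧ (Real.pi / 2 - 1)⁻¹ ≤ α) ∨ (2 ≤ α ∧ 0 < β ∧ β < 1)) →
      ∀ μ : MeasureTheory.Measure (EuclideanSpace ℝ (Fin 3)),
        (FourierUncertainty.IsRadial μ ∧ FourierUncertainty.IsExtremizer α β μ) ↔
          FourierUncertainty.IsRescaling μ FourierUncertainty.μ₄) ∧
    -- non-radial extremizers: the explicit family in case (2), and existence in case (3)
    (∃ ε₀ : ℝ, 0 < ε₀ ∧ ∀ ε : ℝ, |ε| < ε₀ →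
      (∀ x : ℝ, 0 ≤ FourierUncertainty.f₂Tilde ε x) ∧
      FourierUncertainty.IsExtremizer 1 2
        (FourierUncertainty.ofDensity (FourierUncertainty.f₂Tilde ε)) ∧
      (ε ≠ 0 → ¬ FourierUncertainty.IsRadial
        (FourierUncertainty.ofDensity (FourierUncertainty.f₂Tilde ε)))) ∧
    (∃ μ : MeasureTheory.Measure (EuclideanSpace ℝ (Fin 3)),
      FourierUncertainty.IsExtremizer 1 2 μ ∧ ¬ FourierUncertainty.IsRadial μ) := by
  refine ⟨fun α hα μ => FourierUncertainty.isExtremizer_iff_isRescaling_f₁ hα μ,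
    FourierUncertainty.isRadial_isExtremizer_iff_isRescaling_f₂,
    FourierUncertainty.isRadial_isExtremizer_iff_isRescaling_f₃,
    fun α β h μ => FourierUncertainty.isRadial_isExtremizer_iff_isRescaling_μ₄ h μ,
    ⟨1 / 40, by norm_num, fun ε hε => ⟨FourierUncertainty.f₂Tilde_nonneg hε.le,
      FourierUncertainty.isExtremizer_f₂Tilde hε.le,
      FourierUncertainty.not_isRadial_f₂Tilde hε.le⟩⟩,
    ⟨FourierUncertainty.ofDensity (FourierUncertainty.f₃Tilde (1 / 8)), ?_, ?_⟩⟩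
  · exact FourierUncertainty.isExtremizer_f₃Tilde (abs_of_pos (by norm_num)).le
  · exact FourierUncertainty.not_isRadial_f₃Tilde (abs_of_pos (by norm_num)).le (by norm_num)
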